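/- Let $S$ be a countable set, $p\in\,]0,1[$, $\beta_p=(1-p)\delta_0+p\delta_1$, $\lambda_p^S=\beta_p^{\otimes S}$ on $\{0,1\}^S$, and let $\gamma$ be the standard Gaussian measure on $\mathbb R$, with density $g(x)=\frac1{\sqrt{2\pi}}e^{-x^2/2}$ and distribution function $G$. Let $c_{LS}(p)=\frac{\log p-\log(1-p)}{p-(1-p)}$ for $p\neq 1/2$ and $c_{LS}(1/2)=2$. Let $H_1^2(\lambda_p^S\otimes\gamma^{\mathbb N})$ be the set of $F\in L^2(\lambda_p^S\otimes\gamma^{\mathbb N})$ such that for every $i\in\mathbb N$ there is $F_i\in L^2(\lambda_p^S\otimes\gamma^{\mathbb N})$ which, almost surely with all the other coordinates fixed, is the weak derivative of $F$ on $\mathbb R$ as a function of the coordinate $y_i$ (in particular both are locally integrable there). Let $\nu$ be a probability measure on $\mathbb R_+$, absolutely continuous with density $h\ge 0$ and distribution function $H(t)=\int_0^t h(u)\,du$; let $H^{-1}(t)=\inf\{x: t\le H(x)\}$ for $0<t<1$, and $$\psi(t)=\frac{g\big(G^{-1}(H(t))\big)}{h(t)}\qquad (t\ge 0,\ h(t)>0),$$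 which is defined $\nu$-almost everywhere. Equip $\{0,1\}^S\times\mathbb R^{\mathbb N}$ with $\mu=\lambda_p^S\otimes\nu^{\otimes\mathbb N}$; $\mathbb E$, $\mathsf{Var}$ and $\|\cdot\|_1$ refer to $\mu$. For a coordinate $j\in S\cup\mathbb N$ let $\Delta_j f$ be $f$ minus its integral over the coordinate $j$ (with respect to $\beta_p$ if $j\in S$, to $\nu$ if $j\in\mathbb N$). A measurable function $D$ is called a partial derivative $\partial f/\partial y_i$ of $f$ (with respect to $\mu$) if, for $\mu$-almost all values of the other coordinates, there are functions $u,v$ on the interval $\{0<H<1\}$ such that $v$ is the weak derivative of $u$ there and, as functions of $y_i$, $f=u$ and $D=v$ hold $\nu$-almost everywhere. (If $h>0$ almost everywhere on this interval, this is the usual weak partial derivative there.) Let $f:\{0,1\}^S\times\mathbb R^{\mathbb N}\to\mathbb R$ be such that the function $(x,z)\mapsto f\big(x,(H^{-1}(G(z_i)))_{i\in\mathbb N}\big)$ belongs to $H_1^2(\lambda_p^S\otimes\gamma^{\mathbb N})$. Then $f\in L^2(\mu)$, for every $i\in\mathbb N$ the partial derivative $\partial f/\partial y_i$ exists, and for every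 choice of these partial derivatives the functions $$\nabla_i f(x,y)=\psi(y_i)\,\frac{\partial f}{\partial y_i}(x,y)$$ are in $L^2(\mu)$ and $$\mathsf{Var}(f)\,\log\frac{\mathsf{Var}(f)}{\sum_{s\in S}\|\Delta_s f\|_1^2+\sum_{i\in\mathbb N}\|\Delta_i f\|_1^2}\;\le\; c_{LS}(p)\sum_{s\in S}\mathbb E\big((\Delta_s f)^2\big)+2\sum_{i\in\mathbb N}\mathbb E\big((\nabla_i f)^2\big).$$ Here the sums take values in $[0,\infty]$, and the left side is in $[-\infty,\infty]$, equal to $0$ if $\mathsf{Var}(f)=0$, to $-\infty$ if $\mathsf{Var}(f)>0$ and the sum in the denominator is infinite, and to $+\infty$ if $\mathsf{Var}(f)>0$ and that sum is $0$. -/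

import Mathlib

open MeasureTheory ProbabilityTheory
open scoped ENNReal

noncomputable section

namespace ModifiedPoincare

/-- The (left-continuous) inverse `t ↦ inf {x | t ≤ F x}` of a distribution function `F`. On `(0,1)`
it is the usual inverse whenever `F` is continuous and strictly increasing on `{0 < F < 1}`. -/
def genInv (F : ℝ → ℝ) (t : ℝ) : ℝ := sInf {x : ℝ | t ≤ F x}

/-- The density of the standard Gaussian distribution. -/
def gaussDensity (x : ℝ) : ℝ := (Real.sqrt (2 * Real.pi))⁻¹ * Real.exp (-x ^ 2 / 2)

/-- The distribution function of the standard Gaussian distribution. -/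
def gaussCDF (x : ℝ) : ℝ := ∫ u in Set.Iic x, gaussDensity u

/-- The distribution function `H(t) = ∫₀ᵗ h` of the density `h` on the half line. -/
def cdfOf (h : ℝ → ℝ) (t : ℝ) : ℝ := ∫ u in (0 : ℝ)..t, h u

/-- The map `H⁻¹ ∘ G`, acting on one coordinate. -/
def transport (h : ℝ → ℝ) (z : ℝ) : ℝ := genInv (cdfOf h) (gaussCDF z)

/-- The weight `ψ(t) = g(G⁻¹(H(t))) / h(t)`. -/
def weight (h : ℝ → ℝ) (t : ℝ) : ℝ := gaussDensity (genInv gaussCDF (cdfOf h t)) / h t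

/-- The logarithmic Sobolev constant of the Bernoulli law with parameter `p`
(extended by continuity at `p = 1/2`). -/
def cLS (p : ℝ) : ℝ :=
  if p = 1 / 2 then 2 else (Real.log p - Real.log (1 - p)) / (p - (1 - p))

/-- The law on `{0,1}^S` (with `true` for `1`) of independent Bernoulli variables of
parameter `p`. -/
def bernoulliPi (S : Type*) (p : unitInterval) : Measure (S → Bool) :=
  Measure.infinitePi (fun _ : S => bernoulliMeasure true false p)

/-- The measure `λ_p^S ⊗ ν^ℕ` on `{0,1}^S × ℝ^ℕ`. -/
def mixedProduct (S : Type*) (p : unitInterval) (ν : Measure ℝ) :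
    Measure ((S → Bool) × (ℕ → ℝ)) :=
  (bernoulliPi S p).prod (Measure.infinitePi (fun _ : ℕ => ν))

/-- The function of the real variable `t` obtained from `f` by putting `t` in the `i`-th real
coordinate and keeping all the other coordinates of `ω` fixed. -/
def realSlice {S : Type*} (f : (S → Bool) × (ℕ → ℝ) → ℝ) (i : ℕ) (ω : (S → Bool) × (ℕ → ℝ)) :
    ℝ → ℝ :=
  fun t => f (ω.1, Function.update ω.2 i t)

/-- `Δ_s f = f - ∫ f dβ_p(x_s)`. -/
def deltaBit {S : Type*} [DecidableEq S] (p : unitInterval) (f : (S → Bool) × (ℕ → ℝ) → ℝ)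
    (s : S) (ω : (S → Bool) × (ℕ → ℝ)) : ℝ :=
  f ω - ∫ b, f (Function.update ω.1 s b, ω.2) ∂(bernoulliMeasure true false p)

/-- `Δ_i f = f - ∫ f dν(y_i)`. -/
def deltaReal {S : Type*} (ν : Measure ℝ) (f : (S → Bool) × (ℕ → ℝ) → ℝ)
    (i : ℕ) (ω : (S → Bool) × (ℕ → ℝ)) : ℝ :=
  f ω - ∫ t, realSlice f i ω t ∂ν

/-- `v` is the weak derivative of `u` on the open set `U ⊆ ℝ`. -/
def HasWeakDerivOn (U : Set ℝ) (u v : ℝ → ℝ) : Prop :=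
  LocallyIntegrableOn u U ∧ LocallyIntegrableOn v U ∧
    ∀ φ : ℝ → ℝ, ContDiff ℝ ((⊤ : ℕ∞) : WithTop ℕ∞) φ → HasCompactSupport φ → tsupport φ ⊆ U →
      ∫ t, v t * φ t = -∫ t, deriv φ t * u t

/-- The weighted Sobolev space `H_1^2(λ_p^S ⊗ γ^ℕ)`: square integrable functions which have, in
each real coordinate, a square integrable partial weak derivative. -/
def MemGaussSobolev {S : Type*} (p : unitInterval) (F : (S → Bool) × (ℕ → ℝ) → ℝ) : Prop :=
  MemLp F 2 (mixedProduct S p (gaussianReal 0 1)) ∧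
    ∀ i : ℕ, ∃ D : (S → Bool) × (ℕ → ℝ) → ℝ,
      MemLp D 2 (mixedProduct S p (gaussianReal 0 1)) ∧
      ∀ᵐ ω ∂(mixedProduct S p (gaussianReal 0 1)),
        HasWeakDerivOn Set.univ (realSlice F i ω) (realSlice D i ω)

/-- `D` is the partial derivative `∂f/∂y_i` with respect to the measure `λ_p^S ⊗ ν^ℕ`, where `ν` is
the law with density `h`. For almost all values of the other coordinates, the slice of `f` is
weakly differentiable on the open interval `{0 < H < 1}` with the slice of `D` as its derivative,
up to modification on a `ν`-null set (as `f` and `D` matter only up to null sets; a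
Lebesgue-null modification does not affect weak derivatives, so this only matters on `{h = 0}`). -/
def IsPartialDeriv {S : Type*} (p : unitInterval) (ν : Measure ℝ) (h : ℝ → ℝ)
    (f : (S → Bool) × (ℕ → ℝ) → ℝ) (i : ℕ) (D : (S → Bool) × (ℕ → ℝ) → ℝ) : Prop :=
  AEStronglyMeasurable D (mixedProduct S p ν) ∧
    ∀ᵐ ω ∂(mixedProduct S p ν), ∃ u v : ℝ → ℝ,
      HasWeakDerivOn {t : ℝ | 0 < cdfOf h t ∧ cdfOf h t < 1} u v ∧
      realSlice f i ω =ᵐ[ν] u ∧ realSlice D i ω =ᵐ[ν] v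

/-- `∇_i f (x,y) = ψ(y_i) ∂f/∂y_i (x,y)`, where `D i` is the function `∂f/∂y_i`. -/
def weightedGrad {S : Type*} (h : ℝ → ℝ) (D : ℕ → (S → Bool) × (ℕ → ℝ) → ℝ) (i : ℕ)
    (ω : (S → Bool) × (ℕ → ℝ)) : ℝ :=
  weight h (ω.2 i) * D i ω

/-- The sum `∑_s ‖Δ_s f‖₁² + ∑_i ‖Δ_i f‖₁²`, in `[0,∞]`. -/
def sumInfluences {S : Type*} [DecidableEq S] (p : unitInterval) (ν : Measure ℝ)
    (f : (S → Bool) × (ℕ → ℝ) → ℝ) : ℝ≥0∞ :=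
  ∑' s : S, (∫⁻ ω, ‖deltaBit p f s ω‖ₑ ∂(mixedProduct S p ν)) ^ 2 +
    ∑' i : ℕ, (∫⁻ ω, ‖deltaReal ν f i ω‖ₑ ∂(mixedProduct S p ν)) ^ 2

/-- The energy `c_LS(p) ∑_s E((Δ_s f)²) + 2 ∑_i E((∇_i f)²)`, in `[0,∞]`. -/
def energy {S : Type*} [DecidableEq S] (p : unitInterval) (ν : Measure ℝ) (h : ℝ → ℝ)
    (f : (S → Bool) × (ℕ → ℝ) → ℝ) (D : ℕ → (S → Bool) × (ℕ → ℝ) → ℝ) : ℝ≥0∞ :=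
  ENNReal.ofReal (cLS p) * ∑' s : S, ∫⁻ ω, ‖deltaBit p f s ω‖ₑ ^ 2 ∂(mixedProduct S p ν) +
    2 * ∑' i : ℕ, ∫⁻ ω, ‖weightedGrad h D i ω‖ₑ ^ 2 ∂(mixedProduct S p ν)

end ModifiedPoincare

end

open ModifiedPoincare

namespace ModifiedPoincare

open Filter Topology

/-! The map `H⁻¹ ∘ G`, applied to every real coordinate, is a measurable embedding carrying `γ^ℕ` to
`ν^ℕ`. Variance and influences are unchanged by it. Since `(G⁻¹ ∘ H)' = h / g(G⁻¹ ∘ H) = 1/ψ`, the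
functions `ψ ∂f/∂y_i` become the Gaussian weak derivatives of the transported function
(`IsDensity.weightedGrad_ae_eq`). So only `ν = γ` remains.

There, enumerate all coordinates and split `f - E f` into martingale increments `V_k`, the
differences of the averages of `f` given the first `k + 1` and the first `k` coordinates. For every
`l > 0`, the entropy of `V_k²` is at least `(log l + 1) E V_k² - l (E|V_k|)²`
(`le_integral_mul_log_sub`, after truncation), and by the logarithmic Sobolev inequality it is at
most the energy of `V_k`. Now sum over `k`: the second moments add up to the variance; `E|V_k| ≤
‖Δ_k f‖₁`, because `V_k` is a conditional expectation of `Δ_k f`; and the energies of the increments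
telescope to at most the energy of `f`, because derivatives commute with averages. This gives `(log
l + 1) Var f ≤ E + l B` (`Splicing.IsDerivation.modified_poincare`), with `E` the energy and `B` the
sum of squared influences; `l = Var f / B` yields the claim (`mul_log_div_le`).

The logarithmic Sobolev inequality tensorises, by the submodularity of the entropy
(`Splicing.ent_submodular`), so one coordinate is enough. For a bit it is a calculus problem with
optimal constant `c_LS(p)` (`two_point_logSobolev`). For a Gaussian coordinate it follows from fair
bits by tensorisation and the central limit theorem, first for compactly supported continuous
derivatives and then by density in `L²` (`gaussian_logSobolev`). -/

/-- Operations `splice A a b`, for sets `A` of coordinates, which replace the coordinates of `a`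
outside `A` by those of `b`, for a measure `μ` with independent coordinates. -/
structure Splicing (ι : Type*) {Ω : Type*} [MeasurableSpace Ω] (μ : Measure Ω) where
  splice : Set ι → Ω → Ω → Ω
  measurePreserving : ∀ A, MeasurePreserving (fun q : Ω × Ω => splice A q.1 q.2) (μ.prod μ) μ
  splice_splice : ∀ A B a b c, splice B (splice A a b) c = splice (A ∩ B) a (splice B b c)
  splice_right : ∀ A a b c, splice A a (splice A b c) = splice A a c
  splice_univ : ∀ a b, splice Set.univ a b = a
  splice_empty : ∀ a b, splice ∅ a b = b

/-! ### Averages over independent coordinates. -/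

namespace Splicing

variable {ι Ω : Type*} {mΩ : MeasurableSpace Ω} {μ : Measure Ω} (sp : Splicing ι μ)

/-- The functions depending only on the coordinates in `A`. -/
def Inv (A : Set ι) (f : Ω → ℝ) : Prop := ∀ a b, f (sp.splice A a b) = f a

/-- The `σ`-algebra generated by the coordinates in `A`. -/
@[reducible] def inv (A : Set ι) : MeasurableSpace Ω where
  MeasurableSet' s := MeasurableSet s ∧ ∀ a b, sp.splice A a b ∈ s ↔ a ∈ s
  measurableSet_empty := ⟨MeasurableSet.empty, fun _ _ => Iff.rfl⟩
  measurableSet_compl := fun s hs => ⟨hs.1.compl, fun a b => not_congr (hs.2 a b)⟩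
  measurableSet_iUnion := fun s hs => ⟨MeasurableSet.iUnion fun i => (hs i).1, fun a b => by
    simp only [Set.mem_iUnion]; exact exists_congr fun i => (hs i).2 a b⟩

lemma inv_le (A : Set ι) : sp.inv A ≤ mΩ := fun _ hs => hs.1

lemma splice_of_subset {A B : Set ι} (h : A ⊆ B) (a b c : Ω) :
    sp.splice B (sp.splice A a b) c = sp.splice A a (sp.splice B b c) := by
  rw [sp.splice_splice, Set.inter_eq_self_of_subset_left h]

lemma splice_of_subset' {A B : Set ι} (h : A ⊆ B) (a b c : Ω) :
    sp.splice A (sp.splice B a b) c = sp.splice A a (sp.splice A b c) := by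
  rw [sp.splice_splice, Set.inter_eq_self_of_subset_right h]

lemma Inv.mono {A B : Set ι} (h : A ⊆ B) {f : Ω → ℝ} (hf : sp.Inv A f) : sp.Inv B f := by
  intro a b
  rw [← hf (sp.splice B a b) a, sp.splice_of_subset' h, hf]

lemma inv_mono {A B : Set ι} (h : A ⊆ B) : sp.inv A ≤ sp.inv B := by
  intro s hs
  refine ⟨hs.1, fun a b => ?_⟩
  rw [← hs.2 (sp.splice B a b) a, sp.splice_of_subset' h, hs.2]

/-- Integrating out the coordinates outside `A`. -/
noncomputable def avg (A : Set ι) (f : Ω → ℝ) (ω : Ω) : ℝ := ∫ ω', f (sp.splice A ω ω') ∂μ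

lemma measurable_splice (A : Set ι) : Measurable (fun q : Ω × Ω => sp.splice A q.1 q.2) :=
  (sp.measurePreserving A).measurable

lemma measurable_splice_left (A : Set ι) (a : Ω) : Measurable (sp.splice A a) :=
  (sp.measurable_splice A).comp measurable_prodMk_left

lemma inv_avg (A : Set ι) (f : Ω → ℝ) : sp.Inv A (sp.avg A f) := by
  intro a b
  simp only [avg, sp.splice_of_subset (subset_refl A), sp.splice_right]

lemma Inv.avg_eq [IsProbabilityMeasure μ] {A : Set ι} {f : Ω → ℝ} (hf : sp.Inv A f) :
    sp.avg A f = f := by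
  funext a
  simp [avg, hf a]

lemma avg_empty (f : Ω → ℝ) (ω : Ω) : sp.avg ∅ f ω = ∫ ω', f ω' ∂μ := by
  simp [avg, sp.splice_empty]

lemma avg_univ [IsProbabilityMeasure μ] (f : Ω → ℝ) : sp.avg Set.univ f = f := by
  funext a
  simp [avg, sp.splice_univ]

lemma integral_comp_splice (A : Set ι) {f : Ω → ℝ} (hf : Measurable f) :
    ∫ q : Ω × Ω, f (sp.splice A q.1 q.2) ∂(μ.prod μ) = ∫ ω, f ω ∂μ := by
  conv_rhs => rw [← (sp.measurePreserving A).map_eq]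
  rw [integral_map (sp.measurable_splice A).aemeasurable hf.aestronglyMeasurable]

lemma integrable_comp_splice (A : Set ι) {f : Ω → ℝ} (hf : Integrable f μ) :
    Integrable (fun q : Ω × Ω => f (sp.splice A q.1 q.2)) (μ.prod μ) :=
  (sp.measurePreserving A).integrable_comp_of_integrable hf

variable [IsProbabilityMeasure μ]

lemma measurable_avg (A : Set ι) {f : Ω → ℝ} (hf : Measurable f) : Measurable (sp.avg A f) := by
  have : StronglyMeasurable (Function.uncurry fun ω ω' => f (sp.splice A ω ω')) :=
    (hf.comp (sp.measurable_splice A)).stronglyMeasurable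
  exact this.integral_prod_right.measurable

lemma integral_avg (A : Set ι) {f : Ω → ℝ} (hm : Measurable f) (hf : Integrable f μ) :
    ∫ ω, sp.avg A f ω ∂μ = ∫ ω, f ω ∂μ := by
  rw [← sp.integral_comp_splice A hm, integral_prod _ (sp.integrable_comp_splice A hf)]
  rfl

/-- Functions of the coordinates in `A` can be taken out of the average. -/
lemma integral_mul_avg (A : Set ι) {f g : Ω → ℝ} (hf : Measurable f) (hg : Measurable g)
    (hfg : Integrable (fun ω => f ω * g ω) μ) (hi : sp.Inv A g) :
    ∫ ω, f ω * g ω ∂μ = ∫ ω, sp.avg A f ω * g ω ∂μ := by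
  have h := sp.integral_avg A (f := fun ω => f ω * g ω) (hf.mul hg) hfg
  rw [← h]
  refine integral_congr_ae (.of_forall fun ω => ?_)
  simp only [avg]
  simp only [hi ω, integral_mul_const]

/-- The average is defined pointwise by a partial integral. Identifying it with a conditional
expectation gives access to contractivity in `L¹` and `L²` and to martingale convergence. -/
lemma avg_ae_eq_condExp (A : Set ι) {f : Ω → ℝ} (hm : Measurable f) (hf : Integrable f μ) :
    sp.avg A f =ᵐ[μ] μ[f|sp.inv A] := by
  have hi : Integrable (sp.avg A f) μ := (sp.integrable_comp_splice A hf).integral_prod_left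
  refine ae_eq_condExp_of_forall_setIntegral_eq (sp.inv_le A) hf (fun s _ _ => hi.integrableOn)
    (fun s hs _ => ?_) ?_
  · have hs' : MeasurableSet s := hs.1
    have h1 : ∀ g : Ω → ℝ, ∫ x in s, g x ∂μ = ∫ x, g x * s.indicator (fun _ => (1 : ℝ)) x ∂μ := by
      intro g
      rw [← integral_indicator hs']
      congr 1; funext x
      by_cases hx : x ∈ s <;> simp [hx]
    rw [h1, h1]
    refine (sp.integral_mul_avg A hm (measurable_const.indicator hs') ?_ ?_).symm
    · refine (hf.indicator hs').congr (.of_forall fun x => ?_)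
      by_cases hx : x ∈ s <;> simp [hx]
    · intro a b
      by_cases hx : a ∈ s
      · simp [hx, (hs.2 a b).2 hx]
      · simp [hx, mt (hs.2 a b).1 hx]
  · refine StronglyMeasurable.aestronglyMeasurable (m := sp.inv A)
      (Measurable.stronglyMeasurable (fun t ht => ⟨sp.measurable_avg A hm ht, fun a b => ?_⟩))
    simp only [Set.mem_preimage]
    rw [sp.inv_avg A f a b]

lemma memLp_avg (A : Set ι) {f : Ω → ℝ} (hm : Measurable f) (hf : MemLp f 2 μ) :
    MemLp (sp.avg A f) 2 μ :=
  (memLp_congr_ae (sp.avg_ae_eq_condExp A hm (hf.integrable one_le_two))).2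
    (hf.condExp one_le_two)

lemma integrable_avg (A : Set ι) {f : Ω → ℝ} (hf : Integrable f μ) :
    Integrable (sp.avg A f) μ :=
  (sp.integrable_comp_splice A hf).integral_prod_left

/-- Independence makes conditional expectations commute: by `splice_splice`, averaging twice
resamples all coordinates outside `A ∩ B`, and the resampled point again has law `μ`. -/
lemma avg_avg (A B : Set ι) {f : Ω → ℝ} (hm : Measurable f) (hf : Integrable f μ) :
    sp.avg A (sp.avg B f) =ᵐ[μ] sp.avg (A ∩ B) f := by
  have h := (sp.integrable_comp_splice (A ∩ B) hf).prod_right_ae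
  filter_upwards [h] with a ha
  simp only [avg, sp.splice_splice]
  have hm' : Measurable fun ω => f (sp.splice (A ∩ B) a ω) :=
    hm.comp (sp.measurable_splice_left _ _)
  rw [← sp.integral_comp_splice B hm', integral_prod _ (sp.integrable_comp_splice B ha)]

/-- Boundedness makes every section integrable, so the identity holds at every point. -/
lemma avg_avg_of_bounded (A B : Set ι) {f : Ω → ℝ} (hm : Measurable f) {m M : ℝ}
    (hb : ∀ ω, f ω ∈ Set.Icc m M) (a : Ω) :
    sp.avg A (sp.avg B f) a = sp.avg (A ∩ B) f a := by
  simp only [avg, sp.splice_splice]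
  have hm' : Measurable fun ω => f (sp.splice (A ∩ B) a ω) :=
    hm.comp (sp.measurable_splice_left _ _)
  rw [← sp.integral_comp_splice B hm', integral_prod]
  exact .of_mem_Icc m M (hm'.comp (sp.measurable_splice B)).aemeasurable (.of_forall fun _ => hb _)

lemma avg_mem_Icc (A : Set ι) {f : Ω → ℝ} (hm : Measurable f) {m M : ℝ}
    (hb : ∀ ω, f ω ∈ Set.Icc m M) (a : Ω) : sp.avg A f a ∈ Set.Icc m M := by
  have hi : Integrable (fun ω => f (sp.splice A a ω)) μ :=
    .of_mem_Icc m M (hm.comp (sp.measurable_splice_left A a)).aemeasurable (.of_forall fun _ => hb _)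
  constructor
  · have h := integral_mono (integrable_const m) hi (fun ω => (hb _).1)
    simpa [avg] using h
  · have h := integral_mono hi (integrable_const M) (fun ω => (hb _).2)
    simpa [avg] using h

lemma avg_sub (A : Set ι) {f g : Ω → ℝ} (hf : Integrable f μ) (hg : Integrable g μ) :
    sp.avg A (fun ω => f ω - g ω) =ᵐ[μ] fun ω => sp.avg A f ω - sp.avg A g ω := by
  filter_upwards [(sp.integrable_comp_splice A hf).prod_right_ae,
    (sp.integrable_comp_splice A hg).prod_right_ae] with a h1 h2
  exact integral_sub h1 h2

/-- Pythagoras for nested orthogonal projections. -/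
lemma integral_sq_avg_sub {A B : Set ι} (h : A ⊆ B) {f : Ω → ℝ} (hm : Measurable f)
    (hf : MemLp f 2 μ) :
    ∫ ω, (sp.avg B f ω - sp.avg A f ω) ^ 2 ∂μ =
      ∫ ω, (sp.avg B f ω) ^ 2 ∂μ - ∫ ω, (sp.avg A f ω) ^ 2 ∂μ := by
  have hA := sp.memLp_avg A hm hf
  have hB := sp.memLp_avg B hm hf
  have hAB : Integrable (fun ω => sp.avg B f ω * sp.avg A f ω) μ := hB.integrable_mul hA
  have h1 : ∫ ω, sp.avg B f ω * sp.avg A f ω ∂μ = ∫ ω, (sp.avg A f ω) ^ 2 ∂μ := by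
    rw [sp.integral_mul_avg A (sp.measurable_avg B hm) (sp.measurable_avg A hm) hAB
      (sp.inv_avg A f)]
    refine integral_congr_ae ?_
    filter_upwards [sp.avg_avg A B hm (hf.integrable one_le_two)] with ω hω
    rw [hω, Set.inter_eq_self_of_subset_left h, sq]
  have h2 : ∀ ω, (sp.avg B f ω - sp.avg A f ω) ^ 2 =
      (sp.avg B f ω) ^ 2 + (sp.avg A f ω) ^ 2 - 2 * (sp.avg B f ω * sp.avg A f ω) := by
    intro ω; ring
  have hS : Integrable (fun ω => (sp.avg B f ω) ^ 2 + (sp.avg A f ω) ^ 2) μ :=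
    hB.integrable_sq.add hA.integrable_sq
  simp only [h2]
  rw [integral_sub hS (hAB.const_mul 2),
    integral_add hB.integrable_sq hA.integrable_sq, integral_const_mul, h1]
  ring

lemma integral_sq_avg_le (A : Set ι) {f : Ω → ℝ} (hm : Measurable f) (hf : MemLp f 2 μ) :
    ∫ ω, (sp.avg A f ω) ^ 2 ∂μ ≤ ∫ ω, (f ω) ^ 2 ∂μ := by
  have h := sp.integral_sq_avg_sub (Set.subset_univ A) hm hf
  rw [sp.avg_univ] at h
  have : 0 ≤ ∫ ω, (f ω - sp.avg A f ω) ^ 2 ∂μ := integral_nonneg fun ω => sq_nonneg _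
  linarith

/-! ### Tensorisation of the entropy -/

/-- `∫ Φ(E[F|A]) dμ` for `Φ(x) = x log x`. -/
noncomputable def ent (A : Set ι) (F : Ω → ℝ) : ℝ := ∫ ω, sp.avg A F ω * Real.log (sp.avg A F ω) ∂μ

/-- This is `log x ≤ x - 1` at `x = b A / (B a)`, multiplied by `a`. It serves as the integrand of
`ent_submodular`. -/
lemma mul_log_sub_le {a A b B : ℝ} (ha : 0 < a) (hA : 0 < A) (hb : 0 < b) (hB : 0 < B) :
    a * Real.log b - a * Real.log B ≤ a * Real.log a - a * Real.log A + b * (A / B) - a := by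
  have h := Real.log_le_sub_one_of_pos (x := b * A / (B * a)) (by positivity)
  rw [Real.log_div (by positivity) (by positivity), Real.log_mul hb.ne' hA.ne',
    Real.log_mul hB.ne' ha.ne'] at h
  have h2 := mul_le_mul_of_nonneg_left h ha.le
  have h3 : a * (b * A / (B * a) - 1) = b * (A / B) - a := by field_simp
  rw [h3] at h2
  linarith

/-- Write `F_C` for the average of `F` given `C`. Both sides have the form `E[F log (·)]`; integrate
`mul_log_sub_le` with `a = F`, `b = F_A`, `A = F_B`, `B = F_{A ∩ B}`. The error `F_A F_B / F_{A ∩ B}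
- F` has mean zero. -/
lemma ent_submodular (A B : Set ι) {F : Ω → ℝ} (hm : Measurable F) {m M : ℝ} (hm0 : 0 < m)
    (hb : ∀ ω, F ω ∈ Set.Icc m M) :
    sp.ent A F - sp.ent (A ∩ B) F ≤ sp.ent Set.univ F - sp.ent B F := by
  have hM : m ≤ M := by
    obtain ⟨ω⟩ := nonempty_of_isProbabilityMeasure μ
    exact (hb ω).1.trans (hb ω).2
  have bdd : ∀ C ω, sp.avg C F ω ∈ Set.Icc m M := fun C => sp.avg_mem_Icc C hm hb
  have meas : ∀ C, Measurable (sp.avg C F) := fun C => sp.measurable_avg C hm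
  have hlog : ∀ C ω, Real.log (sp.avg C F ω) ∈ Set.Icc (Real.log m) (Real.log M) := fun C ω =>
    ⟨Real.log_le_log hm0 (bdd C ω).1, Real.log_le_log (hm0.trans_le (bdd C ω).1) (bdd C ω).2⟩
  have hF : Integrable F μ := .of_mem_Icc m M hm.aemeasurable (.of_forall hb)
  have mlog : ∀ C, Measurable fun ω => Real.log (sp.avg C F ω) := fun C => (meas C).log
  have hI : ∀ C, Integrable (fun ω => F ω * Real.log (sp.avg C F ω)) μ := fun C => by
    refine hF.mul_bdd (c := |Real.log m| + |Real.log M|) (mlog C).aestronglyMeasurable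
      (.of_forall fun ω => ?_)
    rw [Real.norm_eq_abs]
    exact (abs_le_max_abs_abs (hlog C ω).1 (hlog C ω).2).trans
      (max_le (by linarith [abs_nonneg (Real.log M)]) (by linarith [abs_nonneg (Real.log m)]))
  have hent : ∀ C, sp.ent C F = ∫ ω, F ω * Real.log (sp.avg C F ω) ∂μ := fun C => by
    rw [sp.integral_mul_avg C hm (mlog C) (hI C)]
    · rfl
    · intro a b; simp only [sp.inv_avg C F a b]
  have hent' : ∫ ω, F ω * Real.log (sp.avg (A ∩ B) F ω) ∂μ = sp.ent (A ∩ B) F := (hent _).symm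
  have hU : sp.ent Set.univ F = ∫ ω, F ω * Real.log (F ω) ∂μ := by
    rw [hent, sp.avg_univ]
  have hIU : Integrable (fun ω => F ω * Real.log (F ω)) μ := by
    have := hI Set.univ; rwa [sp.avg_univ] at this
  have hq : Measurable fun ω => sp.avg B F ω / sp.avg (A ∩ B) F ω := (meas B).div (meas _)
  have hqb : ∀ ω, ‖sp.avg B F ω / sp.avg (A ∩ B) F ω‖ ≤ M / m := fun ω => by
    have h1 := bdd B ω
    have h2 := bdd (A ∩ B) ω
    rw [Real.norm_eq_abs, abs_of_nonneg (div_nonneg (hm0.le.trans h1.1) (hm0.le.trans h2.1))]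
    exact div_le_div₀ (hm0.le.trans hM) h1.2 hm0 h2.1
  have hIq : Integrable (fun ω => sp.avg A F ω * (sp.avg B F ω / sp.avg (A ∩ B) F ω)) μ :=
    (sp.integrable_avg A hF).mul_bdd hq.aestronglyMeasurable (.of_forall hqb)
  -- The quotient depends on `B` only, so `F_A` may be averaged given `B`. This produces `F_{A ∩
  -- B}`, which cancels the denominator and leaves `E F_B = E F`.
  have hqe : ∫ ω, sp.avg A F ω * (sp.avg B F ω / sp.avg (A ∩ B) F ω) ∂μ = ∫ ω, F ω ∂μ := by
    rw [sp.integral_mul_avg B (meas A) hq hIq]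
    · rw [← sp.integral_avg B hm hF]
      refine integral_congr_ae (.of_forall fun ω => ?_)
      have h2 := hm0.trans_le (bdd (A ∩ B) ω).1
      simp only [sp.avg_avg_of_bounded B A hm hb, Set.inter_comm B A]
      field_simp
    · intro a b
      have h := (sp.inv_avg (A ∩ B) F).mono sp Set.inter_subset_right a b
      simp only [sp.inv_avg B F a b, h]
  have key : ∫ ω, (F ω * Real.log (sp.avg A F ω) - F ω * Real.log (sp.avg (A ∩ B) F ω)) ∂μ ≤
      ∫ ω, (F ω * Real.log (F ω) - F ω * Real.log (sp.avg B F ω) +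
        sp.avg A F ω * (sp.avg B F ω / sp.avg (A ∩ B) F ω) - F ω) ∂μ := by
    refine integral_mono ((hI A).sub (hI _)) (((hIU.sub (hI B)).add hIq).sub hF) fun ω => ?_
    exact mul_log_sub_le (hm0.trans_le (hb ω).1) (hm0.trans_le (bdd B ω).1)
      (hm0.trans_le (bdd A ω).1) (hm0.trans_le (bdd _ ω).1)
  have hJ : Integrable (fun ω => F ω * Real.log (F ω) - F ω * Real.log (sp.avg B F ω)) μ :=
    hIU.sub (hI B)
  have hK : Integrable (fun ω => F ω * Real.log (F ω) - F ω * Real.log (sp.avg B F ω) +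
      sp.avg A F ω * (sp.avg B F ω / sp.avg (A ∩ B) F ω)) μ := hJ.add hIq
  rw [integral_sub (hI A) (hI _), integral_sub hK hF, integral_add hJ hIq, integral_sub hIU (hI B), hqe, ← hent, ← hent, ← hent,
    ← hU] at key
  linarith

end Splicing

/-- The lower bound of the entropy of `W²` by the `L¹` and `L²` norms of `W`. -/
lemma le_integral_mul_log_sub {Ω : Type*} [MeasurableSpace Ω] {μ : Measure Ω} [IsProbabilityMeasure μ]
    {W : Ω → ℝ} (hm : Measurable W) {m M : ℝ}
    (hm0 : 0 < m) (hb : ∀ ω, W ω ∈ Set.Icc m M) {l : ℝ} (hl : 0 < l) :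
    (Real.log l + 1) * ∫ ω, W ω ^ 2 ∂μ - l * (∫ ω, W ω ∂μ) ^ 2 ≤
      ∫ ω, W ω ^ 2 * Real.log (W ω ^ 2) ∂μ -
        (∫ ω, W ω ^ 2 ∂μ) * Real.log (∫ ω, W ω ^ 2 ∂μ) := by
  have hW : Integrable W μ := .of_mem_Icc m M hm.aemeasurable (.of_forall hb)
  have hpos : ∀ ω, 0 < W ω := fun ω => hm0.trans_le (hb ω).1
  have hb2 : ∀ ω, W ω ^ 2 ∈ Set.Icc (m ^ 2) (M ^ 2) := fun ω =>
    ⟨pow_le_pow_left₀ hm0.le (hb ω).1 2, pow_le_pow_left₀ (hpos ω).le (hb ω).2 2⟩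
  have hW2 : Integrable (fun ω => W ω ^ 2) μ :=
    .of_mem_Icc _ _ (hm.pow_const 2).aemeasurable (.of_forall hb2)
  have hWl : Integrable (fun ω => W ω ^ 2 * Real.log (W ω ^ 2)) μ := by
    refine hW2.mul_bdd (c := |Real.log (m ^ 2)| + |Real.log (M ^ 2)|)
      (hm.pow_const 2).log.aestronglyMeasurable (.of_forall fun ω => ?_)
    rw [Real.norm_eq_abs]
    have h1 := Real.log_le_log (by positivity) (hb2 ω).1
    have h2 := Real.log_le_log (pow_pos (hpos ω) 2) (hb2 ω).2
    exact (abs_le_max_abs_abs h1 h2).trans (max_le (by linarith [abs_nonneg (Real.log (M ^ 2))])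
      (by linarith [abs_nonneg (Real.log (m ^ 2))]))
  set a := ∫ ω, W ω ^ 2 ∂μ with ha
  set w := ∫ ω, W ω ∂μ with hw
  have hw0 : 0 < w := by
    have h := integral_mono (integrable_const m) hW (fun ω => (hb ω).1)
    simp only [integral_const, probReal_univ, one_smul] at h
    exact hm0.trans_le h
  have ha0 : 0 < a := by
    have h := integral_mono (integrable_const (m ^ 2)) hW2 (fun ω => (hb2 ω).1)
    simp only [integral_const, probReal_univ, one_smul] at h
    exact (pow_pos hm0 2).trans_le h
  -- The tangent bound `log x ≤ x - 1` at `x = (a / w) / W`, multiplied by `2 W²`. After integration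
  -- the linear terms cancel, so the entropy is at least `a log (a / w²)`.
  have h1 : ∫ ω, ((2 * Real.log (a / w) + 2) * W ω ^ 2 - 2 * (a / w) * W ω) ∂μ ≤
      ∫ ω, W ω ^ 2 * Real.log (W ω ^ 2) ∂μ := by
    refine integral_mono ((hW2.const_mul _).sub (hW.const_mul _)) hWl fun ω => ?_
    have hx := hpos ω
    have h := Real.log_le_sub_one_of_pos (x := a / w / W ω) (by positivity)
    rw [Real.log_div (by positivity) hx.ne'] at h
    have h2 := mul_le_mul_of_nonneg_left h (sq_nonneg (W ω))
    have h3 : W ω ^ 2 * (a / w / W ω - 1) = a / w * W ω - W ω ^ 2 := by field_simp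
    simp only [Real.log_pow, Nat.cast_ofNat]
    linarith
  rw [integral_sub (hW2.const_mul _) (hW.const_mul _), integral_const_mul, integral_const_mul,
    ← ha, ← hw, Real.log_div ha0.ne' hw0.ne'] at h1
  have h4 : 2 * (a / w) * w = 2 * a := by field_simp
  rw [h4] at h1
  -- A second tangent bound replaces `a log (a / w²)` by an expression affine in `a` and `w²` for
  -- fixed `l`, so that it can be summed over increments.
  have h5 := Real.log_le_sub_one_of_pos (x := l * w ^ 2 / a) (by positivity)
  rw [Real.log_div (by positivity) ha0.ne', Real.log_mul hl.ne' (by positivity), Real.log_pow] at h5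
  have h6 := mul_le_mul_of_nonneg_left h5 ha0.le
  have h7 : a * (l * w ^ 2 / a - 1) = l * w ^ 2 - a := by field_simp
  rw [h7] at h6
  push_cast at h6
  linarith

/-! ### Martingale increments and the abstract modified Poincaré inequality. -/

namespace Splicing

variable {ι Ω : Type*} {mΩ : MeasurableSpace Ω} {μ : Measure Ω} (sp : Splicing ι μ)
variable [IsProbabilityMeasure μ]

/-- The set of the first `n` coordinates in an enumeration. -/
def initial (e : ι ≃ ℕ) (n : ℕ) : Set ι := {j | e j < n}

lemma initial_zero (e : ι ≃ ℕ) : initial e 0 = ∅ := by simp [initial]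

lemma initial_mono (e : ι ≃ ℕ) : Monotone (initial e) := fun _ _ h _ hj => lt_of_lt_of_le hj h

lemma initial_succ_inter (e : ι ≃ ℕ) (k : ℕ) :
    initial e (k + 1) ∩ {e.symm k}ᶜ = initial e k := by
  ext j
  simp only [initial, Set.mem_inter_iff, Set.mem_ofPred_eq, Set.mem_compl_iff,
    Set.mem_singleton_iff, Equiv.eq_symm_apply]
  omega

/-- Tensorisation of the entropy. -/
lemma ent_initial_sub_le (e : ι ≃ ℕ) (n : ℕ) {F : Ω → ℝ} (hm : Measurable F) {m M : ℝ}
    (hm0 : 0 < m) (hb : ∀ ω, F ω ∈ Set.Icc m M) :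
    sp.ent (initial e n) F - sp.ent ∅ F ≤
      ∑ k ∈ Finset.range n, (sp.ent Set.univ F - sp.ent {e.symm k}ᶜ F) := by
  -- Reveal the coordinates one at a time; submodularity with `A = initial e (k + 1)` and `B =
  -- {e.symm k}ᶜ` bounds each step.
  rw [← initial_zero e, ← Finset.sum_range_sub (fun k => sp.ent (initial e k) F)]
  refine Finset.sum_le_sum fun k _ => ?_
  have := sp.ent_submodular (initial e (k + 1)) {e.symm k}ᶜ hm hm0 hb
  rwa [initial_succ_inter] at this

/-- A smooth truncation of the absolute value. -/
noncomputable def trunc (n : ℕ) (x : ℝ) : ℝ :=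
  √((min |x| n) ^ 2 + (1 / (n + 1 : ℝ)) ^ 2)

/-- Reverse triangle inequality for the vectors `(a, c)` and `(b, c)` of the plane; the product
bound inside is Cauchy–Schwarz. -/
lemma abs_sqrt_sub_sqrt_le (a b c : ℝ) : |√(a ^ 2 + c ^ 2) - √(b ^ 2 + c ^ 2)| ≤ |a - b| := by
  have h1 := Real.sq_sqrt (show 0 ≤ a ^ 2 + c ^ 2 by positivity)
  have h2 := Real.sq_sqrt (show 0 ≤ b ^ 2 + c ^ 2 by positivity)
  have h3 := Real.sqrt_nonneg (a ^ 2 + c ^ 2)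
  have h4 := Real.sqrt_nonneg (b ^ 2 + c ^ 2)
  refine abs_le_of_sq_le_sq' ?_ (abs_nonneg _) |> abs_le.2
  rw [sq_abs]
  have h5 : a * b + c ^ 2 ≤ √(a ^ 2 + c ^ 2) * √(b ^ 2 + c ^ 2) := by
    rw [← Real.sqrt_mul (by positivity)]
    apply Real.le_sqrt_of_sq_le
    nlinarith [sq_nonneg (c * (a - b))]
  nlinarith

lemma lipschitzWith_trunc (n : ℕ) : LipschitzWith 1 (trunc n) := by
  refine LipschitzWith.of_dist_le_mul fun x y => ?_
  rw [Real.dist_eq, Real.dist_eq, NNReal.coe_one, one_mul]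
  refine (abs_sqrt_sub_sqrt_le _ _ _).trans ((abs_min_sub_min_le_max _ _ _ _).trans ?_)
  simpa using abs_abs_sub_abs_le_abs_sub x y

lemma trunc_mem_Icc (n : ℕ) (x : ℝ) : trunc n x ∈ Set.Icc (1 / (n + 1 : ℝ)) (n + 1) := by
  have h0 : (0 : ℝ) ≤ min |x| n := le_min (abs_nonneg _) (Nat.cast_nonneg _)
  have h1 : (0 : ℝ) < 1 / (n + 1 : ℝ) := by positivity
  have h2 : 1 / (n + 1 : ℝ) ≤ 1 := by
    rw [div_le_one (by positivity)]; linarith [(Nat.cast_nonneg n : (0 : ℝ) ≤ n)]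
  constructor
  · exact Real.le_sqrt_of_sq_le (by nlinarith)
  · rw [trunc, Real.sqrt_le_left (by positivity)]
    have h3 : min |x| (n : ℝ) ≤ n := min_le_right _ _
    nlinarith

lemma trunc_le (n : ℕ) (x : ℝ) : trunc n x ≤ |x| + 1 := by
  have h0 : (0 : ℝ) ≤ min |x| n := le_min (abs_nonneg _) (Nat.cast_nonneg _)
  have h1 : (0 : ℝ) < 1 / (n + 1 : ℝ) := by positivity
  have h2 : 1 / (n + 1 : ℝ) ≤ 1 := by
    rw [div_le_one (by positivity)]; linarith [(Nat.cast_nonneg n : (0 : ℝ) ≤ n)]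
  rw [trunc, Real.sqrt_le_left (by positivity)]
  have h3 : min |x| (n : ℝ) ≤ |x| := min_le_left _ _
  nlinarith

lemma tendsto_trunc (x : ℝ) : Tendsto (fun n => trunc n x) atTop (𝓝 |x|) := by
  have h1 : Tendsto (fun n : ℕ => (1 / (n + 1 : ℝ))) atTop (𝓝 0) :=
    tendsto_one_div_add_atTop_nhds_zero_nat
  have h2 : Tendsto (fun n : ℕ => min |x| (n : ℝ)) atTop (𝓝 |x|) := by
    refine tendsto_const_nhds.congr' ?_
    filter_upwards [tendsto_natCast_atTop_atTop.eventually_ge_atTop |x|] with n hn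
    exact (min_eq_left hn).symm
  have := ((h2.pow 2).add (h1.pow 2)).sqrt
  simpa [trunc, Real.sqrt_sq_eq_abs] using this

/-- `R j f D` says that `D` is a derivative of `f` in the direction of the coordinate `j`; these
derivatives commute with averages and satisfy logarithmic Sobolev inequalities. -/
structure IsDerivation (c : ι → ℝ) (R : ι → (Ω → ℝ) → (Ω → ℝ) → Prop) : Prop where
  avg : ∀ {j A f D}, Measurable f → MemLp f 2 μ → Measurable D → MemLp D 2 μ → R j f D → j ∈ A →
    R j (sp.avg A f) (sp.avg A D)
  avg_zero : ∀ {j A f}, Measurable f → MemLp f 2 μ → j ∉ A → R j (sp.avg A f) (fun _ => 0)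
  sub : ∀ {j f g D E}, Measurable f → MemLp f 2 μ → Measurable D → MemLp D 2 μ →
    Measurable g → MemLp g 2 μ → Measurable E → MemLp E 2 μ → R j f D → R j g E →
    R j (fun ω => f ω - g ω) (fun ω => D ω - E ω)
  -- The Lipschitz function `θ` is part of the inequality, with the energy of `f` itself on the
  -- right, so no chain rule for `R` is needed.
  logSobolev : ∀ {j f D} {θ : ℝ → ℝ} {m M : ℝ}, Measurable f → MemLp f 2 μ → Measurable D →
    MemLp D 2 μ → R j f D → LipschitzWith 1 θ → (∀ x, θ x ∈ Set.Icc m M) → 0 < m →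
    sp.ent Set.univ (fun ω => θ (f ω) ^ 2) - sp.ent {j}ᶜ (fun ω => θ (f ω) ^ 2) ≤
      c j * ∫ ω, D ω ^ 2 ∂μ

variable {c : ι → ℝ} {R : ι → (Ω → ℝ) → (Ω → ℝ) → Prop}

/-- The logarithmic Sobolev inequality for a function of finitely many coordinates, combined with
the lower bound for the entropy. -/
lemma IsDerivation.le_sum_of_inv (hR : sp.IsDerivation c R) (e : ι ≃ ℕ) (n : ℕ) {V : Ω → ℝ}
    (hV : Measurable V) (hV2 : MemLp V 2 μ) (hi : sp.Inv (initial e n) V) {D : ι → Ω → ℝ}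
    (hD : ∀ j, Measurable (D j)) (hD2 : ∀ j, MemLp (D j) 2 μ) (hVD : ∀ j, R j V (D j))
    {l : ℝ} (hl : 0 < l) :
    (Real.log l + 1) * ∫ ω, V ω ^ 2 ∂μ - l * (∫ ω, |V ω| ∂μ) ^ 2 ≤
      ∑ k ∈ Finset.range n, c (e.symm k) * ∫ ω, D (e.symm k) ω ^ 2 ∂μ := by
  have hmeas : ∀ N, Measurable fun ω => trunc N (V ω) := fun N =>
    (lipschitzWith_trunc N).continuous.measurable.comp hV
  -- The truncated functions are bounded away from `0` and `∞`, as the entropy estimates require,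
  -- and their energy is controlled by that of `V` because `trunc N` is 1-Lipschitz. Dominated
  -- convergence removes the truncation.
  have step : ∀ N : ℕ, (Real.log l + 1) * ∫ ω, trunc N (V ω) ^ 2 ∂μ -
      l * (∫ ω, trunc N (V ω) ∂μ) ^ 2 ≤
      ∑ k ∈ Finset.range n, c (e.symm k) * ∫ ω, D (e.symm k) ω ^ 2 ∂μ := by
    intro N
    have hm0 : (0 : ℝ) < 1 / (N + 1 : ℝ) := by positivity
    have hb : ∀ ω, trunc N (V ω) ^ 2 ∈ Set.Icc ((1 / (N + 1 : ℝ)) ^ 2) ((N + 1 : ℝ) ^ 2) :=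
      fun ω => ⟨pow_le_pow_left₀ hm0.le (trunc_mem_Icc N _).1 2,
        pow_le_pow_left₀ (hm0.le.trans (trunc_mem_Icc N _).1) (trunc_mem_Icc N _).2 2⟩
    refine (le_integral_mul_log_sub (hmeas N) hm0 (fun ω => trunc_mem_Icc N _) hl).trans ?_
    have h1 := sp.ent_initial_sub_le e n ((hmeas N).pow_const 2) (pow_pos hm0 2) hb
    have h2 : sp.Inv (initial e n) (fun ω => trunc N (V ω) ^ 2) := fun a b => by simp only [hi a b]
    have h3 : sp.ent (initial e n) (fun ω => trunc N (V ω) ^ 2) =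
        ∫ ω, trunc N (V ω) ^ 2 * Real.log (trunc N (V ω) ^ 2) ∂μ := by
      rw [ent, h2.avg_eq]
    have h4 : sp.ent ∅ (fun ω => trunc N (V ω) ^ 2) =
        (∫ ω, trunc N (V ω) ^ 2 ∂μ) * Real.log (∫ ω, trunc N (V ω) ^ 2 ∂μ) := by
      simp [ent, sp.avg_empty]
    rw [h3, h4] at h1
    exact h1.trans (Finset.sum_le_sum fun k _ => hR.logSobolev hV hV2 (hD _) (hD2 _) (hVD _)
      (lipschitzWith_trunc N) (trunc_mem_Icc N) hm0)
  have hint : Integrable (fun ω => |V ω| + 1) μ :=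
    (hV2.integrable one_le_two).abs.add (integrable_const 1)
  have hint2 : Integrable (fun ω => (|V ω| + 1) ^ 2) μ := by
    have : MemLp (fun ω => |V ω| + 1) 2 μ := hV2.abs.add (memLp_const 1)
    exact this.integrable_sq
  have hnn : ∀ N x, 0 ≤ trunc N x := fun N x => Real.sqrt_nonneg _
  have t1 : Tendsto (fun N => ∫ ω, trunc N (V ω) ∂μ) atTop (𝓝 (∫ ω, |V ω| ∂μ)) :=
    tendsto_integral_of_dominated_convergence _ (fun N => (hmeas N).aestronglyMeasurable) hint
      (fun N => .of_forall fun ω => by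
        rw [Real.norm_of_nonneg (hnn _ _)]; exact trunc_le _ _)
      (.of_forall fun ω => tendsto_trunc _)
  have t2 : Tendsto (fun N => ∫ ω, trunc N (V ω) ^ 2 ∂μ) atTop (𝓝 (∫ ω, V ω ^ 2 ∂μ)) :=
    tendsto_integral_of_dominated_convergence _
      (fun N => ((hmeas N).pow_const 2).aestronglyMeasurable) hint2
      (fun N => .of_forall fun ω => by
        rw [Real.norm_of_nonneg (sq_nonneg _)]
        exact pow_le_pow_left₀ (hnn _ _) (trunc_le _ _) 2)
      (.of_forall fun ω => by simpa using (tendsto_trunc (V ω)).pow 2)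
  exact le_of_tendsto ((t2.const_mul _).sub ((t1.pow 2).const_mul l)) (.of_forall step)

/-- The increment is the conditional expectation of `Δ_k f` given the first `k + 1` coordinates,
since averaging both over `k` and over the later coordinates leaves the first `k`. Conditional
expectations contract `L¹`. -/
lemma integral_abs_avg_sub_le (e : ι ≃ ℕ) (k : ℕ) {f : Ω → ℝ} (hm : Measurable f)
    (hf : Integrable f μ) :
    ∫ ω, |sp.avg (initial e (k + 1)) f ω - sp.avg (initial e k) f ω| ∂μ ≤
      ∫ ω, |f ω - sp.avg {e.symm k}ᶜ f ω| ∂μ := by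
  have hi := sp.integrable_avg {e.symm k}ᶜ hf
  have hd : Integrable (fun ω => f ω - sp.avg {e.symm k}ᶜ f ω) μ := hf.sub hi
  refine le_of_eq_of_le (integral_congr_ae ?_)
    (integral_abs_condExp_le (m := sp.inv (initial e (k + 1)))
      (fun ω => f ω - sp.avg {e.symm k}ᶜ f ω))
  have h1 := sp.avg_ae_eq_condExp (initial e (k + 1))
    (hm.sub (sp.measurable_avg {e.symm k}ᶜ hm)) hd
  have h2 := sp.avg_sub (initial e (k + 1)) hf hi
  have h3 := sp.avg_avg (initial e (k + 1)) {e.symm k}ᶜ hm hf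
  rw [initial_succ_inter] at h3
  filter_upwards [h1, h2, h3] with ω h1 h2 h3
  rw [← h3, ← h2]
  exact congrArg _ h1

/-- The averages over all but the first `n` coordinates converge in `L²`-norm. -/
lemma tendsto_integral_sq_avg (e : ι ≃ ℕ) (hgen : mΩ ≤ ⨆ j, sp.inv {j}) {f : Ω → ℝ}
    (hm : Measurable f) (hf : MemLp f 2 μ) :
    Tendsto (fun n => ∫ ω, sp.avg (initial e n) f ω ^ 2 ∂μ) atTop (𝓝 (∫ ω, f ω ^ 2 ∂μ)) := by
  let ℱ : Filtration ℕ mΩ :=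
    ⟨fun n => sp.inv (initial e n), fun _ _ h => sp.inv_mono (initial_mono e h),
      fun n => sp.inv_le _⟩
  have hsup : mΩ ≤ ⨆ n, ℱ n := by
    refine hgen.trans (iSup_le fun j => ?_)
    exact (sp.inv_mono (B := initial e (e j + 1)) (by simp [initial])).trans
      (le_iSup (fun n => ℱ n) (e j + 1))
  have hae : ∀ᵐ ω ∂μ, Tendsto (fun n => sp.avg (initial e n) f ω) atTop (𝓝 (f ω)) := by
    have h1 := (hf.integrable one_le_two).tendsto_ae_condExp (ℱ := ℱ)
      (hm.stronglyMeasurable.mono hsup)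
    have h2 : ∀ᵐ ω ∂μ, ∀ n, sp.avg (initial e n) f ω = (μ[f|ℱ n]) ω :=
      ae_all_iff.2 fun n => sp.avg_ae_eq_condExp _ hm (hf.integrable one_le_two)
    filter_upwards [h1, h2] with ω h1 h2
    simpa only [h2] using h1
  have hE : ∀ g : Ω → ℝ, MemLp g 2 μ →
      ∫⁻ ω, ENNReal.ofReal (g ω ^ 2) ∂μ = ENNReal.ofReal (∫ ω, g ω ^ 2 ∂μ) := fun g hg =>
    (ofReal_integral_eq_lintegral_ofReal hg.integrable_sq (.of_forall fun ω => sq_nonneg _)).symm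
  -- Almost sure martingale convergence and Fatou bound the lower limit; the contraction of `L²`
  -- bounds the upper one.
  have hfatou : ∫⁻ ω, ENNReal.ofReal (f ω ^ 2) ∂μ ≤
      liminf (fun n => ∫⁻ ω, ENNReal.ofReal (sp.avg (initial e n) f ω ^ 2) ∂μ) atTop := by
    refine le_trans (le_of_eq (lintegral_congr_ae ?_)) (lintegral_liminf_le fun n =>
      ((sp.measurable_avg _ hm).pow_const 2).ennreal_ofReal)
    filter_upwards [hae] with ω hω
    exact ((ENNReal.continuous_ofReal.tendsto _).comp (hω.pow 2)).liminf_eq.symm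
  have hle : limsup (fun n => ∫⁻ ω, ENNReal.ofReal (sp.avg (initial e n) f ω ^ 2) ∂μ) atTop ≤
      ∫⁻ ω, ENNReal.ofReal (f ω ^ 2) ∂μ := by
    refine limsup_le_of_le (h := .of_forall fun n => ?_)
    rw [hE f hf, hE _ (sp.memLp_avg _ hm hf)]
    exact ENNReal.ofReal_le_ofReal (sp.integral_sq_avg_le _ hm hf)
  have ht := tendsto_of_le_liminf_of_limsup_le hfatou hle
  rw [hE f hf] at ht
  have ht' := (ENNReal.tendsto_toReal ENNReal.ofReal_ne_top).comp ht
  rw [ENNReal.toReal_ofReal (integral_nonneg fun ω => sq_nonneg _)] at ht'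
  refine ht'.congr fun n => ?_
  simp only [Function.comp]
  rw [hE _ (sp.memLp_avg _ hm hf), ENNReal.toReal_ofReal (integral_nonneg fun ω => sq_nonneg _)]

/-- The modified Poincaré inequality, in the form optimised over `l = Var f / ∑ ‖Δ_j f‖₁²`. -/
theorem IsDerivation.modified_poincare (hR : sp.IsDerivation c R) (hc : ∀ j, 0 ≤ c j) (e : ι ≃ ℕ)
    (hgen : mΩ ≤ ⨆ j, sp.inv {j}) {f : Ω → ℝ} (hm : Measurable f) (hf : MemLp f 2 μ)
    {D : ι → Ω → ℝ} (hD : ∀ j, Measurable (D j)) (hD2 : ∀ j, MemLp (D j) 2 μ)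
    (hfD : ∀ j, R j f (D j)) {E B : ℝ}
    (hE : ∀ s : Finset ι, ∑ j ∈ s, c j * ∫ ω, D j ω ^ 2 ∂μ ≤ E)
    (hB : ∀ s : Finset ι, ∑ j ∈ s, (∫ ω, |f ω - sp.avg {j}ᶜ f ω| ∂μ) ^ 2 ≤ B)
    {l : ℝ} (hl : 0 < l) :
    (Real.log l + 1) * (∫ ω, f ω ^ 2 ∂μ - (∫ ω, f ω ∂μ) ^ 2) ≤ E + l * B := by
  classical
  let V : ℕ → Ω → ℝ := fun k ω => sp.avg (initial e (k + 1)) f ω - sp.avg (initial e k) f ω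
  -- The derivative in direction `j` of the average of `f` over all but the first `k` coordinates:
  -- it vanishes until `j` has been revealed.
  let Q : ℕ → ι → Ω → ℝ := fun k j => if e j < k then sp.avg (initial e k) (D j) else fun _ => 0
  have hQm : ∀ k j, Measurable (Q k j) := fun k j => by
    dsimp only [Q]; split_ifs
    exacts [sp.measurable_avg _ (hD j), measurable_const]
  have hQ2 : ∀ k j, MemLp (Q k j) 2 μ := fun k j => by
    dsimp only [Q]; split_ifs
    exacts [sp.memLp_avg _ (hD j) (hD2 j), memLp_const 0]
  have hQR : ∀ k j, R j (sp.avg (initial e k) f) (Q k j) := fun k j => by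
    dsimp only [Q]; split_ifs with h
    exacts [hR.avg hm hf (hD j) (hD2 j) (hfD j) h, hR.avg_zero hm hf h]
  have hVD : ∀ k, (Real.log l + 1) * ∫ ω, V k ω ^ 2 ∂μ - l * (∫ ω, |V k ω| ∂μ) ^ 2 ≤
      ∑ i ∈ Finset.range (k + 1), c (e.symm i) *
        ∫ ω, (Q (k + 1) (e.symm i) ω - Q k (e.symm i) ω) ^ 2 ∂μ := fun k => by
    refine hR.le_sum_of_inv sp e (k + 1) (D := fun j ω => Q (k + 1) j ω - Q k j ω)
      ((sp.measurable_avg _ hm).sub (sp.measurable_avg _ hm))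
      ((sp.memLp_avg _ hm hf).sub (sp.memLp_avg _ hm hf)) (fun a b => ?_)
      (fun j => (hQm _ j).sub (hQm _ j)) (fun j => (hQ2 _ j).sub (hQ2 _ j))
      (fun j => hR.sub (sp.measurable_avg _ hm) (sp.memLp_avg _ hm hf) (hQm _ j) (hQ2 _ j)
        (sp.measurable_avg _ hm) (sp.memLp_avg _ hm hf) (hQm _ j) (hQ2 _ j) (hQR _ j) (hQR _ j)) hl
    have h1 := sp.inv_avg (initial e (k + 1)) f a b
    have h2 := (sp.inv_avg (initial e k) f).mono sp (initial_mono e k.le_succ) a b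
    change sp.avg _ f _ - sp.avg _ f _ = _
    rw [h1, h2]
    rfl
  -- For fixed `j` the functions `Q k j` have orthogonal increments, so energies of increments are
  -- differences of energies. In the step where `j` is revealed the earlier function is `0`.
  have hQQ : ∀ k j, ∫ ω, (Q (k + 1) j ω - Q k j ω) ^ 2 ∂μ =
      ∫ ω, Q (k + 1) j ω ^ 2 ∂μ - ∫ ω, Q k j ω ^ 2 ∂μ := fun k j => by
    dsimp only [Q]
    by_cases h : e j < k
    · rw [if_pos h, if_pos (h.trans k.lt_succ_self)]
      exact sp.integral_sq_avg_sub (initial_mono e k.le_succ) (hD j) (hD2 j)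
    · simp [h]
  have hQle : ∀ n j, ∫ ω, Q n j ω ^ 2 ∂μ ≤ ∫ ω, D j ω ^ 2 ∂μ := fun n j => by
    dsimp only [Q]
    split_ifs
    · exact sp.integral_sq_avg_le _ (hD j) (hD2 j)
    · simpa using integral_nonneg fun ω => sq_nonneg (D j ω)
  have hfin : ∀ n, (Real.log l + 1) * (∫ ω, sp.avg (initial e n) f ω ^ 2 ∂μ - (∫ ω, f ω ∂μ) ^ 2) ≤
      E + l * B := fun n => by
    have h1 : ∑ k ∈ Finset.range n, ∫ ω, V k ω ^ 2 ∂μ =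
        ∫ ω, sp.avg (initial e n) f ω ^ 2 ∂μ - (∫ ω, f ω ∂μ) ^ 2 := by
      have h0 : ∫ ω, sp.avg (initial e 0) f ω ^ 2 ∂μ = (∫ ω, f ω ∂μ) ^ 2 := by
        simp [initial_zero, sp.avg_empty]
      rw [← h0, ← Finset.sum_range_sub (fun k => ∫ ω, sp.avg (initial e k) f ω ^ 2 ∂μ)]
      exact Finset.sum_congr rfl fun k _ =>
        sp.integral_sq_avg_sub (initial_mono e k.le_succ) hm hf
    have h2 : ∑ k ∈ Finset.range n, (∫ ω, |V k ω| ∂μ) ^ 2 ≤ B := by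
      refine le_trans ?_ (hB ((Finset.range n).map e.symm.toEmbedding))
      rw [Finset.sum_map]
      exact Finset.sum_le_sum fun k _ => pow_le_pow_left₀ (integral_nonneg fun ω => abs_nonneg _)
        (sp.integral_abs_avg_sub_le e k hm (hf.integrable one_le_two)) 2
    have h3 : ∑ k ∈ Finset.range n, ∑ i ∈ Finset.range (k + 1), c (e.symm i) *
        ∫ ω, (Q (k + 1) (e.symm i) ω - Q k (e.symm i) ω) ^ 2 ∂μ ≤ E := by
      -- Enlarging the inner range adds only nonnegative terms, so that after exchanging the sums
      -- the one over `k` telescopes; the lower end is `Q 0 = 0`.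
      calc _ ≤ ∑ k ∈ Finset.range n, ∑ i ∈ Finset.range n, c (e.symm i) *
            (∫ ω, Q (k + 1) (e.symm i) ω ^ 2 ∂μ - ∫ ω, Q k (e.symm i) ω ^ 2 ∂μ) := by
            refine Finset.sum_le_sum fun k hk => ?_
            simp only [← hQQ]
            refine Finset.sum_le_sum_of_subset_of_nonneg ?_ fun i _ _ =>
              mul_nonneg (hc _) (integral_nonneg fun ω => sq_nonneg _)
            exact Finset.range_subset_range.2 (Finset.mem_range.1 hk)
        _ = ∑ i ∈ Finset.range n, c (e.symm i) * ∫ ω, Q n (e.symm i) ω ^ 2 ∂μ := by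
            rw [Finset.sum_comm]
            refine Finset.sum_congr rfl fun i _ => ?_
            rw [← Finset.mul_sum, Finset.sum_range_sub (fun k => ∫ ω, Q k (e.symm i) ω ^ 2 ∂μ)]
            simp [Q]
        _ ≤ ∑ i ∈ Finset.range n, c (e.symm i) * ∫ ω, D (e.symm i) ω ^ 2 ∂μ :=
            Finset.sum_le_sum fun i _ => mul_le_mul_of_nonneg_left (hQle _ _) (hc _)
        _ ≤ E := by
            refine le_trans (le_of_eq ?_) (hE ((Finset.range n).map e.symm.toEmbedding))
            rw [Finset.sum_map]
            rfl
    have h4 := Finset.sum_le_sum fun k (_ : k ∈ Finset.range n) => hVD k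
    rw [Finset.sum_sub_distrib, ← Finset.mul_sum, ← Finset.mul_sum, h1] at h4
    have h5 := mul_le_mul_of_nonneg_left h2 hl.le
    linarith
  exact le_of_tendsto (((sp.tendsto_integral_sq_avg e hgen hm hf).sub_const _).const_mul _)
    (.of_forall hfin)

end Splicing

/-! ### The logarithmic Sobolev inequality on the two-point space -/

lemma convexOn_sinh : ConvexOn ℝ (Set.Ici 0) Real.sinh := by
  refine MonotoneOn.convexOn_of_deriv (convex_Ici 0) Real.continuous_sinh.continuousOn
    Real.differentiable_sinh.differentiableOn ?_
  rw [interior_Ici, Real.deriv_sinh]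
  intro x hx y hy hxy
  rw [Real.cosh_le_cosh, abs_of_pos hx, abs_of_pos hy]
  exact hxy

/-- `sinh` is convex on the half line and vanishes at `0`, so `sinh y / y` increases; here in
cross-multiplied form. -/
lemma mul_sinh_le {y z : ℝ} (hy : 0 ≤ y) (hyz : y ≤ z) :
    z * Real.sinh y ≤ y * Real.sinh z := by
  rcases hy.eq_or_lt with rfl | hy
  · simp
  have hz := hy.trans_le hyz
  have h := convexOn_sinh.2 (Set.self_mem_Ici (a := (0 : ℝ))) (Set.mem_Ici.2 hz.le)
    (show 0 ≤ 1 - y / z by rw [sub_nonneg, div_le_one hz]; exact hyz)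
    (show 0 ≤ y / z by positivity) (by ring)
  simp only [smul_eq_mul, mul_zero, zero_add, Real.sinh_zero, div_mul_cancel₀ y hz.ne'] at h
  calc z * Real.sinh y ≤ z * (y / z * Real.sinh z) := by gcongr
    _ = y * Real.sinh z := by field_simp

/-- `log (s / (1 - s))`. -/
noncomputable def logit (s : ℝ) : ℝ := Real.log s - Real.log (1 - s)

lemma logit_nonneg {s : ℝ} (h : 1 / 2 ≤ s) (h1 : s < 1) : 0 ≤ logit s :=
  sub_nonneg.2 (Real.log_le_log (by linarith) (by linarith))

lemma logit_le {s t : ℝ} (h : 0 < s) (hst : s ≤ t) (h1 : t < 1) : logit s ≤ logit t :=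
  sub_le_sub (Real.log_le_log h hst) (Real.log_le_log (by linarith) (by linarith))

/-- `exp (logit s / 2) = √s / √(1 - s)`. -/
lemma two_mul_sinh_logit {s : ℝ} (h0 : 0 < s) (h1 : s < 1) :
    2 * Real.sinh (logit s / 2) = (2 * s - 1) / √(s * (1 - s)) := by
  have h1' : 0 < 1 - s := by linarith
  have h2 : logit s / 2 = Real.log (√s / √(1 - s)) := by
    rw [Real.log_div (by positivity) (by positivity), Real.log_sqrt h0.le, Real.log_sqrt h1'.le,
      logit]
    ring
  rw [h2, Real.sinh_log (by positivity), Real.sqrt_mul h0.le]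
  have h3 := Real.sq_sqrt h0.le
  have h4 := Real.sq_sqrt h1'.le
  have h5 : 0 < √s := Real.sqrt_pos.2 h0
  have h6 : 0 < √(1 - s) := Real.sqrt_pos.2 h1'
  rw [inv_div]
  field_simp
  rw [h3, h4]; ring

/-- In the variable `logit s`, the sign of this derivative is governed by the monotone ratio `sinh x
/ x` compared with `1 / K`. -/
lemma hasDerivAt_binEntropy_sub {s : ℝ} (h0 : 0 < s) (h1 : s < 1) (K : ℝ) :
    HasDerivAt (fun s => Real.binEntropy s - 2 * K * √(s * (1 - s)))
      (K * (2 * Real.sinh (logit s / 2)) - logit s) s := by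
  have h1' : 0 < 1 - s := by linarith
  have ha := Real.hasDerivAt_binEntropy h0.ne' h1.ne
  have hb : HasDerivAt (fun s : ℝ => s * (1 - s)) (1 - 2 * s) s := by
    refine ((hasDerivAt_id' s).mul ((hasDerivAt_id' s).const_sub 1)).congr_deriv ?_
    ring
  have hc := (hb.sqrt (by positivity)).const_mul (2 * K)
  refine (ha.sub hc).congr_deriv ?_
  rw [two_mul_sinh_logit h0 h1, logit]
  have : 0 < √(s * (1 - s)) := by positivity
  field_simp
  ring

/-- On the two-point space, the deficit is minimal at `q` (and at `1 - q`). -/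
lemma binEntropy_sub_le {q K : ℝ} (hq : 1 / 2 ≤ q) (hq1 : q < 1)
    (hK : K * (2 * Real.sinh (logit q / 2)) = logit q) (hK2 : q = 1 / 2 → K = 1)
    {s : ℝ} (hs : 0 < s) (hs1 : s < 1) :
    Real.binEntropy q - 2 * K * √(q * (1 - q)) ≤ Real.binEntropy s - 2 * K * √(s * (1 - s)) := by
  wlog hs2 : 1 / 2 ≤ s generalizing s
  · have := this (s := 1 - s) (by linarith) (by linarith) (by linarith)
    rwa [Real.binEntropy_one_sub, sub_sub_cancel, mul_comm (1 - s)] at this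
  set φ : ℝ → ℝ := fun s => Real.binEntropy s - 2 * K * √(s * (1 - s)) with hφ
  have hcont : Continuous φ := by
    have := Real.binEntropy_continuous
    fun_prop
  -- Monotonicity of `sinh x / x` at the points `logit x / 2` and `logit y / 2`. With `hK`, which
  -- says that the derivative vanishes at `q`, it decides the sign on either side of `q`.
  have hsl : ∀ {x y : ℝ}, 1 / 2 ≤ x → x ≤ y → y < 1 →
      logit y * (2 * Real.sinh (logit x / 2)) ≤ logit x * (2 * Real.sinh (logit y / 2)) := by
    intro x y hx hxy hy
    have := mul_sinh_le (y := logit x / 2) (z := logit y / 2)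
      (by linarith [logit_nonneg hx (hxy.trans_lt hy)])
      (by linarith [logit_le (by linarith) hxy hy])
    linarith
  have hLq : 1 / 2 < q → 0 < logit q := fun h =>
    sub_pos.2 (Real.log_lt_log (by linarith) (by linarith))
  have hσ : ∀ {x : ℝ}, 0 < logit x → 0 < 2 * Real.sinh (logit x / 2) := fun h =>
    mul_pos two_pos (Real.sinh_pos_iff.2 (by linarith))
  rcases le_total s q with hsq | hqs
  · have : AntitoneOn φ (Set.Icc (1 / 2) q) := by
      refine antitoneOn_of_deriv_nonpos (convex_Icc _ _) hcont.continuousOn ?_ ?_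
      · intro x hx
        rw [interior_Icc] at hx
        exact (hasDerivAt_binEntropy_sub (by linarith [hx.1]) (hx.2.trans hq1)
          K).differentiableAt.differentiableWithinAt
      · intro x hx
        rw [interior_Icc] at hx
        rw [(hasDerivAt_binEntropy_sub (by linarith [hx.1]) (hx.2.trans hq1) K).deriv]
        have hp := hσ (hLq (hx.1.trans hx.2))
        have h := hsl hx.1.le hx.2.le hq1
        nth_rewrite 1 [← hK] at h
        have : (K * (2 * Real.sinh (logit x / 2))) * (2 * Real.sinh (logit q / 2)) ≤
          logit x * (2 * Real.sinh (logit q / 2)) := by linarith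
        linarith [le_of_mul_le_mul_right this hp]
    exact this ⟨hs2, hsq⟩ ⟨hq, le_rfl⟩ hsq
  · have : MonotoneOn φ (Set.Ico q 1) := by
      refine monotoneOn_of_deriv_nonneg (convex_Ico _ _) hcont.continuousOn ?_ ?_
      · intro x hx
        rw [interior_Ico] at hx
        exact (hasDerivAt_binEntropy_sub (by linarith [hx.1]) hx.2
          K).differentiableAt.differentiableWithinAt
      · intro x hx
        rw [interior_Ico] at hx
        rw [(hasDerivAt_binEntropy_sub (by linarith [hx.1]) hx.2 K).deriv]
        -- At `q = 1/2` the equation `hK` reads `0 = 0` and does not determine `K`; the limiting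
        -- value `K = 1` is used, with `x ≤ sinh x`.
        rcases hq.eq_or_lt with h2 | h2
        · rw [hK2 h2.symm]
          have := Real.self_le_sinh_iff.2
            (show 0 ≤ logit x / 2 by linarith [logit_nonneg (by linarith [hx.1]) hx.2])
          linarith
        · have hp := hσ (hLq h2)
          have h := hsl hq hx.1.le hx.2
          nth_rewrite 2 [← hK] at h
          have : logit x * (2 * Real.sinh (logit q / 2)) ≤
            (K * (2 * Real.sinh (logit x / 2))) * (2 * Real.sinh (logit q / 2)) := by linarith
          linarith [le_of_mul_le_mul_right this hp]
    exact this ⟨le_rfl, hq1⟩ ⟨hqs, hs1⟩ hqs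

/-- The only property of the constant needed when `p ≠ 1/2`, stated without division so that it also
covers `p = 1/2`. -/
lemma cLS_mul (p : ℝ) : cLS p * (1 - p - p) = Real.log (1 - p) - Real.log p := by
  rw [cLS]
  split_ifs with h
  · subst h; norm_num
  · have : p - (1 - p) ≠ 0 := fun h' => h (by linarith)
    field_simp
    ring

lemma cLS_one_sub (p : ℝ) : cLS (1 - p) = cLS p := by
  rw [cLS, cLS]
  by_cases h : p = 1 / 2
  · rw [if_pos h, if_pos (by linarith)]
  · rw [if_neg h, if_neg (fun h' => h (by linarith)), sub_sub_cancel, ← neg_div_neg_eq]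
    ring_nf

/-- The logarithmic Sobolev inequality on the two-point space, with the optimal constant. -/
lemma two_point_logSobolev {p : ℝ} (hp0 : 0 < p) (hp1 : p < 1) {a b : ℝ} (ha : 0 < a)
    (hb : 0 < b) :
    p * (a ^ 2 * Real.log (a ^ 2)) + (1 - p) * (b ^ 2 * Real.log (b ^ 2)) -
      (p * a ^ 2 + (1 - p) * b ^ 2) * Real.log (p * a ^ 2 + (1 - p) * b ^ 2) ≤
      cLS p * (p * (1 - p) * (a - b) ^ 2) := by
  wlog hp2 : p ≤ 1 / 2 generalizing p a b
  · have := this (p := 1 - p) (by linarith) (by linarith) hb ha (by linarith)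
    rw [sub_sub_cancel, cLS_one_sub] at this
    have e1 : (1 - p) * b ^ 2 + p * a ^ 2 = p * a ^ 2 + (1 - p) * b ^ 2 := by ring
    rw [e1] at this
    refine le_of_eq_of_le (by ring) (this.trans (le_of_eq (by ring)))
  obtain ⟨q, rfl⟩ : ∃ q, p = 1 - q := ⟨1 - p, by ring⟩
  rw [sub_sub_cancel]
  have hq0 : 0 < q := by linarith
  have hq1 : q < 1 := by linarith
  have hc := cLS_mul (1 - q)
  rw [sub_sub_cancel] at hc
  set c := cLS (1 - q) with hcdef
  set m := (1 - q) * a ^ 2 + q * b ^ 2 with hm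
  have hm0 : 0 < m := by positivity
  -- Homogeneity reduces to one parameter: `s` is the share of `a²` in the second moment `m`. The
  -- case `a = b` corresponds to `s = 1 - q`.
  set s := (1 - q) * a ^ 2 / m with hs
  have hs0 : 0 < s := by positivity
  have hs1' : 1 - s = q * b ^ 2 / m := by
    rw [hs, eq_div_iff hm0.ne']; field_simp; rw [hm]; ring
  have hs1 : s < 1 := by
    have : 0 < 1 - s := by rw [hs1']; positivity
    linarith
  have hsq : 0 < √(q * (1 - q)) := Real.sqrt_pos.2 (mul_pos hq0 hp0)
  have hsq2 : √(q * (1 - q)) * √(q * (1 - q)) = q * (1 - q) :=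
    Real.mul_self_sqrt (mul_pos hq0 hp0).le
  -- Divided by `m`, the cross term `2 c q (1 - q) a b` equals `2 K √(s (1 - s))` with `K = c √(q (1
  -- - q))`. The critical-point equation for this `K` is the definition of `c`.
  have key := binEntropy_sub_le (q := q) (K := c * √(q * (1 - q))) (by linarith) hq1
    (by
      rw [two_mul_sinh_logit hq0 hq1, logit, ← hc]
      field_simp
      ring)
    (by
      intro h
      have : √(q * (1 - q)) = 1 / 2 := by
        rw [h, show (1 / 2 : ℝ) * (1 - 1 / 2) = (1 / 2) ^ 2 by norm_num, Real.sqrt_sq (by norm_num)]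
      rw [this, hcdef, cLS, if_pos (by linarith)]
      norm_num) hs0 hs1
  have hss : √(s * (1 - s)) = √(q * (1 - q)) * (a * b / m) := by
    rw [hs1', hs, ← Real.sqrt_sq (show 0 ≤ a * b / m by positivity),
      ← Real.sqrt_mul (mul_pos hq0 hp0).le]
    congr 1
    field_simp
  have hla : Real.log (a ^ 2) = Real.log s + Real.log m - Real.log (1 - q) := by
    rw [hs, Real.log_div (by positivity) hm0.ne', Real.log_mul hp0.ne' (by positivity)]; ring
  have hlb : Real.log (b ^ 2) = Real.log (1 - s) + Real.log m - Real.log q := by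
    rw [hs1', Real.log_div (by positivity) hm0.ne', Real.log_mul hq0.ne' (by positivity)]; ring
  have hma : (1 - q) * a ^ 2 = m * s := by rw [hs]; field_simp
  have hmb : q * b ^ 2 = m * (1 - s) := by rw [hs1']; field_simp
  have hab : (1 - q) * q * (a - b) ^ 2 =
      m * (q * s + (1 - q) * (1 - s)) - 2 * (q * (1 - q)) * (a * b) := by
    have : m * (q * s + (1 - q) * (1 - s)) = q * (m * s) + (1 - q) * (m * (1 - s)) := by ring
    rw [this, ← hma, ← hmb]; ring
  have hsm : c * √(q * (1 - q)) * √(s * (1 - s)) * m = c * (q * (1 - q)) * (a * b) := by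
    rw [hss]
    have : m * (a * b / m) = a * b := by field_simp
    calc _ = c * (√(q * (1 - q)) * √(q * (1 - q))) * (m * (a * b / m)) := by ring
      _ = _ := by rw [hsq2, this]
  simp only [Real.binEntropy, Real.log_inv] at key
  have hk2 : c * √(q * (1 - q)) * √(q * (1 - q)) = c * (q * (1 - q)) := by rw [mul_assoc, hsq2]
  have key2 := mul_le_mul_of_nonneg_left key hm0.le
  have e1 : (1 - q) * (a ^ 2 * Real.log (a ^ 2)) + q * (b ^ 2 * Real.log (b ^ 2)) =
      m * s * (Real.log s + Real.log m - Real.log (1 - q)) +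
      m * (1 - s) * (Real.log (1 - s) + Real.log m - Real.log q) := by
    rw [← hla, ← hlb, ← hma, ← hmb]; ring
  rw [e1, hab]
  -- The terms linear in `s` on the two sides have equal slopes, by the choice of `c`; only binary
  -- entropy and the square root remain, which is `key`.
  have hcq : m * s * (c * (q - (1 - q))) = m * s * (Real.log q - Real.log (1 - q)) := by rw [hc]
  have hcq2 : m * (1 - q) * (c * (q - (1 - q))) =
    m * (1 - q) * (Real.log q - Real.log (1 - q)) := by rw [hc]
  have key3 : m * (2 * (c * √(q * (1 - q)) * √(q * (1 - q)))) = m * (2 * (c * (q * (1 - q)))) := by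
    rw [hk2]
  linarith

/-! ### Splicing of the coordinates in a product -/

open Classical in
/-- Choose the coordinates in `A` from the first point, the others from the second one. -/
noncomputable def choose {ι : Type*} {X : Type*} (A : Set ι) (a b : ι → X) (i : ι) : X :=
  if i ∈ A then a i else b i

lemma choose_of_mem {ι : Type*} {X : Type*} {A : Set ι} {i : ι} (h : i ∈ A) (a b : ι → X) :
    choose A a b i = a i := if_pos h

lemma choose_choose {ι : Type*} {X : Type*} (A B : Set ι) (a b c : ι → X) :
    choose B (choose A a b) c = choose (A ∩ B) a (choose B b c) := by
  funext i
  by_cases hA : i ∈ A <;> by_cases hB : i ∈ B <;> simp [choose, hA, hB]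

lemma measurable_choose {ι X : Type*} [MeasurableSpace X] (A : Set ι) :
    Measurable (fun q : (ι → X) × (ι → X) => choose A q.1 q.2) := by
  refine measurable_pi_lambda _ fun i => ?_
  by_cases hA : i ∈ A <;> simp only [choose, hA, if_true, if_false] <;> fun_prop

/-- A cylinder pulls back to a product of two cylinders, over its coordinates inside and outside
`A`, so its probability factors as it should. -/
lemma measurePreserving_choose {ι X : Type*} [MeasurableSpace X] (A : Set ι)
    (m : Measure X) [IsProbabilityMeasure m] :
    MeasurePreserving (fun q : (ι → X) × (ι → X) => choose A q.1 q.2)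
      ((Measure.infinitePi fun _ => m).prod (Measure.infinitePi fun _ => m))
      (Measure.infinitePi fun _ => m) := by
  classical
  refine ⟨measurable_choose A, Measure.eq_infinitePi _ fun s t ht => ?_⟩
  rw [Measure.map_apply (measurable_choose A) (.pi s.countable_toSet fun _ _ => ht _)]
  have : (fun q : (ι → X) × (ι → X) => choose A q.1 q.2) ⁻¹' (s : Set ι).pi t =
      ((s.filter (· ∈ A) : Finset ι) : Set ι).pi t ×ˢ
        ((s.filter (· ∉ A) : Finset ι) : Set ι).pi t := by
    ext q
    simp only [Set.mem_preimage, Set.mem_pi, Finset.mem_coe, Set.mem_prod, Finset.mem_filter]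
    constructor
    · intro h
      refine ⟨fun i hi => ?_, fun i hi => ?_⟩
      · simpa [choose, hi.2] using h i hi.1
      · simpa [choose, hi.2] using h i hi.1
    · intro h i hi
      by_cases hA : i ∈ A
      · simpa [choose, hA] using h.1 i ⟨hi, hA⟩
      · simpa [choose, hA] using h.2 i ⟨hi, hA⟩
  rw [this, Measure.prod_prod, Measure.infinitePi_pi _ (fun i _ => ht i),
    Measure.infinitePi_pi _ (fun i _ => ht i)]
  exact Finset.prod_filter_mul_prod_filter_not s (· ∈ A) _

/-- The composition regroups `(X × Y) × (X × Y)` as `(X × X) × (Y × Y)`, where `φ` and `ψ` act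
separately. -/
lemma MeasurePreserving.prod_prod {X Y : Type*} [MeasurableSpace X] [MeasurableSpace Y]
    {μ : Measure X} {ν : Measure Y} [SFinite μ] [SFinite ν] {φ : X × X → X} {ψ : Y × Y → Y}
    (hφ : MeasurePreserving φ (μ.prod μ) μ) (hψ : MeasurePreserving ψ (ν.prod ν) ν) :
    MeasurePreserving (fun q : (X × Y) × (X × Y) => (φ (q.1.1, q.2.1), ψ (q.1.2, q.2.2)))
      ((μ.prod ν).prod (μ.prod ν)) (μ.prod ν) := by
  have h1 := measurePreserving_prodAssoc μ ν (μ.prod ν)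
  have h2 := (MeasurePreserving.id μ).prod (measurePreserving_prodAssoc ν μ ν).symm
  have h3 := (MeasurePreserving.id μ).prod
    ((Measure.measurePreserving_swap (μ := ν) (ν := μ)).prod (MeasurePreserving.id ν))
  have h4 := (MeasurePreserving.id μ).prod (measurePreserving_prodAssoc μ ν ν)
  have h5 := (measurePreserving_prodAssoc μ μ (ν.prod ν)).symm
  exact (hφ.prod hψ).comp (h5.comp (h4.comp (h3.comp (h2.comp h1))))

instance {S : Type*} (p : unitInterval) : IsProbabilityMeasure (bernoulliPi S p) := by
  unfold bernoulliPi; infer_instance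

instance {S : Type*} (p : unitInterval) (ν : Measure ℝ) [IsProbabilityMeasure ν] :
    IsProbabilityMeasure (mixedProduct S p ν) := by
  unfold mixedProduct; infer_instance

/-- The coordinates of `{0,1}^S × ℝ^ℕ` are indexed by `S ⊕ ℕ`. -/
noncomputable def mixedSplicing (S : Type*) (p : unitInterval) (ν : Measure ℝ)
    [IsProbabilityMeasure ν] : Splicing (S ⊕ ℕ) (mixedProduct S p ν) where
  splice A a b := (choose (Sum.inl ⁻¹' A) a.1 b.1, choose (Sum.inr ⁻¹' A) a.2 b.2)
  measurePreserving A := MeasurePreserving.prod_prod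
    (measurePreserving_choose (Sum.inl ⁻¹' A) (bernoulliMeasure true false p))
    (measurePreserving_choose (Sum.inr ⁻¹' A) ν)
  splice_splice A B a b c := Prod.ext (choose_choose _ _ _ _ _) (choose_choose _ _ _ _ _)
  splice_right A a b c := by
    refine Prod.ext ?_ ?_ <;> funext i <;> simp only [choose] <;> split_ifs <;> rfl
  splice_univ a b := by
    refine Prod.ext ?_ ?_ <;> funext i <;> simp [choose]
  splice_empty a b := by
    refine Prod.ext ?_ ?_ <;> funext i <;> simp [choose]

section

variable {S : Type*} (p : unitInterval) (ν : Measure ℝ) [IsProbabilityMeasure ν]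

lemma splice_compl_inl [DecidableEq S] (s : S) (a b : (S → Bool) × (ℕ → ℝ)) :
    (mixedSplicing S p ν).splice {Sum.inl s}ᶜ a b = (Function.update a.1 s (b.1 s), a.2) := by
  refine Prod.ext ?_ ?_ <;> funext i
  · by_cases h : i = s
    · subst h; simp [mixedSplicing, choose]
    · simp [mixedSplicing, choose, h]
  · simp [mixedSplicing, choose]

lemma splice_compl_inr (s : ℕ) (a b : (S → Bool) × (ℕ → ℝ)) :
    (mixedSplicing S p ν).splice {Sum.inr s}ᶜ a b = (a.1, Function.update a.2 s (b.2 s)) := by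
  refine Prod.ext ?_ ?_ <;> funext i
  · simp [mixedSplicing, choose]
  · by_cases h : i = s
    · subst h; simp [mixedSplicing, choose]
    · simp [mixedSplicing, choose, h]

lemma splice_update {i : ℕ} {A : Set (S ⊕ ℕ)} (hi : Sum.inr i ∈ A) (a b : (S → Bool) × (ℕ → ℝ))
    (t : ℝ) :
    (mixedSplicing S p ν).splice A (a.1, Function.update a.2 i t) b =
      (((mixedSplicing S p ν).splice A a b).1,
        Function.update ((mixedSplicing S p ν).splice A a b).2 i t) := by
  refine Prod.ext rfl ?_
  funext j
  by_cases h : j = i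
  · subst h; simp [mixedSplicing, choose, hi]
  · by_cases hj : Sum.inr j ∈ A <;> simp [mixedSplicing, choose, h, hj]

lemma splice_update_notMem {i : ℕ} {A : Set (S ⊕ ℕ)} (hi : Sum.inr i ∉ A)
    (a b : (S → Bool) × (ℕ → ℝ)) (t : ℝ) :
    (mixedSplicing S p ν).splice A (a.1, Function.update a.2 i t) b =
      (mixedSplicing S p ν).splice A a b := by
  refine Prod.ext rfl ?_
  funext j
  by_cases h : j = i
  · subst h; simp [mixedSplicing, choose, hi]
  · by_cases hj : Sum.inr j ∈ A <;> simp [mixedSplicing, choose, h, hj]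

lemma measurePreserving_eval_fst (s : S) :
    MeasurePreserving (fun ω : (S → Bool) × (ℕ → ℝ) => ω.1 s) (mixedProduct S p ν)
      (bernoulliMeasure true false p) :=
  (measurePreserving_eval_infinitePi (fun _ : S => bernoulliMeasure true false p) s).comp
    measurePreserving_fst

lemma measurePreserving_eval_snd (i : ℕ) :
    MeasurePreserving (fun ω : (S → Bool) × (ℕ → ℝ) => ω.2 i) (mixedProduct S p ν) ν :=
  (measurePreserving_eval_infinitePi (fun _ : ℕ => ν) i).comp measurePreserving_snd

/-- Replacing one coordinate by an independent copy preserves the measure. -/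
lemma measurePreserving_update_bit [DecidableEq S] (s : S) :
    MeasurePreserving (fun q : ((S → Bool) × (ℕ → ℝ)) × Bool => (Function.update q.1.1 s q.2, q.1.2))
      ((mixedProduct S p ν).prod (bernoulliMeasure true false p)) (mixedProduct S p ν) := by
  have h1 := (mixedSplicing S p ν).measurePreserving {Sum.inl s}ᶜ
  simp only [splice_compl_inl] at h1
  have h2 := (MeasurePreserving.id (mixedProduct S p ν)).prod (measurePreserving_eval_fst p ν s)
  refine ⟨by fun_prop, ?_⟩
  rw [← h2.map_eq, Measure.map_map (by fun_prop) h2.measurable]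
  exact h1.map_eq

lemma measurePreserving_update_real (i : ℕ) :
    MeasurePreserving (fun q : ((S → Bool) × (ℕ → ℝ)) × ℝ => (q.1.1, Function.update q.1.2 i q.2))
      ((mixedProduct S p ν).prod ν) (mixedProduct S p ν) := by
  have h1 := (mixedSplicing S p ν).measurePreserving {Sum.inr i}ᶜ
  simp only [splice_compl_inr] at h1
  have h2 := (MeasurePreserving.id (mixedProduct S p ν)).prod
    (measurePreserving_eval_snd (S := S) p ν i)
  refine ⟨by fun_prop, ?_⟩
  rw [← h2.map_eq, Measure.map_map (by fun_prop) h2.measurable]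
  exact h1.map_eq

lemma avg_compl_inl [DecidableEq S] (s : S) (f : (S → Bool) × (ℕ → ℝ) → ℝ) (ω : (S → Bool) × (ℕ → ℝ)) :
    (mixedSplicing S p ν).avg {Sum.inl s}ᶜ f ω =
      ∫ b, f (Function.update ω.1 s b, ω.2) ∂(bernoulliMeasure true false p) := by
  simp only [Splicing.avg, splice_compl_inl]
  rw [← (measurePreserving_eval_fst p ν s).map_eq, integral_map]
  · exact (measurePreserving_eval_fst p ν s).measurable.aemeasurable
  · exact (measurable_of_countable (fun b => f (Function.update ω.1 s b, ω.2))).aestronglyMeasurable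

lemma avg_compl_inr (i : ℕ) {f : (S → Bool) × (ℕ → ℝ) → ℝ} (hf : Measurable f)
    (ω : (S → Bool) × (ℕ → ℝ)) :
    (mixedSplicing S p ν).avg {Sum.inr i}ᶜ f ω = ∫ t, realSlice f i ω t ∂ν := by
  have hm := measurePreserving_eval_snd (S := S) p ν i
  have h := integral_map (μ := mixedProduct S p ν) hm.measurable.aemeasurable
    (f := realSlice f i ω)
    (hf.comp (by fun_prop : Measurable fun t => (ω.1, Function.update ω.2 i t))).aestronglyMeasurable
  rw [hm.map_eq] at h
  rw [h]
  simp only [Splicing.avg, splice_compl_inr]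
  rfl

/-- Each coordinate map is unchanged by splicing outside its own coordinate, and together these maps
generate the product `σ`-algebra. Martingale convergence needs this to recover `f`. -/
lemma mixedSplicing_generate :
    (inferInstance : MeasurableSpace ((S → Bool) × (ℕ → ℝ))) ≤
      ⨆ j, (mixedSplicing S p ν).inv {j} := by
  have key : ∀ {X : Type} [MeasurableSpace X] (j : S ⊕ ℕ) (g : (S → Bool) × (ℕ → ℝ) → X),
      Measurable g → (∀ a b, g ((mixedSplicing S p ν).splice {j} a b) = g a) →
      MeasurableSpace.comap g inferInstance ≤ ⨆ j, (mixedSplicing S p ν).inv {j} := by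
    intro X _ j g hg hi
    refine le_trans ?_ (le_iSup (fun j => (mixedSplicing S p ν).inv {j}) j)
    rintro _ ⟨t, ht, rfl⟩
    exact ⟨hg ht, fun a b => by simp only [Set.mem_preimage, hi]⟩
  change MeasurableSpace.comap _ _ ⊔ MeasurableSpace.comap _ _ ≤ _
  refine sup_le ?_ ?_
  · change MeasurableSpace.comap _ (⨆ s : S, MeasurableSpace.comap _ _) ≤ _
    rw [MeasurableSpace.comap_iSup]
    refine iSup_le fun s => ?_
    rw [MeasurableSpace.comap_comp]
    exact key (Sum.inl s) (fun ω => ω.1 s) (by fun_prop)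
      (fun a b => by simp [mixedSplicing, choose])
  · change MeasurableSpace.comap _ (⨆ i : ℕ, MeasurableSpace.comap _ _) ≤ _
    rw [MeasurableSpace.comap_iSup]
    refine iSup_le fun i => ?_
    rw [MeasurableSpace.comap_comp]
    exact key (Sum.inr i) (fun ω => ω.2 i) (by fun_prop)
      (fun a b => by simp [mixedSplicing, choose])

end

/-! ### Entropy in one coordinate, and the Bernoulli case. -/

lemma abs_mul_log_le {m M x : ℝ} (hm0 : 0 < m) (hx : x ∈ Set.Icc m M) :
    |x * Real.log x| ≤ M * (|Real.log m| + |Real.log M|) := by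
  have hx0 : 0 < x := hm0.trans_le hx.1
  rw [abs_mul, abs_of_pos hx0]
  refine mul_le_mul hx.2 ?_ (abs_nonneg _) (hx0.le.trans hx.2)
  exact (abs_le_max_abs_abs (Real.log_le_log hm0 hx.1) (Real.log_le_log hx0 hx.2)).trans
    (max_le (by linarith [abs_nonneg (Real.log M)]) (by linarith [abs_nonneg (Real.log m)]))

lemma measurable_mul_log {Ω : Type*} [MeasurableSpace Ω] {F : Ω → ℝ} (hF : Measurable F) :
    Measurable fun ω => F ω * Real.log (F ω) := hF.mul hF.log

lemma integrable_mul_log {Ω : Type*} [MeasurableSpace Ω] {μ : Measure Ω} [IsFiniteMeasure μ]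
    {F : Ω → ℝ} (hF : Measurable F) {m M : ℝ} (hm0 : 0 < m) (hb : ∀ ω, F ω ∈ Set.Icc m M) :
    Integrable (fun ω => F ω * Real.log (F ω)) μ :=
  .of_bound (measurable_mul_log hF).aestronglyMeasurable _
    (.of_forall fun ω => abs_mul_log_le hm0 (hb ω))

/-- The loss of entropy under averaging is the mean of the conditional entropy, so pointwise bounds
for the latter integrate. -/
lemma Splicing.ent_univ_sub_le {ι Ω : Type*} {mΩ : MeasurableSpace Ω} {μ : Measure Ω}
    (sp : Splicing ι μ) [IsProbabilityMeasure μ] (A : Set ι) {F G : Ω → ℝ} (hF : Measurable F)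
    {m M : ℝ} (hm0 : 0 < m) (hb : ∀ ω, F ω ∈ Set.Icc m M) (hG : Integrable G μ)
    (h : ∀ᵐ ω ∂μ, sp.avg A (fun ω => F ω * Real.log (F ω)) ω -
      sp.avg A F ω * Real.log (sp.avg A F ω) ≤ G ω) :
    sp.ent Set.univ F - sp.ent A F ≤ ∫ ω, G ω ∂μ := by
  have hi := integrable_mul_log (μ := μ) hF hm0 hb
  rw [ent, ent, sp.avg_univ, ← sp.integral_avg A (measurable_mul_log hF) hi, ← integral_sub]
  · refine integral_mono_ae ((sp.integrable_avg A hi).sub ?_) hG h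
    exact integrable_mul_log (sp.measurable_avg A hF) hm0 (sp.avg_mem_Icc A hF hb)
  · exact sp.integrable_avg A hi
  · exact integrable_mul_log (sp.measurable_avg A hF) hm0 (sp.avg_mem_Icc A hF hb)

lemma sq_mem_Icc {θ : ℝ → ℝ} {m M : ℝ} (hb : ∀ x, θ x ∈ Set.Icc m M) (hm0 : 0 < m) (x : ℝ) :
    θ x ^ 2 ∈ Set.Icc (m ^ 2) (M ^ 2) :=
  ⟨pow_le_pow_left₀ hm0.le (hb x).1 2, pow_le_pow_left₀ (hm0.le.trans (hb x).1) (hb x).2 2⟩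

lemma cLS_nonneg {p : ℝ} (hp0 : 0 < p) (hp1 : p < 1) : 0 ≤ cLS p := by
  rw [cLS]
  split_ifs with h
  · norm_num
  rcases le_total p (1 - p) with h1 | h1
  · exact div_nonneg_of_nonpos (sub_nonpos.2 (Real.log_le_log hp0 h1)) (sub_nonpos.2 h1)
  · exact div_nonneg (sub_nonneg.2 (Real.log_le_log (by linarith) h1)) (sub_nonneg.2 h1)

/-- The logarithmic Sobolev inequality on the two-point space, for Lipschitz images. -/
lemma bernoulli_logSobolev {p : unitInterval} (hp0 : 0 < (p : ℝ)) (hp1 : (p : ℝ) < 1)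
    (u : Bool → ℝ) {θ : ℝ → ℝ} {m M : ℝ} (hθ : LipschitzWith 1 θ)
    (hb : ∀ x, θ x ∈ Set.Icc m M) (hm0 : 0 < m) :
    ∫ b, θ (u b) ^ 2 * Real.log (θ (u b) ^ 2) ∂(bernoulliMeasure true false p) -
      (∫ b, θ (u b) ^ 2 ∂(bernoulliMeasure true false p)) *
        Real.log (∫ b, θ (u b) ^ 2 ∂(bernoulliMeasure true false p)) ≤
      cLS p * (p * (1 - p) * (u true - u false) ^ 2) := by
  simp only [integral_bernoulliMeasure, smul_eq_mul]
  refine (two_point_logSobolev hp0 hp1 (hm0.trans_le (hb _).1) (hm0.trans_le (hb _).1)).trans ?_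
  refine mul_le_mul_of_nonneg_left ?_ (cLS_nonneg hp0 hp1)
  refine mul_le_mul_of_nonneg_left ?_ (mul_nonneg hp0.le (by linarith))
  rw [← sq_abs, ← sq_abs (u true - u false)]
  have := hθ.dist_le_mul (u true) (u false)
  rw [Real.dist_eq, Real.dist_eq, NNReal.coe_one, one_mul] at this
  exact pow_le_pow_left₀ (abs_nonneg _) this 2

/-! ### The logarithmic Sobolev inequality for the Gaussian measure -/

/-- The coordinates of an infinite product are indexed by `ι`. -/
noncomputable def piSplicing (ι : Type*) {X : Type*} [MeasurableSpace X] (m : Measure X)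
    [IsProbabilityMeasure m] : Splicing ι (Measure.infinitePi fun _ : ι => m) where
  splice := choose
  measurePreserving A := measurePreserving_choose A m
  splice_splice := choose_choose
  splice_right A a b c := by funext i; simp only [choose]; split_ifs <;> rfl
  splice_univ a b := by funext i; simp [choose]
  splice_empty a b := by funext i; simp [choose]

lemma piSplicing_avg_compl (p : unitInterval) (k : ℕ) (f : (ℕ → Bool) → ℝ) (ω : ℕ → Bool) :
    (piSplicing ℕ (bernoulliMeasure true false p)).avg {k}ᶜ f ω =
      ∫ b, f (Function.update ω k b) ∂(bernoulliMeasure true false p) := by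
  have h : ∀ a b : ℕ → Bool, (piSplicing ℕ (bernoulliMeasure true false p)).splice {k}ᶜ a b =
      Function.update a k (b k) := fun a b => by
    funext i
    by_cases h : i = k
    · subst h; simp [piSplicing, choose]
    · simp [piSplicing, choose, h]
  have hm := measurePreserving_eval_infinitePi (fun _ : ℕ => bernoulliMeasure true false p) k
  simp only [Splicing.avg, h]
  conv_rhs => rw [← hm.map_eq]
  rw [integral_map hm.measurable.aemeasurable]
  exact (measurable_of_countable (fun b => f (Function.update ω k b))).aestronglyMeasurable

/-- The fair coin. -/
noncomputable def fair : unitInterval := ⟨1 / 2, by norm_num, by norm_num⟩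

/-- The infinite product of fair coins. -/
noncomputable def coins : Measure (ℕ → Bool) :=
  Measure.infinitePi fun _ : ℕ => bernoulliMeasure true false fair

instance : IsProbabilityMeasure coins := by unfold coins; infer_instance

/-- The sign of a coin. -/
def sign (b : Bool) : ℝ := if b then 1 else -1

/-- Normalised sums of random signs. -/
noncomputable def walk (n : ℕ) (ω : ℕ → Bool) : ℝ :=
  (√n)⁻¹ * ∑ k ∈ Finset.range n, sign (ω k)

lemma measurable_sign : Measurable sign := measurable_of_countable _

lemma measurable_walk (n : ℕ) : Measurable (walk n) := by
  have := measurable_sign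
  unfold walk
  fun_prop

lemma abs_sign_sub_le (a b : Bool) : |sign a - sign b| ≤ 2 := by
  cases a <;> cases b <;> norm_num [sign]

lemma abs_walk_update_sub_le (n k : ℕ) (hk : k < n) (ω : ℕ → Bool) (b : Bool) :
    |walk n (Function.update ω k b) - walk n ω| ≤ 2 * (√n)⁻¹ := by
  rw [walk, walk, ← mul_sub, ← Finset.sum_sub_distrib,
    Finset.sum_eq_single_of_mem k (Finset.mem_range.2 hk)
      (fun i _ hi => by rw [Function.update_of_ne hi, sub_self]), Function.update_self, abs_mul,
    abs_of_nonneg (by positivity), mul_comm]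
  gcongr
  exact abs_sign_sub_le _ _

/-- Central limit theorem for fair signs, which are centred with variance `1`. -/
lemma tendsto_integral_walk {φ : ℝ → ℝ} (hφ : Continuous φ) {C : ℝ} (hC : ∀ x, |φ x| ≤ C) :
    Tendsto (fun n => ∫ ω, φ (walk n ω) ∂coins) atTop (𝓝 (∫ x, φ x ∂(gaussianReal 0 1))) := by
  have hm : ∀ k, MeasurePreserving (fun ω : ℕ → Bool => ω k) coins
      (bernoulliMeasure true false fair) := fun k =>
    measurePreserving_eval_infinitePi (fun _ : ℕ => bernoulliMeasure true false fair) k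
  have hint : ∀ (k : ℕ) (g : Bool → ℝ), ∫ ω, g (ω k) ∂coins = (g true + g false) / 2 := by
    intro k g
    have h := integral_map (μ := coins) (f := g) (hm k).measurable.aemeasurable
      (measurable_of_countable _).aestronglyMeasurable
    rw [← h, (hm k).map_eq, integral_bernoulliMeasure]
    simp only [fair, smul_eq_mul]
    ring
  have hlaw : HasLaw (id : ℝ → ℝ) (gaussianReal 0 1) (gaussianReal 0 1) :=
    ⟨aemeasurable_id, Measure.map_id⟩
  have hclt := tendstoInDistribution_inv_sqrt_mul_sum (P := coins)
    (X := fun k ω => sign (ω k)) hlaw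
    (by rw [hint 0 sign]; norm_num [sign])
    (by
      have := hint 0 (fun b => sign b ^ 2)
      simp only [Pi.pow_apply]
      rw [this]; norm_num [sign])
    (iIndepFun_infinitePi fun _ => measurable_sign)
    (fun i => ⟨(measurable_sign.comp (hm i).measurable).aemeasurable,
      (measurable_sign.comp (hm 0).measurable).aemeasurable, by
        have := fun k => Measure.map_map (μ := coins) measurable_sign (hm k).measurable
        simp only [(hm _).map_eq] at this
        exact (this i).symm.trans (this 0)⟩)
  have h := ProbabilityMeasure.tendsto_iff_forall_integral_tendsto.1 hclt.tendsto
    (BoundedContinuousFunction.ofNormedAddCommGroup φ hφ C hC)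
  simp only [BoundedContinuousFunction.coe_ofNormedAddCommGroup, ProbabilityMeasure.coe_mk,
    Measure.map_id] at h
  refine h.congr fun n => ?_
  exact integral_map (measurable_walk n).aemeasurable hφ.aestronglyMeasurable

/-- A discrete version of the Gaussian inequality: each of the `n` bits contributes an energy of
order `1 / n`, as one bit moves the walk by at most `2 / √n` and `v` oscillates by at most `ε` on
that scale. -/
lemma ent_walk_le {v : ℝ → ℝ} {u : ℝ → ℝ} (hum : Measurable u) (hv : Continuous v) {C : ℝ}
    (hvC : ∀ x, |v x| ≤ C) (hu : ∀ s t, u t - u s = ∫ r in s..t, v r)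
    {θ : ℝ → ℝ} {m M : ℝ} (hθ : LipschitzWith 1 θ) (hb : ∀ x, θ x ∈ Set.Icc m M) (hm0 : 0 < m)
    {n : ℕ} (hn : 0 < n) {ε : ℝ} (hvn : ∀ x y, |x - y| ≤ 2 * (√n)⁻¹ → |v x| ≤ |v y| + ε) :
    ∫ ω, θ (u (walk n ω)) ^ 2 * Real.log (θ (u (walk n ω)) ^ 2) ∂coins -
      (∫ ω, θ (u (walk n ω)) ^ 2 ∂coins) * Real.log (∫ ω, θ (u (walk n ω)) ^ 2 ∂coins) ≤
      2 * ∫ ω, (|v (walk n ω)| + ε) ^ 2 ∂coins := by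
  let sp := piSplicing ℕ (bernoulliMeasure true false fair)
  set F : (ℕ → Bool) → ℝ := fun ω => θ (u (walk n ω)) ^ 2 with hF
  have hFm : Measurable F :=
    (hθ.continuous.measurable.comp (hum.comp (measurable_walk n))).pow_const 2
  have hFb : ∀ ω, F ω ∈ Set.Icc (m ^ 2) (M ^ 2) := fun ω => sq_mem_Icc hb hm0 _
  have hinv : sp.Inv (Splicing.initial (Equiv.refl ℕ) n) F := by
    intro a b
    have : walk n (sp.splice (Splicing.initial (Equiv.refl ℕ) n) a b) = walk n a := by
      unfold walk
      congr 1
      refine Finset.sum_congr rfl fun k hk => ?_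
      rw [show sp.splice (Splicing.initial (Equiv.refl ℕ) n) a b k = a k from
        choose_of_mem (by simpa [Splicing.initial] using hk) a b]
    simp only [hF, this]
  have h1 := sp.ent_initial_sub_le (Equiv.refl ℕ) n hFm (pow_pos hm0 2) hFb
  have h3 : sp.ent (Splicing.initial (Equiv.refl ℕ) n) F =
      ∫ ω, F ω * Real.log (F ω) ∂coins := by
    rw [Splicing.ent, hinv.avg_eq]; rfl
  have h4 : sp.ent ∅ F = (∫ ω, F ω ∂coins) * Real.log (∫ ω, F ω ∂coins) := by
    simp [Splicing.ent, sp.avg_empty]; rfl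
  rw [h3, h4] at h1
  refine h1.trans ?_
  have hs0 : 0 < √(n : ℝ) := Real.sqrt_pos.2 (by exact_mod_cast hn)
  have hGi : Integrable (fun ω => (|v (walk n ω)| + ε) ^ 2) coins := by
    refine .of_bound (((hv.measurable.comp (measurable_walk n)).abs.add_const
      ε).pow_const 2).aestronglyMeasurable ((C + |ε|) ^ 2) (.of_forall fun ω => ?_)
    rw [Real.norm_of_nonneg (sq_nonneg _), ← sq_abs]
    refine pow_le_pow_left₀ (abs_nonneg _) ((abs_add_le _ _).trans ?_) 2
    rw [abs_abs]
    exact add_le_add_left (hvC _) _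
  have hk : ∀ k ∈ Finset.range n, sp.ent Set.univ F - sp.ent {k}ᶜ F ≤
      ∫ ω, 2 / n * (|v (walk n ω)| + ε) ^ 2 ∂coins := by
    intro k hk
    refine sp.ent_univ_sub_le {k}ᶜ hFm (pow_pos hm0 2) hFb (hGi.const_mul _)
      (.of_forall fun ω => ?_)
    simp only [sp, piSplicing_avg_compl]
    refine (bernoulli_logSobolev (p := fair) (by norm_num [fair]) (by norm_num [fair])
      (fun b => u (walk n (Function.update ω k b))) hθ hb hm0).trans ?_
    have hd1 := abs_walk_update_sub_le n k (Finset.mem_range.1 hk) ω true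
    have hd0 := abs_walk_update_sub_le n k (Finset.mem_range.1 hk) ω false
    have hd := abs_walk_update_sub_le n k (Finset.mem_range.1 hk) (Function.update ω k false) true
    rw [Function.update_idem] at hd
    -- Every point between the two values of the walk is within `2 / √n` of `walk n ω`, so `|v|` is
    -- at most `|v (walk n ω)| + ε` along the whole interval of integration.
    have hC : |u (walk n (Function.update ω k true)) - u (walk n (Function.update ω k false))| ≤
        (|v (walk n ω)| + ε) * (2 * (√n)⁻¹) := by
      rw [hu]
      have h0 : 0 ≤ |v (walk n ω)| + ε :=
        (abs_nonneg _).trans (hvn (walk n ω) (walk n ω) (by simp))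
      refine (intervalIntegral.norm_integral_le_of_norm_le_const
        (f := v) (C := |v (walk n ω)| + ε) fun r hr => ?_).trans (mul_le_mul_of_nonneg_left hd h0)
      refine hvn r _ ?_
      rw [← Real.dist_eq, ← Metric.mem_closedBall, Real.closedBall_eq_Icc] at hd1 hd0 ⊢
      exact Set.ordConnected_Icc.uIcc_subset hd0 hd1 (Set.uIoc_subset_uIcc hr)
    have hC2 := pow_le_pow_left₀ (abs_nonneg _) hC 2
    rw [sq_abs, mul_pow, mul_pow, inv_pow, Real.sq_sqrt (Nat.cast_nonneg n)] at hC2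
    have : cLS (fair : ℝ) = 2 := by norm_num [cLS, fair]
    rw [this]
    have hf : (fair : ℝ) = 1 / 2 := rfl
    rw [hf]
    -- The constants: `c_LS(1/2) · 1/4 · (2 / √n)² = 2 / n`, and summing over `n` bits gives the
    -- factor `2`.
    have e : (2 : ℝ) / n * (|v (walk n ω)| + ε) ^ 2 =
      1 / 2 * ((|v (walk n ω)| + ε) ^ 2 * (2 ^ 2 * (n : ℝ)⁻¹)) := by ring
    rw [e]
    linarith
  refine (Finset.sum_le_sum hk).trans (le_of_eq ?_)
  rw [Finset.sum_const, Finset.card_range, nsmul_eq_mul, integral_const_mul]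
  have : (n : ℝ) ≠ 0 := by exact_mod_cast hn.ne'
  field_simp

/-- The Gaussian logarithmic Sobolev inequality for functions with a continuous and compactly
supported derivative. -/
lemma gaussian_logSobolev_of_hasCompactSupport {u v : ℝ → ℝ} (hv : Continuous v)
    (hvs : HasCompactSupport v) (hu : ∀ s t, u t - u s = ∫ r in s..t, v r)
    {θ : ℝ → ℝ} {m M : ℝ} (hθ : LipschitzWith 1 θ) (hb : ∀ x, θ x ∈ Set.Icc m M) (hm0 : 0 < m) :
    ∫ x, θ (u x) ^ 2 * Real.log (θ (u x) ^ 2) ∂(gaussianReal 0 1) -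
      (∫ x, θ (u x) ^ 2 ∂(gaussianReal 0 1)) * Real.log (∫ x, θ (u x) ^ 2 ∂(gaussianReal 0 1)) ≤
      2 * ∫ x, v x ^ 2 ∂(gaussianReal 0 1) := by
  have huc : Continuous u := by
    have h : u = fun t => (∫ r in (0 : ℝ)..t, v r) + u 0 := by
      funext t; rw [← hu]; ring
    rw [h]
    exact (intervalIntegral.continuous_primitive (fun a b => hv.intervalIntegrable a b) 0).add
      continuous_const
  obtain ⟨C, hC⟩ := hvs.exists_bound_of_continuous hv
  have hC' : ∀ x, |v x| ≤ C := hC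
  have hc : Continuous fun x => θ (u x) ^ 2 := (hθ.continuous.comp huc).pow 2
  have hpos : ∀ x, 0 < θ (u x) ^ 2 := fun x => (pow_pos hm0 2).trans_le (sq_mem_Icc hb hm0 _).1
  have hcl : Continuous fun x => θ (u x) ^ 2 * Real.log (θ (u x) ^ 2) :=
    hc.mul (hc.log fun x => (hpos x).ne')
  have t1 := tendsto_integral_walk hcl (fun x => abs_mul_log_le (pow_pos hm0 2)
    (sq_mem_Icc hb hm0 (u x)))
  have t2 := tendsto_integral_walk hc (C := M ^ 2) (fun x => by
    rw [abs_of_pos (hpos x)]; exact (sq_mem_Icc hb hm0 _).2)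
  have hne : ∫ x, θ (u x) ^ 2 ∂(gaussianReal 0 1) ≠ 0 := by
    have h := integral_mono (μ := gaussianReal 0 1) (integrable_const (m ^ 2))
      (.of_bound hc.aestronglyMeasurable (M ^ 2) (.of_forall fun x => by
        rw [Real.norm_of_nonneg (hpos x).le]; exact (sq_mem_Icc hb hm0 _).2))
      (fun x => (sq_mem_Icc hb hm0 (u x)).1)
    simp only [integral_const, probReal_univ, one_smul] at h
    exact ((pow_pos hm0 2).trans_le h).ne'
  have t3 := t1.sub (t2.mul (t2.log hne))
  -- Uniform continuity of `v` provides the `ε` of `ent_walk_le` for large `n`; the central limit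
  -- theorem passes to the limit on both sides.
  have step : ∀ ε > 0, ∫ x, θ (u x) ^ 2 * Real.log (θ (u x) ^ 2) ∂(gaussianReal 0 1) -
      (∫ x, θ (u x) ^ 2 ∂(gaussianReal 0 1)) * Real.log (∫ x, θ (u x) ^ 2 ∂(gaussianReal 0 1)) ≤
      2 * ∫ x, (|v x| + ε) ^ 2 ∂(gaussianReal 0 1) := by
    intro ε hε
    have hcε : Continuous fun x => (|v x| + ε) ^ 2 := (hv.abs.add continuous_const).pow 2
    have t4 := tendsto_integral_walk hcε (C := (C + ε) ^ 2) (fun x => by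
      rw [abs_of_nonneg (sq_nonneg _)]
      exact pow_le_pow_left₀ (add_nonneg (abs_nonneg _) hε.le) (add_le_add_left (hC' x) ε) 2)
    refine le_of_tendsto_of_tendsto t3 (t4.const_mul 2) ?_
    obtain ⟨δ, hδ, huc'⟩ := Metric.uniformContinuous_iff.1
      (hvs.uniformContinuous_of_continuous hv) ε hε
    have ht : Tendsto (fun n : ℕ => 2 * (√(n : ℝ))⁻¹) atTop (𝓝 0) := by
      simpa using (tendsto_inv_atTop_zero.comp
        (Real.tendsto_sqrt_atTop.comp tendsto_natCast_atTop_atTop)).const_mul 2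
    filter_upwards [ht.eventually (gt_mem_nhds hδ), eventually_gt_atTop 0] with n hn hn0
    refine ent_walk_le huc.measurable hv hC' hu hθ hb hm0 hn0 fun x y hxy => ?_
    have := huc' (a := x) (b := y) (by rw [Real.dist_eq]; exact hxy.trans_lt hn)
    rw [Real.dist_eq] at this
    have h2 := abs_sub_abs_le_abs_sub (v x) (v y)
    linarith
  have hcont : Tendsto (fun k : ℕ => ∫ x, (|v x| + 1 / (k + 1 : ℝ)) ^ 2 ∂(gaussianReal 0 1)) atTop
      (𝓝 (∫ x, v x ^ 2 ∂(gaussianReal 0 1))) := by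
    refine tendsto_integral_of_dominated_convergence (fun _ => (C + 1) ^ 2)
      (fun k => ((hv.abs.add continuous_const).pow 2).aestronglyMeasurable) (integrable_const _)
      (fun k => .of_forall fun x => ?_) (.of_forall fun x => ?_)
    · rw [Real.norm_of_nonneg (sq_nonneg _)]
      refine pow_le_pow_left₀ (by positivity) (add_le_add (hC' x) ?_) 2
      rw [div_le_one (by positivity)]; linarith [(Nat.cast_nonneg k : (0 : ℝ) ≤ k)]
    · have := (tendsto_one_div_add_atTop_nhds_zero_nat (𝕜 := ℝ)).const_add |v x|
      simpa using this.pow 2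
  exact ge_of_tendsto (hcont.const_mul 2) (.of_forall fun k => step _ (by positivity))

lemma integral_sq_eq_toReal {Ω : Type*} [MeasurableSpace Ω] {μ : Measure Ω} {f : Ω → ℝ}
    (hf : AEStronglyMeasurable f μ) :
    ∫ x, f x ^ 2 ∂μ = ((eLpNorm f 2 μ) ^ 2).toReal := by
  have h := eLpNorm_nnreal_pow_eq_lintegral (μ := μ) (f := f) (p := 2) two_ne_zero
  simp only [NNReal.coe_ofNat, ENNReal.rpow_ofNat, ENNReal.coe_ofNat] at h
  rw [h, integral_eq_lintegral_of_nonneg_ae (.of_forall fun x => sq_nonneg _) (hf.pow 2)]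
  congr 1
  refine lintegral_congr fun x => ?_
  rw [← sq_abs, ENNReal.ofReal_pow (abs_nonneg _), ← Real.norm_eq_abs, ofReal_norm]

/-- On bounded intervals, the Lebesgue measure is controlled by the Gaussian measure. -/
lemma exists_restrict_uIoc_le_smul_gaussianReal (a b : ℝ) : ∃ C : ℝ≥0∞, C ≠ ∞ ∧
    volume.restrict (Set.uIoc a b) ≤ C • gaussianReal 0 1 := by
  obtain ⟨x₀, -, hx₀⟩ := (isCompact_uIcc (a := a) (b := b)).exists_isMinOn Set.nonempty_uIcc
    (f := gaussianPDFReal 0 1) (by unfold gaussianPDFReal; fun_prop)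
  set c := gaussianPDFReal 0 1 x₀
  have hc : 0 < c := gaussianPDFReal_pos 0 1 x₀ one_ne_zero
  refine ⟨(ENNReal.ofReal c)⁻¹, by simp [hc], ?_⟩
  refine Measure.le_iff.2 fun s hs => ?_
  have h1 : ENNReal.ofReal c * volume (s ∩ Set.uIoc a b) ≤ gaussianReal 0 1 s := by
    rw [← setLIntegral_const]
    refine le_trans ?_ (measure_mono (Set.inter_subset_left (s := s) (t := Set.uIoc a b)))
    rw [gaussianReal_apply 0 one_ne_zero]
    refine setLIntegral_mono (measurable_gaussianPDF 0 1) fun x hx => ?_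
    exact ENNReal.ofReal_le_ofReal (hx₀ (Set.uIoc_subset_uIcc hx.2))
  rw [Measure.restrict_apply hs, Measure.smul_apply, smul_eq_mul]
  calc volume (s ∩ Set.uIoc a b)
      = (ENNReal.ofReal c)⁻¹ * (ENNReal.ofReal c * volume (s ∩ Set.uIoc a b)) := by
        rw [← mul_assoc, ENNReal.inv_mul_cancel (by simpa using hc) ENNReal.ofReal_ne_top, one_mul]
    _ ≤ _ := by gcongr

lemma intervalIntegrable_of_gaussianReal {v : ℝ → ℝ} (hv : Integrable v (gaussianReal 0 1))
    (a b : ℝ) : IntervalIntegrable v volume a b := by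
  obtain ⟨C, hC, h⟩ := exists_restrict_uIoc_le_smul_gaussianReal a b
  rw [intervalIntegrable_iff]
  exact (hv.smul_measure hC).mono_measure h

/-- The Gaussian logarithmic Sobolev inequality. -/
lemma gaussian_logSobolev {u v : ℝ → ℝ} (hv : MemLp v 2 (gaussianReal 0 1)) {s : ℝ}
    (hu : ∀ᵐ t ∂(gaussianReal 0 1), u t - u s = ∫ r in s..t, v r)
    {θ : ℝ → ℝ} {m M : ℝ} (hθ : LipschitzWith 1 θ) (hb : ∀ x, θ x ∈ Set.Icc m M) (hm0 : 0 < m) :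
    ∫ x, θ (u x) ^ 2 * Real.log (θ (u x) ^ 2) ∂(gaussianReal 0 1) -
      (∫ x, θ (u x) ^ 2 ∂(gaussianReal 0 1)) * Real.log (∫ x, θ (u x) ^ 2 ∂(gaussianReal 0 1)) ≤
      2 * ∫ x, v x ^ 2 ∂(gaussianReal 0 1) := by
  have hε : ∀ n : ℕ, ((n + 1 : ℝ≥0∞))⁻¹ ≠ 0 := fun n => by simp
  -- Approximate the derivative in `L²(γ)`, and integrate the approximants from the base point `s`.
  choose w hws hwv hwc hw2 using fun n =>
    hv.exists_hasCompactSupport_eLpNorm_sub_le (by simp) (hε n)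
  have hlim : Tendsto (fun n : ℕ => ((n + 1 : ℝ≥0∞))⁻¹) atTop (𝓝 0) := by
    have := (tendsto_add_atTop_iff_nat 1).2 ENNReal.tendsto_inv_nat_nhds_zero
    simpa using this
  set U : ℕ → ℝ → ℝ := fun n t => u s + ∫ r in s..t, w n r
  have hUw : ∀ n a b, U n b - U n a = ∫ r in a..b, w n r := fun n a b => by
    have := intervalIntegral.integral_interval_sub_left ((hwc n).intervalIntegrable s b)
      ((hwc n).intervalIntegrable s a) (μ := volume)
    simp only [U]
    linarith
  have hUu : ∀ᵐ t ∂(gaussianReal 0 1), Tendsto (fun n => U n t) atTop (𝓝 (u t)) := by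
    filter_upwards [hu] with t ht
    have ht' : u t = u s + ∫ r in s..t, v r := by linarith
    rw [ht']
    refine Tendsto.const_add _ ?_
    obtain ⟨C, hC, h⟩ := exists_restrict_uIoc_le_smul_gaussianReal s t
    have hvi := intervalIntegrable_of_gaussianReal (hv.integrable one_le_two) s t
    rw [tendsto_iff_edist_tendsto_0]
    refine tendsto_of_tendsto_of_tendsto_of_le_of_le tendsto_const_nhds
      (h := fun n : ℕ => C * ((n + 1 : ℝ≥0∞))⁻¹) ?_ (fun _ => zero_le) fun n => ?_
    · simpa using ENNReal.Tendsto.const_mul hlim (Or.inr hC)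
    · have h1 : edist (∫ r in s..t, w n r) (∫ r in s..t, v r) ≤
          ∫⁻ r in Set.uIoc s t, ‖(v - w n) r‖ₑ := by
        rw [edist_comm, edist_eq_enorm_sub,
          ← intervalIntegral.integral_sub hvi ((hwc n).intervalIntegrable _ _),
          ← enorm_norm, intervalIntegral.norm_intervalIntegral_eq, enorm_norm]
        exact enorm_integral_le_lintegral_enorm _
      refine h1.trans ((lintegral_mono' h le_rfl).trans ?_)
      rw [lintegral_smul_measure, smul_eq_mul, ← eLpNorm_one_eq_lintegral_enorm]
      exact mul_le_mul' le_rfl ((eLpNorm_le_eLpNorm_of_exponent_le one_le_two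
        (hv.1.sub (hw2 n).1)).trans (hwv n))
  have hθU : ∀ n, Measurable fun x => θ (U n x) ^ 2 := fun n => by
    have : Continuous (U n) := (intervalIntegral.continuous_primitive
      (fun a b => (hwc n).intervalIntegrable a b) s).const_add _ 
    exact (hθ.continuous.comp this).measurable.pow_const 2
  have hθt : ∀ᵐ x ∂(gaussianReal 0 1),
      Tendsto (fun n => θ (U n x) ^ 2) atTop (𝓝 (θ (u x) ^ 2)) := by
    filter_upwards [hUu] with x hx
    exact ((hθ.continuous.tendsto _).comp hx).pow 2
  have hpos : ∀ x, 0 < θ x ^ 2 := fun x => (pow_pos hm0 2).trans_le (sq_mem_Icc hb hm0 _).1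
  have t1 : Tendsto (fun n => ∫ x, θ (U n x) ^ 2 ∂(gaussianReal 0 1)) atTop
      (𝓝 (∫ x, θ (u x) ^ 2 ∂(gaussianReal 0 1))) :=
    tendsto_integral_of_dominated_convergence (fun _ => M ^ 2)
      (fun n => (hθU n).aestronglyMeasurable) (integrable_const _)
      (fun n => .of_forall fun x => by
        rw [Real.norm_of_nonneg (hpos _).le]; exact (sq_mem_Icc hb hm0 _).2) hθt
  have t2 : Tendsto (fun n => ∫ x, θ (U n x) ^ 2 * Real.log (θ (U n x) ^ 2) ∂(gaussianReal 0 1))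
      atTop (𝓝 (∫ x, θ (u x) ^ 2 * Real.log (θ (u x) ^ 2) ∂(gaussianReal 0 1))) :=
    tendsto_integral_of_dominated_convergence _
      (fun n => (measurable_mul_log (hθU n)).aestronglyMeasurable) (integrable_const _)
      (fun n => .of_forall fun x => abs_mul_log_le (pow_pos hm0 2) (sq_mem_Icc hb hm0 _))
      (by filter_upwards [hθt] with x hx; exact hx.mul (hx.log (hpos _).ne'))
  have hne : ∫ x, θ (u x) ^ 2 ∂(gaussianReal 0 1) ≠ 0 := by
    refine ((pow_pos hm0 2).trans_le (ge_of_tendsto t1 (.of_forall fun n => ?_))).ne'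
    have h := integral_mono (μ := gaussianReal 0 1) (integrable_const (m ^ 2))
      (.of_bound (hθU n).aestronglyMeasurable (M ^ 2) (.of_forall fun x => by
        rw [Real.norm_of_nonneg (hpos _).le]; exact (sq_mem_Icc hb hm0 _).2))
      (fun x => (sq_mem_Icc hb hm0 (U n x)).1)
    simpa only [integral_const, probReal_univ, one_smul] using h
  -- An upper bound for the energies of the approximants with the right limit, from the triangle
  -- inequality in `L²(γ)`.
  have t3 : Tendsto (fun n : ℕ => ((eLpNorm v 2 (gaussianReal 0 1) + ((n + 1 : ℝ≥0∞))⁻¹) ^ 2).toReal)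
      atTop (𝓝 (∫ x, v x ^ 2 ∂(gaussianReal 0 1))) := by
    rw [integral_sq_eq_toReal hv.1]
    refine (ENNReal.tendsto_toReal (by simpa using hv.2.ne)).comp (ENNReal.Tendsto.pow ?_)
    simpa using hlim.const_add (eLpNorm v 2 (gaussianReal 0 1))
  refine le_of_tendsto_of_tendsto (t2.sub (t1.mul (t1.log hne))) (t3.const_mul 2)
    (.of_forall fun n => ?_)
  refine (gaussian_logSobolev_of_hasCompactSupport (hwc n) (hws n) (hUw n) hθ hb hm0).trans ?_
  rw [integral_sq_eq_toReal (hw2 n).1]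
  refine mul_le_mul_of_nonneg_left (ENNReal.toReal_mono ?_ (pow_le_pow_left' ?_ 2)) two_pos.le
  · simp [hv.2.ne]
  · have e : w n = v - (v - w n) := by simp
    have h3 := eLpNorm_sub_le (p := 2) hv.1 (hv.1.sub (hw2 n).1) one_le_two
    rw [← e] at h3
    exact h3.trans (by gcongr; exact hwv n)

/-! ### Derivations on the mixed product -/

section

variable {S : Type*} (p : unitInterval)

/-- `D` is the derivative of `f` in the direction of the real coordinate `i`. -/
def IsPrimitive (ν : Measure ℝ) (i : ℕ) (f D : (S → Bool) × (ℕ → ℝ) → ℝ) : Prop :=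
  ∀ᵐ q ∂((mixedProduct S p ν).prod (ν.prod ν)),
    realSlice f i q.1 q.2.2 - realSlice f i q.1 q.2.1 = ∫ r in q.2.1..q.2.2, realSlice D i q.1 r

variable {p}

lemma measurable_realSlice {f : (S → Bool) × (ℕ → ℝ) → ℝ} (hf : Measurable f) (i : ℕ)
    (ω : (S → Bool) × (ℕ → ℝ)) : Measurable (realSlice f i ω) :=
  hf.comp (by fun_prop : Measurable fun t => (ω.1, Function.update ω.2 i t))

lemma ae_memLp_realSlice {ν : Measure ℝ} [IsProbabilityMeasure ν] (i : ℕ)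
    {f : (S → Bool) × (ℕ → ℝ) → ℝ} (hfm : Measurable f) (hf : MemLp f 2 (mixedProduct S p ν)) :
    ∀ᵐ ω ∂(mixedProduct S p ν), MemLp (realSlice f i ω) 2 ν := by
  have h := ((measurePreserving_update_real p ν i).integrable_comp_of_integrable
    hf.integrable_sq).prod_right_ae
  filter_upwards [h] with ω hω
  exact (memLp_two_iff_integrable_sq (measurable_realSlice hfm i ω).aestronglyMeasurable).2 hω

lemma IsPrimitive.sub {i : ℕ} {f g D E : (S → Bool) × (ℕ → ℝ) → ℝ}
    (hDm : Measurable D) (hD : MemLp D 2 (mixedProduct S p (gaussianReal 0 1)))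
    (hEm : Measurable E) (hE : MemLp E 2 (mixedProduct S p (gaussianReal 0 1)))
    (hf : IsPrimitive p (gaussianReal 0 1) i f D) (hg : IsPrimitive p (gaussianReal 0 1) i g E) :
    IsPrimitive p (gaussianReal 0 1) i (fun ω => f ω - g ω) (fun ω => D ω - E ω) := by
  have h1 := Measure.quasiMeasurePreserving_fst (μ := mixedProduct S p (gaussianReal 0 1))
    (ν := (gaussianReal 0 1).prod (gaussianReal 0 1)) |>.ae (ae_memLp_realSlice i hDm hD)
  have h2 := Measure.quasiMeasurePreserving_fst (μ := mixedProduct S p (gaussianReal 0 1))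
    (ν := (gaussianReal 0 1).prod (gaussianReal 0 1)) |>.ae (ae_memLp_realSlice i hEm hE)
  filter_upwards [hf, hg, h1, h2] with q hf hg h1 h2
  have h := intervalIntegral.integral_sub
    (intervalIntegrable_of_gaussianReal (h1.integrable one_le_two) q.2.1 q.2.2)
    (intervalIntegrable_of_gaussianReal (h2.integrable one_le_two) q.2.1 q.2.2)
  simp only [realSlice] at *
  rw [h, ← hf, ← hg]
  ring

/-- The one-dimensional inequality on almost every slice, integrated over the other coordinates. -/
lemma IsPrimitive.logSobolev {i : ℕ} {f D : (S → Bool) × (ℕ → ℝ) → ℝ} (hfm : Measurable f)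
    (hDm : Measurable D) (hD : MemLp D 2 (mixedProduct S p (gaussianReal 0 1)))
    (h : IsPrimitive p (gaussianReal 0 1) i f D)
    {θ : ℝ → ℝ} {m M : ℝ} (hθ : LipschitzWith 1 θ) (hb : ∀ x, θ x ∈ Set.Icc m M) (hm0 : 0 < m) :
    (mixedSplicing S p (gaussianReal 0 1)).ent Set.univ (fun ω => θ (f ω) ^ 2) -
      (mixedSplicing S p (gaussianReal 0 1)).ent {Sum.inr i}ᶜ (fun ω => θ (f ω) ^ 2) ≤
      2 * ∫ ω, D ω ^ 2 ∂(mixedProduct S p (gaussianReal 0 1)) := by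
  set sp := mixedSplicing S p (gaussianReal 0 1)
  have hFm : Measurable fun ω => θ (f ω) ^ 2 := (hθ.continuous.measurable.comp hfm).pow_const 2
  rw [← sp.integral_avg {Sum.inr i}ᶜ (hDm.pow_const 2) hD.integrable_sq, ← integral_const_mul]
  refine sp.ent_univ_sub_le _ hFm (pow_pos hm0 2) (fun ω => sq_mem_Icc hb hm0 _)
    ((sp.integrable_avg _ hD.integrable_sq).const_mul 2) ?_
  have h1 := Measure.ae_ae_of_ae_prod h
  filter_upwards [h1, ae_memLp_realSlice i hDm hD] with ω h1 h2
  -- Almost every lower endpoint satisfies the identity for almost every upper one; a single such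
  -- `s` serves as base point.
  obtain ⟨s, hs⟩ := (Measure.ae_ae_of_ae_prod h1).exists
  simp only [sp, avg_compl_inr p (gaussianReal 0 1) i hFm,
    avg_compl_inr p (gaussianReal 0 1) i (measurable_mul_log hFm),
    avg_compl_inr p (gaussianReal 0 1) i (hDm.pow_const 2)]
  exact gaussian_logSobolev h2 hs hθ hb hm0

lemma realSlice_avg {ν : Measure ℝ} [IsProbabilityMeasure ν] {i : ℕ} {A : Set (S ⊕ ℕ)}
    (hi : Sum.inr i ∈ A) (f : (S → Bool) × (ℕ → ℝ) → ℝ) (ω : (S → Bool) × (ℕ → ℝ)) (t : ℝ) :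
    realSlice ((mixedSplicing S p ν).avg A f) i ω t =
      ∫ ω', realSlice f i ((mixedSplicing S p ν).splice A ω ω') t ∂(mixedProduct S p ν) := by
  simp only [realSlice, Splicing.avg, splice_update p ν hi]

/-- Splicing preserves the measure, so the increment identity holds at almost every spliced point.
Integrating over the resampled coordinates and exchanging with the interval integral gives it for
the averages. -/
lemma IsPrimitive.avg {i : ℕ} {A : Set (S ⊕ ℕ)} {f D : (S → Bool) × (ℕ → ℝ) → ℝ}
    (hf : MemLp f 2 (mixedProduct S p (gaussianReal 0 1)))
    (hD : MemLp D 2 (mixedProduct S p (gaussianReal 0 1)))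
    (h : IsPrimitive p (gaussianReal 0 1) i f D) (hi : Sum.inr i ∈ A) :
    IsPrimitive p (gaussianReal 0 1) i ((mixedSplicing S p (gaussianReal 0 1)).avg A f)
      ((mixedSplicing S p (gaussianReal 0 1)).avg A D) := by
  set γ : Measure ℝ := gaussianReal 0 1 with hγ
  set μ := mixedProduct S p γ with hμ
  set sp := mixedSplicing S p γ with hsp
  have hT : MeasurePreserving (fun q : (((S → Bool) × (ℕ → ℝ)) × (ℝ × ℝ)) ×
      ((S → Bool) × (ℕ → ℝ)) => (sp.splice A q.1.1 q.2, q.1.2))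
      ((μ.prod (γ.prod γ)).prod μ) (μ.prod (γ.prod γ)) := by
    have h1 := measurePreserving_prodAssoc μ (γ.prod γ) μ
    have h2 := (MeasurePreserving.id μ).prod
      (Measure.measurePreserving_swap (μ := γ.prod γ) (ν := μ))
    have h3 := (measurePreserving_prodAssoc μ μ (γ.prod γ)).symm
    exact ((sp.measurePreserving A).prod (MeasurePreserving.id (γ.prod γ))).comp
      (h3.comp (h2.comp h1))
  have a1 := Measure.ae_ae_of_ae_prod (hT.quasiMeasurePreserving.ae h)
  have hu : MeasurePreserving (fun q : ((S → Bool) × (ℕ → ℝ)) × ℝ =>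
      (q.1.1, Function.update q.1.2 i q.2)) (μ.prod γ) μ := measurePreserving_update_real p γ i
  have hfi := (sp.integrable_comp_splice A (hf.integrable one_le_two)).prod_right_ae
  have b1 := hu.quasiMeasurePreserving.ae hfi
  have a2 := (((MeasurePreserving.id μ).prod
    (measurePreserving_fst (μ := γ) (ν := γ))).quasiMeasurePreserving).ae b1
  have a3 := (((MeasurePreserving.id μ).prod
    (measurePreserving_snd (μ := γ) (ν := γ))).quasiMeasurePreserving).ae b1
  have hDi : ∀ᵐ ω ∂μ, Integrable (fun z : ℝ × ((S → Bool) × (ℕ → ℝ)) =>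
      realSlice D i (sp.splice A ω z.2) z.1) (γ.prod μ) := by
    have k1 := (measurePreserving_prodAssoc μ μ γ).symm
    have k2 := (MeasurePreserving.id μ).prod (Measure.measurePreserving_swap (μ := γ) (ν := μ))
    have k3 := hu.comp (((sp.measurePreserving A).prod (MeasurePreserving.id γ)).comp
      (k1.comp k2))
    exact (k3.integrable_comp_of_integrable (hD.integrable one_le_two)).prod_right_ae
  have a4 := Measure.quasiMeasurePreserving_fst (μ := μ) (ν := γ.prod γ) |>.ae hDi
  filter_upwards [a1, a2, a3, a4] with q a1 a2 a3 a4
  simp only [hsp, realSlice_avg hi]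
  simp only [Prod.map, id, hsp, splice_update p γ hi] at a2 a3
  -- Integrability is known for `γ ⊗ μ`; domination of Lebesgue measure on the bounded interval
  -- transfers it to the measure that Fubini needs.
  obtain ⟨C, hC, hle⟩ := exists_restrict_uIoc_le_smul_gaussianReal q.2.1 q.2.2
  have h5 : Integrable (fun z : ℝ × ((S → Bool) × (ℕ → ℝ)) =>
      realSlice D i (sp.splice A q.1 z.2) z.1) ((volume.restrict (Set.uIoc q.2.1 q.2.2)).prod μ) := by
    refine Integrable.mono_measure (ν := C • (γ.prod μ)) (a4.smul_measure hC) ?_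
    rw [← Measure.prod_smul_left]
    exact Measure.prod_mono hle le_rfl
  have h6 := intervalIntegral_integral_swap
    (f := fun r ω' => realSlice D i (sp.splice A q.1 ω') r) h5
  have a2' : Integrable (fun ω' => realSlice f i (sp.splice A q.1 ω') q.2.1) μ := a2
  have a3' : Integrable (fun ω' => realSlice f i (sp.splice A q.1 ω') q.2.2) μ := a3
  rw [← integral_sub a3' a2']
  refine Eq.trans ?_ h6.symm
  exact integral_congr_ae a1

/-- The coordinate `i` is among those averaged out, so the slices are constant. -/
lemma isPrimitive_avg_zero {ν : Measure ℝ} [IsProbabilityMeasure ν] {i : ℕ} {A : Set (S ⊕ ℕ)}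
    (hi : Sum.inr i ∉ A) (f : (S → Bool) × (ℕ → ℝ) → ℝ) :
    IsPrimitive p ν i ((mixedSplicing S p ν).avg A f) (fun _ => 0) :=
  .of_forall fun q => by
    simp [realSlice, Splicing.avg, splice_update_notMem p ν hi]

end

/-! ### Derivatives in all coordinates and the measurable Gaussian case. -/

section

variable {S : Type*} {p : unitInterval}

lemma Splicing.avg_congr {ι Ω : Type*} {mΩ : MeasurableSpace Ω} {μ : Measure Ω}
    (sp : Splicing ι μ) [IsProbabilityMeasure μ] (A : Set ι) {f g : Ω → ℝ} (h : f =ᵐ[μ] g) :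
    sp.avg A f =ᵐ[μ] sp.avg A g := by
  filter_upwards [Measure.ae_ae_of_ae_prod ((sp.measurePreserving A).quasiMeasurePreserving.ae h)]
    with ω hω
  exact integral_congr_ae hω

lemma ent_bit_le [DecidableEq S] (hp0 : 0 < (p : ℝ)) (hp1 : (p : ℝ) < 1) (s : S)
    {f D : (S → Bool) × (ℕ → ℝ) → ℝ}
    (hfm : Measurable f) (hf : MemLp f 2 (mixedProduct S p (gaussianReal 0 1)))
    (hD : D =ᵐ[mixedProduct S p (gaussianReal 0 1)]
      fun ω => f ω - (mixedSplicing S p (gaussianReal 0 1)).avg {Sum.inl s}ᶜ f ω)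
    {θ : ℝ → ℝ} {m M : ℝ} (hθ : LipschitzWith 1 θ) (hb : ∀ x, θ x ∈ Set.Icc m M) (hm0 : 0 < m) :
    (mixedSplicing S p (gaussianReal 0 1)).ent Set.univ (fun ω => θ (f ω) ^ 2) -
      (mixedSplicing S p (gaussianReal 0 1)).ent {Sum.inl s}ᶜ (fun ω => θ (f ω) ^ 2) ≤
      cLS p * ∫ ω, D ω ^ 2 ∂(mixedProduct S p (gaussianReal 0 1)) := by
  set sp := mixedSplicing S p (gaussianReal 0 1)
  have hFm : Measurable fun ω => θ (f ω) ^ 2 := (hθ.continuous.measurable.comp hfm).pow_const 2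
  set E : (S → Bool) × (ℕ → ℝ) → ℝ := fun ω => f ω - sp.avg {Sum.inl s}ᶜ f ω with hE
  have hEm : Measurable E := hfm.sub (sp.measurable_avg _ hfm)
  have hE2 : MemLp E 2 (mixedProduct S p (gaussianReal 0 1)) := hf.sub (sp.memLp_avg _ hfm hf)
  have hDE : ∫ ω, D ω ^ 2 ∂(mixedProduct S p (gaussianReal 0 1)) =
      ∫ ω, E ω ^ 2 ∂(mixedProduct S p (gaussianReal 0 1)) :=
    integral_congr_ae (by filter_upwards [hD] with ω hω; rw [hω])
  rw [hDE, ← sp.integral_avg {Sum.inl s}ᶜ (hEm.pow_const 2) hE2.integrable_sq, ← integral_const_mul]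
  refine sp.ent_univ_sub_le _ hFm (pow_pos hm0 2) (fun ω => sq_mem_Icc hb hm0 _)
    ((sp.integrable_avg _ hE2.integrable_sq).const_mul _) (.of_forall fun ω => ?_)
  -- On a slice the difference takes the values `(1 - p)(f₁ - f₀)` and `-p (f₁ - f₀)`, with mean
  -- square `p (1 - p)(f₁ - f₀)²`, as in the two-point inequality.
  have h1 : ∀ b, E (Function.update ω.1 s b, ω.2) = f (Function.update ω.1 s b, ω.2) -
      (p * f (Function.update ω.1 s true, ω.2) +
        (1 - p) * f (Function.update ω.1 s false, ω.2)) := fun b => by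
    simp only [hE, sp, avg_compl_inl, Function.update_idem, integral_bernoulliMeasure, smul_eq_mul]
  simp only [sp, avg_compl_inl]
  refine (bernoulli_logSobolev hp0 hp1 (fun b => f (Function.update ω.1 s b, ω.2))
    hθ hb hm0).trans (le_of_eq ?_)
  congr 1
  simp only [h1, integral_bernoulliMeasure, smul_eq_mul]
  ring

/-- The derivatives in all the coordinates: the differences `Δ_s f` for the bits, and the weak
derivatives for the real coordinates. -/
def MixedDeriv (S : Type*) (p : unitInterval) : S ⊕ ℕ → ((S → Bool) × (ℕ → ℝ) → ℝ) →
    ((S → Bool) × (ℕ → ℝ) → ℝ) → Prop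
  | Sum.inl s, f, D => D =ᵐ[mixedProduct S p (gaussianReal 0 1)]
      fun ω => f ω - (mixedSplicing S p (gaussianReal 0 1)).avg {Sum.inl s}ᶜ f ω
  | Sum.inr i, f, D => IsPrimitive p (gaussianReal 0 1) i f D

/-- For bits, compatibility with averages is the commutation of averages; if `s ∉ A`, averaging over
`s` changes nothing further and the difference vanishes. -/
lemma mixedDeriv_isDerivation [DecidableEq S] (hp0 : 0 < (p : ℝ)) (hp1 : (p : ℝ) < 1) :
    (mixedSplicing S p (gaussianReal 0 1)).IsDerivation
      (Sum.elim (fun _ => cLS p) (fun _ => 2)) (MixedDeriv S p) where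
  avg {j A f D} hfm hf hDm hD h hj := by
    set sp := mixedSplicing S p (gaussianReal 0 1)
    have hfi := hf.integrable one_le_two
    cases j with
    | inl s =>
      have h1 := sp.avg_congr A h
      have h2 := sp.avg_sub A hfi (sp.integrable_avg {Sum.inl s}ᶜ hfi)
      have h3 := sp.avg_avg A {Sum.inl s}ᶜ hfm hfi
      have h4 := sp.avg_avg {Sum.inl s}ᶜ A hfm hfi
      rw [Set.inter_comm] at h4
      change _ =ᵐ[_] _
      filter_upwards [h1, h2, h3, h4] with ω h1 h2 h3 h4
      rw [h1, h2, h3, h4]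
    | inr i => exact IsPrimitive.avg hf hD h hj
  avg_zero {j A f} hfm hf hj := by
    cases j with
    | inl s =>
      change _ =ᵐ[_] _
      filter_upwards [(mixedSplicing S p (gaussianReal 0 1)).avg_avg {Sum.inl s}ᶜ A hfm
        (hf.integrable one_le_two)] with ω h
      rw [h, Set.inter_eq_self_of_subset_right, sub_self]
      intro k hk hks
      exact hj (hks ▸ hk)
    | inr i => exact isPrimitive_avg_zero hj f
  sub {j f g D E} hfm hf hDm hD hgm hg hEm hE h h' := by
    cases j with
    | inl s =>
      change _ =ᵐ[_] _
      filter_upwards [h, h', (mixedSplicing S p (gaussianReal 0 1)).avg_sub {Sum.inl s}ᶜ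
        (hf.integrable one_le_two) (hg.integrable one_le_two)] with ω h1 h2 h3
      rw [h1, h2, h3]
      ring
    | inr i => exact IsPrimitive.sub hDm hD hEm hE h h'
  logSobolev {j f D θ m M} hfm hf hDm hD h hθ hb hm0 := by
    cases j with
    | inl s => exact ent_bit_le hp0 hp1 s hfm hf h hθ hb hm0
    | inr i => exact IsPrimitive.logSobolev hfm hDm hD h hθ hb hm0

lemma deltaBit_eq [DecidableEq S] (ν : Measure ℝ) [IsProbabilityMeasure ν]
    (f : (S → Bool) × (ℕ → ℝ) → ℝ) (s : S) :
    deltaBit p f s = fun ω => f ω - (mixedSplicing S p ν).avg {Sum.inl s}ᶜ f ω := by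
  funext ω
  rw [avg_compl_inl]
  rfl

lemma deltaReal_eq (ν : Measure ℝ) [IsProbabilityMeasure ν]
    {f : (S → Bool) × (ℕ → ℝ) → ℝ} (hf : Measurable f) (i : ℕ) :
    deltaReal ν f i = fun ω => f ω - (mixedSplicing S p ν).avg {Sum.inr i}ᶜ f ω := by
  funext ω
  rw [avg_compl_inr p ν i hf]
  rfl

lemma ofReal_integral_sq {Ω : Type*} [MeasurableSpace Ω] {μ : Measure Ω} {f : Ω → ℝ}
    (hf : MemLp f 2 μ) : ENNReal.ofReal (∫ ω, f ω ^ 2 ∂μ) = ∫⁻ ω, ‖f ω‖ₑ ^ 2 ∂μ := by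
  rw [ofReal_integral_eq_lintegral_ofReal hf.integrable_sq (.of_forall fun ω => sq_nonneg _)]
  refine lintegral_congr fun x => ?_
  rw [← sq_abs, ENNReal.ofReal_pow (abs_nonneg _), ← Real.norm_eq_abs, ofReal_norm]

lemma ofReal_integral_abs {Ω : Type*} [MeasurableSpace Ω] {μ : Measure Ω} {f : Ω → ℝ}
    (hf : Integrable f μ) : ENNReal.ofReal (∫ ω, |f ω| ∂μ) = ∫⁻ ω, ‖f ω‖ₑ ∂μ := by
  rw [ofReal_integral_eq_lintegral_ofReal hf.abs (.of_forall fun ω => abs_nonneg _)]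
  refine lintegral_congr fun x => ?_
  rw [← Real.norm_eq_abs, ofReal_norm]

lemma sum_le_toReal {ι : Type*} {T : ι → ℝ} (hT : ∀ j, 0 ≤ T j)
    (h : ∑' j, ENNReal.ofReal (T j) ≠ ∞) (s : Finset ι) :
    ∑ j ∈ s, T j ≤ (∑' j, ENNReal.ofReal (T j)).toReal := by
  rw [← ENNReal.ofReal_le_iff_le_toReal h, ENNReal.ofReal_sum_of_nonneg fun j _ => hT j]
  exact ENNReal.sum_le_tsum s

lemma tsum_sum_ennreal {α β : Type*} (T : α ⊕ β → ℝ≥0∞) :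
    ∑' j, T j = ∑' a, T (Sum.inl a) + ∑' b, T (Sum.inr b) :=
  Summable.tsum_sum ENNReal.summable ENNReal.summable

/-- From the family of linear inequalities to the logarithmic form. -/
lemma mul_log_div_le {V : ℝ} (hV : 0 ≤ V) {B E : ℝ≥0∞}
    (h : B ≠ ∞ → E ≠ ∞ → ∀ l > 0, (Real.log l + 1) * V ≤ E.toReal + l * B.toReal) :
    (ENNReal.ofReal V : EReal) * ENNReal.log (ENNReal.ofReal V / B) ≤ (E : EReal) := by
  rcases hV.eq_or_lt with rfl | hV
  · simp only [ENNReal.ofReal_zero, EReal.coe_ennreal_zero, zero_mul]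
    exact EReal.coe_ennreal_nonneg E
  have hVpos : (0 : EReal) < (ENNReal.ofReal V : EReal) := by
    rw [EReal.coe_ennreal_pos]; simpa using hV
  rcases eq_or_ne B ∞ with rfl | hB
  · rw [ENNReal.div_top, ENNReal.log_zero, EReal.mul_bot_of_pos hVpos]
    exact bot_le
  rcases eq_or_ne E ∞ with rfl | hE
  · simp
  have h := h hB hE
  rcases eq_or_ne B 0 with rfl | hB0
  -- With `B = 0` nothing limits `l`; this value of `l` gives `E + V ≤ E`. So zero influences with
  -- positive variance force infinite energy.
  · exfalso
    have := h (Real.exp (E.toReal / V)) (Real.exp_pos _)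
    rw [Real.log_exp, ENNReal.toReal_zero, mul_zero, add_mul, div_mul_cancel₀ _ hV.ne'] at this
    linarith
  have hBpos : 0 < B.toReal := ENNReal.toReal_pos hB0 hB
  -- The optimal `l`: the term `l B` equals `V` and cancels the extra `V` on the left.
  have h1 := h (V / B.toReal) (by positivity)
  rw [div_mul_cancel₀ _ hBpos.ne'] at h1
  have h2 : ENNReal.ofReal V / B = ENNReal.ofReal (V / B.toReal) := by
    rw [ENNReal.ofReal_div_of_pos hBpos, ENNReal.ofReal_toReal hB]
  rw [h2, ENNReal.log_ofReal_of_pos (by positivity), EReal.coe_ennreal_ofReal, max_eq_left hV.le,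
    ← EReal.coe_mul, ← EReal.coe_ennreal_toReal hE, EReal.coe_le_coe_iff]
  linarith

/-- The modified Poincaré inequality for the Gaussian measure, for measurable functions. -/
theorem gaussian_modified_poincare [Countable S] [DecidableEq S] (hp0 : 0 < (p : ℝ))
    (hp1 : (p : ℝ) < 1) {F : (S → Bool) × (ℕ → ℝ) → ℝ} (hm : Measurable F)
    (hF : MemLp F 2 (mixedProduct S p (gaussianReal 0 1))) {D : ℕ → (S → Bool) × (ℕ → ℝ) → ℝ}
    (hDm : ∀ i, Measurable (D i)) (hD : ∀ i, MemLp (D i) 2 (mixedProduct S p (gaussianReal 0 1)))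
    (hFD : ∀ i, IsPrimitive p (gaussianReal 0 1) i F (D i)) :
    (evariance F (mixedProduct S p (gaussianReal 0 1)) : EReal) *
      ENNReal.log (evariance F (mixedProduct S p (gaussianReal 0 1)) /
        sumInfluences p (gaussianReal 0 1) F) ≤
      ((ENNReal.ofReal (cLS p) *
        ∑' s : S, ∫⁻ ω, ‖deltaBit p F s ω‖ₑ ^ 2 ∂(mixedProduct S p (gaussianReal 0 1)) +
        2 * ∑' i : ℕ, ∫⁻ ω, ‖D i ω‖ₑ ^ 2 ∂(mixedProduct S p (gaussianReal 0 1)) : ℝ≥0∞) :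
          EReal) := by
  set μ := mixedProduct S p (gaussianReal 0 1)
  set sp := mixedSplicing S p (gaussianReal 0 1)
  have hc := cLS_nonneg hp0 hp1
  have hFi := hF.integrable one_le_two
  have hd : ∀ j, MemLp (fun ω => F ω - sp.avg {j}ᶜ F ω) 2 μ := fun j =>
    hF.sub (sp.memLp_avg _ hm hF)
  have hdm : ∀ j, Measurable (fun ω => F ω - sp.avg {j}ᶜ F ω) := fun j =>
    hm.sub (sp.measurable_avg _ hm)
  let 𝒟 : S ⊕ ℕ → (S → Bool) × (ℕ → ℝ) → ℝ :=
    Sum.elim (fun s ω => F ω - sp.avg {Sum.inl s}ᶜ F ω) D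
  let c : S ⊕ ℕ → ℝ := Sum.elim (fun _ => cLS p) (fun _ => 2)
  have hc0 : ∀ j, 0 ≤ c j := by rintro (s | i) <;> simp [c, hc]
  have h𝒟m : ∀ j, Measurable (𝒟 j) := by rintro (s | i); exacts [hdm _, hDm i]
  have h𝒟 : ∀ j, MemLp (𝒟 j) 2 μ := by rintro (s | i); exacts [hd _, hD i]
  have hR : ∀ j, MixedDeriv S p j F (𝒟 j) := by
    rintro (s | i); exacts [Filter.EventuallyEq.rfl, hFD i]
  have hE : ENNReal.ofReal (cLS p) * ∑' s : S, ∫⁻ ω, ‖deltaBit p F s ω‖ₑ ^ 2 ∂μ +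
      2 * ∑' i : ℕ, ∫⁻ ω, ‖D i ω‖ₑ ^ 2 ∂μ =
      ∑' j, ENNReal.ofReal (c j * ∫ ω, 𝒟 j ω ^ 2 ∂μ) := by
    rw [tsum_sum_ennreal, ← ENNReal.tsum_mul_left, ← ENNReal.tsum_mul_left]
    congr 1
    · refine tsum_congr fun s => ?_
      rw [ENNReal.ofReal_mul (hc0 _), ofReal_integral_sq (h𝒟 _), deltaBit_eq (gaussianReal 0 1)]
      rfl
    · refine tsum_congr fun i => ?_
      rw [ENNReal.ofReal_mul (hc0 _), ofReal_integral_sq (h𝒟 _)]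
      simp [c, 𝒟]
  have hB : sumInfluences p (gaussianReal 0 1) F =
      ∑' j, ENNReal.ofReal ((∫ ω, |F ω - sp.avg {j}ᶜ F ω| ∂μ) ^ 2) := by
    have h0 : ∀ j, ENNReal.ofReal ((∫ ω, |F ω - sp.avg {j}ᶜ F ω| ∂μ) ^ 2) =
        (∫⁻ ω, ‖F ω - sp.avg {j}ᶜ F ω‖ₑ ∂μ) ^ 2 := fun j => by
      rw [ENNReal.ofReal_pow (integral_nonneg fun ω => abs_nonneg _),
        ofReal_integral_abs ((hd j).integrable one_le_two)]
    simp only [h0]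
    rw [sumInfluences, tsum_sum_ennreal]
    congr 1
    · refine tsum_congr fun s => ?_
      rw [deltaBit_eq (gaussianReal 0 1)]
    · refine tsum_congr fun i => ?_
      rw [deltaReal_eq (p := p) (gaussianReal 0 1) hm]
  have hV : evariance F μ = ENNReal.ofReal (∫ ω, F ω ^ 2 ∂μ - (∫ ω, F ω ∂μ) ^ 2) := by
    rw [← ofReal_variance hF, variance_eq_sub hF]
    rfl
  have hV0 : 0 ≤ ∫ ω, F ω ^ 2 ∂μ - (∫ ω, F ω ∂μ) ^ 2 := by
    have := variance_nonneg F μ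
    rwa [variance_eq_sub hF] at this
  rw [hE, hB, hV]
  refine mul_log_div_le hV0 fun hB1 hE1 l hl => ?_
  -- The real coordinates make the index set infinite, so it is in bijection with `ℕ` even when `S`
  -- is finite or empty.
  obtain ⟨e⟩ : Nonempty ((S ⊕ ℕ) ≃ ℕ) := nonempty_equiv_of_countable
  exact (mixedDeriv_isDerivation hp0 hp1).modified_poincare sp hc0 e
    (mixedSplicing_generate p (gaussianReal 0 1)) hm hF h𝒟m h𝒟 hR
    (sum_le_toReal (fun j => mul_nonneg (hc0 j) (integral_nonneg fun ω => sq_nonneg _)) hE1)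
    (sum_le_toReal (fun j => sq_nonneg _) hB1) hl

end

/-! ### Weak derivatives on an open interval -/

lemma exists_subset_Ioo {I K : Set ℝ} (hI : IsOpen I) (hne : I.Nonempty) (hK : IsCompact K)
    (hKI : K ⊆ I) : ∃ a ∈ I, ∃ b ∈ I, a < b ∧ K ⊆ Set.Ioo a b := by
  obtain ⟨t, ht⟩ := hne
  -- Inserting a point of `I` covers the case of empty `K`.
  have hK' : IsCompact (insert t K) := hK.insert t
  have hne' : (insert t K).Nonempty := Set.insert_nonempty t K
  have hsub : insert t K ⊆ I := Set.insert_subset ht hKI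
  obtain ⟨l, hlK, hl⟩ := hK'.exists_isLeast hne'
  obtain ⟨r, hrK, hr⟩ := hK'.exists_isGreatest hne'
  obtain ⟨a, hal, haI⟩ := exists_Ioc_subset_of_mem_nhds (hI.mem_nhds (hsub hlK)) ⟨l - 1, by simp⟩
  obtain ⟨b, hrb, hbI⟩ := exists_Ico_subset_of_mem_nhds (hI.mem_nhds (hsub hrK)) ⟨r + 1, by simp⟩
  refine ⟨(a + l) / 2, haI ⟨by linarith, by linarith⟩, (r + b) / 2,
    hbI ⟨by linarith, by linarith⟩, ?_, fun x hx => ?_⟩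
  · have := hl (Set.mem_insert t K)
    have := hr (Set.mem_insert t K)
    linarith
  · have := hl (Set.mem_insert_of_mem t hx)
    have := hr (Set.mem_insert_of_mem t hx)
    exact ⟨by linarith, by linarith⟩

lemma intervalIntegrable_of_locallyIntegrableOn {I : Set ℝ} (hc : I.OrdConnected) {v : ℝ → ℝ}
    (hv : LocallyIntegrableOn v I) {a b : ℝ} (ha : a ∈ I) (hb : b ∈ I) :
    IntervalIntegrable v volume a b :=
  (hv.integrableOn_compact_subset (hc.uIcc_subset ha hb) isCompact_uIcc).intervalIntegrable

/-- Integration by parts for absolutely continuous functions on an interval containing the support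
of `φ`; the constant `u a` drops out because `deriv φ` has integral zero. -/
lemma hasWeakDerivOn_of_primitive {I : Set ℝ} (hI : IsOpen I) (hc : I.OrdConnected) {u v : ℝ → ℝ}
    (hv : LocallyIntegrableOn v I)
    (huv : ∀ a ∈ I, ∀ b ∈ I, u b - u a = ∫ t in a..b, v t) : HasWeakDerivOn I u v := by
  have hint : ∀ {a b}, a ∈ I → b ∈ I → IntervalIntegrable v volume a b := fun ha hb =>
    intervalIntegrable_of_locallyIntegrableOn hc hv ha hb
  have hcont : ContinuousOn u I := by
    intro x hx
    obtain ⟨a, ha, b, hb, hab, hsub⟩ := exists_subset_Ioo hI ⟨x, hx⟩ isCompact_singleton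
      (Set.singleton_subset_iff.2 hx)
    have hxab : x ∈ Set.Ioo a b := hsub rfl
    have h1 : ContinuousOn (fun t => ∫ s in a..t, v s) (Set.uIcc a b) :=
      intervalIntegral.continuousOn_primitive_interval' (hint ha hb) Set.left_mem_uIcc
    have h2 : ContinuousOn (fun t => u a + ∫ s in a..t, v s) (Set.Icc a b) := by
      rw [Set.uIcc_of_le hab.le] at h1
      exact continuousOn_const.add h1
    have h3 : ContinuousOn u (Set.Icc a b) := h2.congr fun t ht => by
      have := huv a ha t (hc.out ha hb ht)
      simp only
      linarith
    exact (h3.continuousAt (Icc_mem_nhds hxab.1 hxab.2)).continuousWithinAt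
  refine ⟨hcont.locallyIntegrableOn hI.measurableSet, hv, fun φ hφ hφc hφI => ?_⟩
  rcases I.eq_empty_or_nonempty with rfl | hne
  · have : φ = 0 := tsupport_eq_empty_iff.1 (Set.subset_empty_iff.1 hφI)
    simp [this]
  obtain ⟨a, ha, b, hb, hab, hsub⟩ := exists_subset_Ioo hI hne hφc hφI
  have hφz : ∀ t, t ∉ Set.Ioo a b → φ t = 0 := fun t ht =>
    image_eq_zero_of_notMem_tsupport fun h => ht (hsub h)
  have hs1 : Function.support (fun t => v t * φ t) ⊆ Set.Ioc a b := fun t ht =>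
    Set.Ioo_subset_Ioc_self (hsub (subset_tsupport _ (right_ne_zero_of_mul ht)))
  have hs2 : Function.support (fun t => deriv φ t * u t) ⊆ Set.Ioc a b := fun t ht =>
    Set.Ioo_subset_Ioc_self (hsub (support_deriv_subset (left_ne_zero_of_mul ht)))
  rw [← intervalIntegral.integral_eq_integral_of_support_subset hs1,
    ← intervalIntegral.integral_eq_integral_of_support_subset hs2]
  set U : ℝ → ℝ := fun t => ∫ s in a..t, v s
  have hU := (hint ha hb).absolutelyContinuousOnInterval_intervalIntegral Set.left_mem_uIcc
  have hφ' : AbsolutelyContinuousOnInterval φ a b :=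
    ((hφ.of_le (by exact_mod_cast le_top)).contDiffOn).absolutelyContinuousOnInterval
  have ibp := hU.integral_mul_deriv_eq_deriv_mul hφ'
  rw [hφz a (by simp), hφz b (by simp)] at ibp
  have hder : ∫ t in a..b, deriv U t * φ t = ∫ t in a..b, v t * φ t := by
    refine intervalIntegral.integral_congr_ae ?_
    filter_upwards [(hint ha hb).ae_hasDerivAt_integral] with t ht hmem
    rw [(ht (Set.uIoc_subset_uIcc hmem) a Set.left_mem_uIcc).deriv]
  have hz : ∫ t in a..b, deriv φ t = 0 := by
    rw [intervalIntegral.integral_deriv_eq_sub (fun t _ => (hφ.differentiable (by simp)) t)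
      ((hφ.continuous_deriv (by simp)).intervalIntegrable _ _), hφz a (by simp), hφz b (by simp),
      sub_zero]
  have hu : ∫ t in a..b, deriv φ t * u t = ∫ t in a..b, U t * deriv φ t := by
    have h1 : ∫ t in a..b, deriv φ t * u t =
        ∫ t in a..b, (U t * deriv φ t + u a * deriv φ t) := by
      refine intervalIntegral.integral_congr fun t ht => ?_
      have := huv a ha t (hc.uIcc_subset ha hb ht)
      simp only [U]
      rw [← this]; ring
    have hUc : ContinuousOn U (Set.uIcc a b) :=
      intervalIntegral.continuousOn_primitive_interval' (hint ha hb) Set.left_mem_uIcc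
    have hdc : Continuous (deriv φ) := hφ.continuous_deriv (by simp)
    have i1 : IntervalIntegrable (fun t => U t * deriv φ t) volume a b :=
      (hUc.mul hdc.continuousOn).intervalIntegrable
    have i2 : IntervalIntegrable (fun t => u a * deriv φ t) volume a b :=
      (continuous_const.mul hdc).intervalIntegrable _ _
    rw [h1, intervalIntegral.integral_add i1 i2, intervalIntegral.integral_const_mul, hz,
      mul_zero, add_zero]
  rw [hu]
  linarith

/-- The primitive from the left of the support vanishes again to its right exactly because the total
integral is zero. -/
lemma exists_deriv_eq_of_integral_eq_zero {I : Set ℝ} (hI : IsOpen I) (hc : I.OrdConnected)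
    (hne : I.Nonempty) {η : ℝ → ℝ} (hη : ContDiff ℝ ((⊤ : ℕ∞) : WithTop ℕ∞) η)
    (hηc : HasCompactSupport η) (hηI : tsupport η ⊆ I) (h0 : ∫ t, η t = 0) :
    ∃ φ : ℝ → ℝ, ContDiff ℝ ((⊤ : ℕ∞) : WithTop ℕ∞) φ ∧ HasCompactSupport φ ∧ tsupport φ ⊆ I ∧
      deriv φ = η := by
  obtain ⟨a, ha, b, hb, hab, hsub⟩ := exists_subset_Ioo hI hne hηc hηI
  have hηz : ∀ t, t ∉ Set.Ioo a b → η t = 0 := fun t ht =>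
    image_eq_zero_of_notMem_tsupport fun h => ht (hsub h)
  have hder : ∀ t, HasDerivAt (fun t => ∫ s in a..t, η s) (η t) t := fun t =>
    intervalIntegral.integral_hasDerivAt_right (hη.continuous.intervalIntegrable _ _)
      (hη.continuous.stronglyMeasurableAtFilter _ _) hη.continuous.continuousAt
  have hderiv : deriv (fun t => ∫ s in a..t, η s) = η := funext fun t => (hder t).deriv
  have hsupp : Function.support (fun t => ∫ s in a..t, η s) ⊆ Set.Icc a b := by
    intro t ht
    by_contra hn
    apply ht
    rcases not_and_or.1 hn with h | h
    · push Not at h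
      have : ∫ s in a..t, η s = ∫ s in a..t, (0 : ℝ) := by
        refine intervalIntegral.integral_congr fun s hs => ?_
        rw [Set.uIcc_of_ge h.le] at hs
        exact hηz s fun hs' => absurd hs'.1 (not_lt.2 hs.2)
      simpa using this
    · push Not at h
      have : Function.support η ⊆ Set.Ioc a t := fun s hs =>
        ⟨(hsub (subset_tsupport _ hs)).1, (hsub (subset_tsupport _ hs)).2.le.trans h.le⟩
      exact (intervalIntegral.integral_eq_integral_of_support_subset this).trans h0
  have hts : tsupport (fun t => ∫ s in a..t, η s) ⊆ Set.Icc a b :=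
    closure_minimal hsupp isClosed_Icc
  refine ⟨fun t => ∫ s in a..t, η s, ?_, HasCompactSupport.of_support_subset_isCompact
    isCompact_Icc hsupp, hts.trans (hc.out ha hb), hderiv⟩
  rw [contDiff_infty_iff_deriv, hderiv]
  exact ⟨fun t => (hder t).differentiableAt, hη⟩

lemma integrable_mul_of_tsupport_subset {I : Set ℝ} {η w : ℝ → ℝ}
    (hη : Continuous η) (hηc : HasCompactSupport η) (hηI : tsupport η ⊆ I)
    (hw : LocallyIntegrableOn w I) : Integrable fun t => η t * w t := by
  have h1 : IntegrableOn w (tsupport η) := hw.integrableOn_compact_subset hηI hηc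
  have h2 : IntegrableOn (fun t => η t * w t) (tsupport η) :=
    h1.continuousOn_mul hη.continuousOn hηc
  refine (integrableOn_iff_integrable_of_support_subset ?_).1 h2
  exact fun t ht => subset_tsupport _ (left_ne_zero_of_mul ht)

lemma HasWeakDerivOn.sub {I : Set ℝ} {u₁ v₁ u₂ v₂ : ℝ → ℝ} (h₁ : HasWeakDerivOn I u₁ v₁)
    (h₂ : HasWeakDerivOn I u₂ v₂) :
    HasWeakDerivOn I (fun t => u₁ t - u₂ t) (fun t => v₁ t - v₂ t) := by
  refine ⟨h₁.1.sub h₂.1, h₁.2.1.sub h₂.2.1, fun φ hφ hφc hφI => ?_⟩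
  have hd : Continuous (deriv φ) := hφ.continuous_deriv (by simp)
  have hdI : tsupport (deriv φ) ⊆ I := (closure_minimal support_deriv_subset
    (isClosed_tsupport φ)).trans hφI
  have e1 := h₁.2.2 φ hφ hφc hφI
  have e2 := h₂.2.2 φ hφ hφc hφI
  have i1 := integrable_mul_of_tsupport_subset hφ.continuous hφc hφI h₁.2.1
  have i2 := integrable_mul_of_tsupport_subset hφ.continuous hφc hφI h₂.2.1
  have i3 := integrable_mul_of_tsupport_subset hd hφc.deriv hdI h₁.1
  have i4 := integrable_mul_of_tsupport_subset hd hφc.deriv hdI h₂.1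
  simp only [mul_comm (φ _)] at i1 i2
  simp only [sub_mul, mul_sub]
  rw [integral_sub i1 i2, integral_sub i3 i4, e1, e2]
  ring

/-- The du Bois-Reymond argument: `w` annihilates derivatives of test functions, that is, test
functions of mean zero. -/
lemma HasWeakDerivOn.ae_eq_const {I : Set ℝ} (hI : IsOpen I) (hc : I.OrdConnected)
    (hne : I.Nonempty) {w : ℝ → ℝ} (hw : HasWeakDerivOn I w fun _ => 0) :
    ∃ c : ℝ, ∀ᵐ t, t ∈ I → w t = c := by
  obtain ⟨t₀, ht₀⟩ := hne
  obtain ⟨χ₀, hs, hcs, hd, hr, h1⟩ :=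
    exists_contDiff_tsupport_subset (n := ⊤) (hI.mem_nhds ht₀)
  have hpos : 0 < ∫ t, χ₀ t := by
    refine (hd.continuous.integral_pos_of_hasCompactSupport_nonneg_nonzero (μ := volume) hcs
      (fun t => (hr ⟨t, rfl⟩).1) (x := t₀) (by simp [h1]))
  set m := ∫ t, χ₀ t
  set c := m⁻¹ * ∫ t, χ₀ t * w t with hcdef
  refine ⟨c, ?_⟩
  have key : ∀ᵐ t, t ∈ I → (fun t => w t - c) t = 0 := by
    refine hI.ae_eq_zero_of_integral_contDiff_smul_eq_zero
      (hw.1.sub (locallyIntegrableOn_const c)) fun η hη hηc hηI => ?_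
    -- Subtracting this multiple of the fixed bump `χ₀` makes `η` of mean zero. The constant `c` is
    -- the mean of `w` weighted by `χ₀`.
    set a := (∫ t, η t) * m⁻¹ with ha
    have hζ : ContDiff ℝ ((⊤ : ℕ∞) : WithTop ℕ∞) (fun t => η t - a * χ₀ t) :=
      hη.sub (contDiff_const.mul hd)
    have hζc : HasCompactSupport (fun t => η t - a * χ₀ t) := hηc.sub (hcs.mul_left)
    have hζI : tsupport (fun t => η t - a * χ₀ t) ⊆ I := by
      refine (tsupport_sub η (fun t => a * χ₀ t)).trans (Set.union_subset hηI ?_)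
      exact (tsupport_mul_subset_right).trans hs
    have iη := hη.continuous.integrable_of_hasCompactSupport (μ := volume) hηc
    have iχ := hd.continuous.integrable_of_hasCompactSupport (μ := volume) hcs
    have hζ0 : ∫ t, (η t - a * χ₀ t) = 0 := by
      rw [integral_sub iη (iχ.const_mul a), integral_const_mul, ha]
      field_simp
      simp [m]
    obtain ⟨φ, hφ, hφc, hφI, hφd⟩ :=
      exists_deriv_eq_of_integral_eq_zero hI hc ⟨t₀, ht₀⟩ hζ hζc hζI hζ0
    have hz := hw.2.2 φ hφ hφc hφI
    simp only [zero_mul, integral_zero, hφd] at hz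
    have i1 := integrable_mul_of_tsupport_subset hη.continuous hηc hηI hw.1
    have i2 := integrable_mul_of_tsupport_subset hd.continuous hcs hs hw.1
    have hz' : ∫ t, (η t - a * χ₀ t) * w t = (∫ t, η t * w t) - a * ∫ t, χ₀ t * w t := by
      rw [← integral_const_mul, ← integral_sub i1 (i2.const_mul a)]
      exact integral_congr_ae (.of_forall fun t => by ring)
    have hg : ∫ t, η t • (w t - c) = (∫ t, η t * w t) - (∫ t, η t) * c := by
      rw [← integral_mul_const, ← integral_sub i1 (iη.mul_const c)]
      exact integral_congr_ae (.of_forall fun t => by simp only [smul_eq_mul]; ring)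
    rw [hg, hcdef]
    rw [hz', ha] at hz
    linarith
  filter_upwards [key] with t ht htI
  exact sub_eq_zero.1 (ht htI)

/-- A weakly differentiable function agrees almost everywhere with a primitive of its weak
derivative. -/
lemma HasWeakDerivOn.exists_ae_eq {I : Set ℝ} (hI : IsOpen I) (hc : I.OrdConnected)
    {u v : ℝ → ℝ} (h : HasWeakDerivOn I u v) {t₀ : ℝ} (ht₀ : t₀ ∈ I) :
    ∃ c : ℝ, ∀ᵐ t, t ∈ I → u t = c + ∫ s in t₀..t, v s := by
  have hint : ∀ {a b}, a ∈ I → b ∈ I → IntervalIntegrable v volume a b := fun ha hb =>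
    intervalIntegrable_of_locallyIntegrableOn hc h.2.1 ha hb
  have hU : HasWeakDerivOn I (fun t => ∫ s in t₀..t, v s) v :=
    hasWeakDerivOn_of_primitive hI hc h.2.1 fun a ha b hb =>
      intervalIntegral.integral_interval_sub_left (hint ht₀ hb) (hint ht₀ ha)
  have h0 := h.sub hU
  simp only [sub_self] at h0
  obtain ⟨c, hc'⟩ := h0.ae_eq_const hI hc ⟨t₀, ht₀⟩
  refine ⟨c, ?_⟩
  filter_upwards [hc'] with t ht htI
  linarith [ht htI]

/-- Weak derivatives are unique, even on a set which does not carry the whole interval. -/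
lemma HasWeakDerivOn.ae_eq_zero {I : Set ℝ} (hI : IsOpen I) (hc : I.OrdConnected) {u v : ℝ → ℝ}
    (h : HasWeakDerivOn I u v) : ∀ᵐ t, t ∈ I → u t = 0 → v t = 0 := by
  rcases I.eq_empty_or_nonempty with rfl | ⟨t₀, ht₀⟩
  · simp
  have hint : ∀ {a b}, a ∈ I → b ∈ I → IntervalIntegrable v volume a b := fun ha hb =>
    intervalIntegrable_of_locallyIntegrableOn hc h.2.1 ha hb
  obtain ⟨c, hu⟩ := h.exists_ae_eq hI hc ht₀
  set U : ℝ → ℝ := fun t => c + ∫ s in t₀..t, v s with hU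
  -- A zero of `U` where the derivative exists and is nonzero is isolated among the zeros, so the
  -- set of such points is locally null.
  have hnull : volume {t | t ∈ I ∧ U t = 0 ∧ HasDerivAt U (v t) t ∧ v t ≠ 0} = 0 := by
    refine measure_null_of_locally_null _ fun x hx => ?_
    refine ⟨{x}, ?_, by simp⟩
    have hev := hx.2.2.1.eventually_ne (c := 0) hx.2.2.2
    rw [mem_nhdsWithin_iff_eventually]
    filter_upwards [eventually_nhdsWithin_iff.1 hev] with y hy hyS
    by_contra hne
    exact hy hne hyS.2.1
  have hderiv : ∀ᵐ t, t ∈ I → HasDerivAt U (v t) t := by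
    have hloc : ∀ x ∈ I, ∃ n ∈ 𝓝[I] x, volume ({t | t ∈ I ∧ ¬ HasDerivAt U (v t) t} ∩ n) = 0 := by
      intro x hx
      obtain ⟨a, ha, b, hb, hab, hsub⟩ := exists_subset_Ioo hI ⟨t₀, ht₀⟩
        ((Set.toFinite {x, t₀}).isCompact) (by
          rintro y (rfl | rfl)
          · exact hx
          · exact ht₀)
      have hx' := hsub (Set.mem_insert x {t₀})
      have ht' := hsub (Set.mem_insert_of_mem x rfl)
      refine ⟨Set.Ioo a b, mem_nhdsWithin_of_mem_nhds (Ioo_mem_nhds hx'.1 hx'.2), ?_⟩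
      have hd := (hint ha hb).ae_hasDerivAt_integral
      refine measure_mono_null ?_ (ae_iff.1 hd)
      rintro t ⟨⟨-, hnd⟩, htab⟩
      simp only [Set.mem_ofPred_eq]
      intro hcon
      apply hnd
      rw [Set.uIcc_of_le hab.le] at hcon
      exact (hcon (Set.Ioo_subset_Icc_self htab) t₀ (Set.Ioo_subset_Icc_self ht')).const_add c
    have : volume {t | t ∈ I ∧ ¬ HasDerivAt U (v t) t} = 0 := by
      refine measure_null_of_locally_null _ fun x hx => ?_
      obtain ⟨n, hn, hn0⟩ := hloc x hx.1
      refine ⟨{t | t ∈ I ∧ ¬ HasDerivAt U (v t) t} ∩ n, ?_, hn0⟩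
      exact inter_mem self_mem_nhdsWithin (nhdsWithin_mono _ (fun t ht => ht.1) hn)
    rw [ae_iff]
    refine measure_mono_null ?_ this
    intro t ht
    simpa using ht
  have hnull' : ∀ᵐ t, ¬ (t ∈ I ∧ U t = 0 ∧ HasDerivAt U (v t) t ∧ v t ≠ 0) := by
    rw [ae_iff]
    simpa using hnull
  filter_upwards [hnull', hderiv, hu] with t h1 h2 h3 htI hut
  by_contra hv
  exact h1 ⟨htI, (h3 htI).symm.trans hut, h2 htI, hv⟩

/-! ### Primitives and almost everywhere equality of slices -/

section

variable {S : Type*} {p : unitInterval}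

lemma ae_ae_realSlice {ν : Measure ℝ} [IsProbabilityMeasure ν] (i : ℕ)
    {P : (S → Bool) × (ℕ → ℝ) → Prop} (h : ∀ᵐ ω ∂(mixedProduct S p ν), P ω) :
    ∀ᵐ ω ∂(mixedProduct S p ν), ∀ᵐ t ∂ν, P (ω.1, Function.update ω.2 i t) :=
  Measure.ae_ae_of_ae_prod ((measurePreserving_update_real p ν i).quasiMeasurePreserving.ae h)

lemma ae_realSlice_ae_eq {ν : Measure ℝ} [IsProbabilityMeasure ν] (i : ℕ)
    {f g : (S → Bool) × (ℕ → ℝ) → ℝ} (h : f =ᵐ[mixedProduct S p ν] g) :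
    ∀ᵐ ω ∂(mixedProduct S p ν), realSlice f i ω =ᵐ[ν] realSlice g i ω :=
  ae_ae_realSlice i h

/-- This direction of Fubini needs a measurable equality set, hence the passage to measurable
representatives. -/
lemma ae_eq_of_realSlice_ae_eq {ν : Measure ℝ} [IsProbabilityMeasure ν] (i : ℕ)
    {f g : (S → Bool) × (ℕ → ℝ) → ℝ} (hf : AEStronglyMeasurable f (mixedProduct S p ν))
    (hg : AEStronglyMeasurable g (mixedProduct S p ν))
    (h : ∀ᵐ ω ∂(mixedProduct S p ν), realSlice f i ω =ᵐ[ν] realSlice g i ω) :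
    f =ᵐ[mixedProduct S p ν] g := by
  obtain ⟨f', hf', hff'⟩ := hf
  obtain ⟨g', hg', hgg'⟩ := hg
  have hmeas : MeasurableSet {ω | f' ω = g' ω} :=
    measurableSet_eq_fun hf'.measurable hg'.measurable
  have hmk : f' =ᵐ[mixedProduct S p ν] g' := by
    have hu := measurePreserving_update_real (S := S) p ν i
    rw [EventuallyEq, ← hu.map_eq, ae_map_iff hu.measurable.aemeasurable hmeas]
    have hmeas' : MeasurableSet {q : ((S → Bool) × (ℕ → ℝ)) × ℝ |
        f' (q.1.1, Function.update q.1.2 i q.2) = g' (q.1.1, Function.update q.1.2 i q.2)} :=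
      hu.measurable hmeas
    rw [Measure.ae_prod_iff_ae_ae hmeas']
    filter_upwards [h, ae_realSlice_ae_eq i hff', ae_realSlice_ae_eq i hgg'] with ω h1 h2 h3
    exact h2.symm.trans (h1.trans h3)
  exact hff'.trans (hmk.trans hgg'.symm)

/-- Makes the set defining `IsPrimitive` measurable, so that a slicewise statement can be assembled
into a joint one. -/
lemma measurable_intervalIntegral_realSlice {D : (S → Bool) × (ℕ → ℝ) → ℝ} (hD : Measurable D)
    (i : ℕ) : Measurable fun q : ((S → Bool) × (ℕ → ℝ)) × (ℝ × ℝ) =>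
      ∫ r in q.2.1..q.2.2, realSlice D i q.1 r := by
  have hDs : Measurable fun z : (((S → Bool) × (ℕ → ℝ)) × (ℝ × ℝ)) × ℝ =>
      realSlice D i z.1.1 z.2 :=
    hD.comp (by fun_prop : Measurable fun z : (((S → Bool) × (ℕ → ℝ)) × (ℝ × ℝ)) × ℝ =>
      (z.1.1.1, Function.update z.1.1.2 i z.2))
  have key : ∀ {a b : ℝ × ℝ → ℝ}, Measurable a → Measurable b →
      Measurable fun q : ((S → Bool) × (ℕ → ℝ)) × (ℝ × ℝ) =>
        ∫ r in Set.Ioc (a q.2) (b q.2), realSlice D i q.1 r := by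
    intro a b ha hb
    have hs : MeasurableSet ({z : (((S → Bool) × (ℕ → ℝ)) × (ℝ × ℝ)) × ℝ | a z.1.2 < z.2} ∩
        {z | z.2 ≤ b z.1.2}) :=
      (measurableSet_lt (by fun_prop) (by fun_prop)).inter
        (measurableSet_le (by fun_prop) (by fun_prop))
    have h := (hDs.indicator hs).stronglyMeasurable.integral_prod_right' (ν := volume)
    simp only [← integral_indicator measurableSet_Ioc]
    exact h.measurable
  exact (key measurable_fst measurable_snd).sub (key measurable_snd measurable_fst)

/-- The slices of `F` agree almost everywhere with primitives of the slices of `D`. -/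
def HasPrimitiveSlices (p : unitInterval) (i : ℕ) (F D : (S → Bool) × (ℕ → ℝ) → ℝ) : Prop :=
  ∀ᵐ ω ∂(mixedProduct S p (gaussianReal 0 1)), LocallyIntegrable (realSlice D i ω) ∧
    ∃ c : ℝ, ∀ᵐ t ∂(gaussianReal 0 1), realSlice F i ω t = c + ∫ r in (0 : ℝ)..t, realSlice D i ω r

/-- Gaussian and Lebesgue null sets agree, so a measurable representative has locally integrable
slices and remains a weak derivative of almost every slice. -/
lemma MemGaussSobolev.exists_hasPrimitiveSlices {F : (S → Bool) × (ℕ → ℝ) → ℝ}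
    (hF : MemGaussSobolev p F) (i : ℕ) : ∃ D : (S → Bool) × (ℕ → ℝ) → ℝ, Measurable D ∧
      MemLp D 2 (mixedProduct S p (gaussianReal 0 1)) ∧ HasPrimitiveSlices p i F D := by
  have hvol : (volume : Measure ℝ) ≪ gaussianReal 0 1 :=
    gaussianReal_absolutelyContinuous' 0 one_ne_zero
  have hgau : gaussianReal 0 1 ≪ (volume : Measure ℝ) :=
    gaussianReal_absolutelyContinuous 0 one_ne_zero
  obtain ⟨D, hD, h⟩ := hF.2 i
  refine ⟨hD.1.mk D, hD.1.stronglyMeasurable_mk.measurable, hD.ae_eq hD.1.ae_eq_mk, ?_⟩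
  filter_upwards [h, ae_realSlice_ae_eq i hD.1.ae_eq_mk] with ω h h2
  have h2v : realSlice D i ω =ᵐ[volume] realSlice (hD.1.mk D) i ω := hvol.ae_le h2
  refine ⟨locallyIntegrableOn_univ.1 (h.2.1.congr (ae_restrict_of_ae h2v)), ?_⟩
  obtain ⟨c, hc⟩ := h.exists_ae_eq isOpen_univ Set.ordConnected_univ (Set.mem_univ 0)
  refine ⟨c, ?_⟩
  filter_upwards [hgau.ae_le hc] with t ht
  rw [ht (Set.mem_univ t)]
  congr 1
  exact intervalIntegral.integral_congr_ae (by filter_upwards [h2v] with r hr _ using hr)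

/-- The unknown constant of each slice cancels in increments. -/
lemma HasPrimitiveSlices.isPrimitive {i : ℕ} {F F' D : (S → Bool) × (ℕ → ℝ) → ℝ}
    (h : HasPrimitiveSlices p i F D) (hF' : Measurable F') (hD : Measurable D)
    (hFF' : F =ᵐ[mixedProduct S p (gaussianReal 0 1)] F') :
    IsPrimitive p (gaussianReal 0 1) i F' D := by
  have hFs : Measurable fun z : ((S → Bool) × (ℕ → ℝ)) × ℝ => realSlice F' i z.1 z.2 :=
    hF'.comp (by fun_prop : Measurable fun z : ((S → Bool) × (ℕ → ℝ)) × ℝ =>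
      (z.1.1, Function.update z.1.2 i z.2))
  have hmeas : MeasurableSet {q : ((S → Bool) × (ℕ → ℝ)) × (ℝ × ℝ) |
      realSlice F' i q.1 q.2.2 - realSlice F' i q.1 q.2.1 =
        ∫ r in q.2.1..q.2.2, realSlice D i q.1 r} :=
    measurableSet_eq_fun
      ((hFs.comp (by fun_prop : Measurable fun q : ((S → Bool) × (ℕ → ℝ)) × (ℝ × ℝ) =>
        (q.1, q.2.2))).sub
      (hFs.comp (by fun_prop : Measurable fun q : ((S → Bool) × (ℕ → ℝ)) × (ℝ × ℝ) =>
        (q.1, q.2.1)))) (measurable_intervalIntegral_realSlice hD i)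
  rw [IsPrimitive, Measure.ae_prod_iff_ae_ae hmeas]
  filter_upwards [h, ae_realSlice_ae_eq i hFF'] with ω ⟨hloc, c, hc⟩ h1
  have hint : ∀ a b, IntervalIntegrable (realSlice D i ω) volume a b := fun a b =>
    (hloc.integrableOn_isCompact isCompact_uIcc).intervalIntegrable
  have hmeas' : MeasurableSet {y : ℝ × ℝ |
      realSlice F' i ω y.2 - realSlice F' i ω y.1 = ∫ r in y.1..y.2, realSlice D i ω r} :=
    measurable_prodMk_left hmeas
  rw [Measure.ae_prod_iff_ae_ae hmeas']
  filter_upwards [hc, h1] with s hs hs1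
  filter_upwards [hc, h1] with t ht ht1
  rw [← hs1, ← ht1, hs, ht, ← intervalIntegral.integral_interval_sub_left (hint 0 t) (hint 0 s)]
  ring

lemma deltaBit_ae_eq [DecidableEq S] {ν : Measure ℝ} [IsProbabilityMeasure ν]
    {f g : (S → Bool) × (ℕ → ℝ) → ℝ} (h : f =ᵐ[mixedProduct S p ν] g) (s : S) :
    deltaBit p f s =ᵐ[mixedProduct S p ν] deltaBit p g s := by
  filter_upwards [h, Measure.ae_ae_of_ae_prod
    ((measurePreserving_update_bit p ν s).quasiMeasurePreserving.ae h)] with ω h1 h2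
  simp only [deltaBit]
  rw [h1, integral_congr_ae h2]

lemma deltaReal_ae_eq {ν : Measure ℝ} [IsProbabilityMeasure ν]
    {f g : (S → Bool) × (ℕ → ℝ) → ℝ} (h : f =ᵐ[mixedProduct S p ν] g) (i : ℕ) :
    deltaReal ν f i =ᵐ[mixedProduct S p ν] deltaReal ν g i := by
  filter_upwards [h, ae_realSlice_ae_eq i h] with ω h1 h2
  simp only [deltaReal]
  rw [h1, integral_congr_ae h2]

/-- The modified Poincaré inequality for the Gaussian measure. -/
theorem HasPrimitiveSlices.modified_poincare [Countable S] [DecidableEq S] (hp0 : 0 < (p : ℝ))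
    (hp1 : (p : ℝ) < 1) {F : (S → Bool) × (ℕ → ℝ) → ℝ}
    (hF : MemLp F 2 (mixedProduct S p (gaussianReal 0 1))) {D : ℕ → (S → Bool) × (ℕ → ℝ) → ℝ}
    (hDm : ∀ i, Measurable (D i)) (hD : ∀ i, MemLp (D i) 2 (mixedProduct S p (gaussianReal 0 1)))
    (hFD : ∀ i, HasPrimitiveSlices p i F (D i)) :
    (evariance F (mixedProduct S p (gaussianReal 0 1)) : EReal) *
      ENNReal.log (evariance F (mixedProduct S p (gaussianReal 0 1)) /
        sumInfluences p (gaussianReal 0 1) F) ≤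
      ((ENNReal.ofReal (cLS p) *
        ∑' s : S, ∫⁻ ω, ‖deltaBit p F s ω‖ₑ ^ 2 ∂(mixedProduct S p (gaussianReal 0 1)) +
        2 * ∑' i : ℕ, ∫⁻ ω, ‖D i ω‖ₑ ^ 2 ∂(mixedProduct S p (gaussianReal 0 1)) : ℝ≥0∞) :
          EReal) := by
  have hm := hF.1.stronglyMeasurable_mk.measurable
  have hae := hF.1.ae_eq_mk
  have h := gaussian_modified_poincare hp0 hp1 hm (hF.ae_eq hae) hDm hD
    fun i => (hFD i).isPrimitive hm (hDm i) hae
  have e1 : sumInfluences p (gaussianReal 0 1) F =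
      sumInfluences p (gaussianReal 0 1) (hF.1.mk F) := by
    simp only [sumInfluences]
    congr 1
    · exact tsum_congr fun s => congrArg (· ^ 2) (lintegral_congr_ae (by
        filter_upwards [deltaBit_ae_eq hae s] with ω h; rw [h]))
    · exact tsum_congr fun s => congrArg (· ^ 2) (lintegral_congr_ae (by
        filter_upwards [deltaReal_ae_eq hae s] with ω h; rw [h]))
  have e2 : ∀ s, ∫⁻ ω, ‖deltaBit p F s ω‖ₑ ^ 2 ∂(mixedProduct S p (gaussianReal 0 1)) =
      ∫⁻ ω, ‖deltaBit p (hF.1.mk F) s ω‖ₑ ^ 2 ∂(mixedProduct S p (gaussianReal 0 1)) := fun s =>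
    lintegral_congr_ae (by filter_upwards [deltaBit_ae_eq hae s] with ω h; rw [h])
  rw [e1, evariance_congr hae]
  simpa only [e2] using h

end

/-! ### The transport of the Gaussian measure -/

section

/-- `μ` is the measure on the line with density `d`. -/
structure IsDensity (μ : Measure ℝ) (d : ℝ → ℝ) : Prop where
  measurable : Measurable d
  nonneg : ∀ t, 0 ≤ d t
  eq : μ = volume.withDensity fun t => ENNReal.ofReal (d t)

namespace IsDensity

variable {μ : Measure ℝ} {d : ℝ → ℝ}

lemma absolutelyContinuous (h : IsDensity μ d) : μ ≪ volume :=
  h.eq ▸ withDensity_absolutelyContinuous _ _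

lemma ae_pos (h : IsDensity μ d) : ∀ᵐ t ∂μ, 0 < d t := by
  rw [h.eq, ae_withDensity_iff h.measurable.ennreal_ofReal]
  exact .of_forall fun t ht => by simpa using ht

lemma integrableOn_iff (h : IsDensity μ d) {A : Set ℝ} (hA : MeasurableSet A) {k : ℝ → ℝ} :
    IntegrableOn k A μ ↔ IntegrableOn (fun y => k y * d y) A := by
  rw [h.eq, IntegrableOn, restrict_withDensity hA,
    integrable_withDensity_iff_integrable_smul' h.measurable.ennreal_ofReal (by simp)]
  simp only [ENNReal.toReal_ofReal (h.nonneg _), smul_eq_mul, mul_comm (d _)]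
  rfl

lemma setIntegral_eq (h : IsDensity μ d) {A : Set ℝ} (hA : MeasurableSet A) (k : ℝ → ℝ) :
    ∫ y in A, k y ∂μ = ∫ y in A, k y * d y := by
  rw [h.eq, restrict_withDensity hA,
    integral_withDensity_eq_integral_toReal_smul h.measurable.ennreal_ofReal (by simp)]
  simp only [ENNReal.toReal_ofReal (h.nonneg _), smul_eq_mul, mul_comm (d _)]

lemma integrable [IsFiniteMeasure μ] (h : IsDensity μ d) : Integrable d := by
  have := (h.integrableOn_iff MeasurableSet.univ (k := fun _ => 1)).1
    (integrable_const 1).integrableOn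
  simpa using this

lemma setIntegral_Iic [IsProbabilityMeasure μ] (h : IsDensity μ d) (t : ℝ) :
    ∫ u in Set.Iic t, d u = cdf μ t := by
  have := h.setIntegral_eq (measurableSet_Iic (a := t)) fun _ => 1
  rw [cdf_eq_real]
  simpa using this.symm

lemma continuous_cdf [IsProbabilityMeasure μ] (h : IsDensity μ d) : Continuous (cdf μ) := by
  have h1 : ∀ t, cdf μ t = cdf μ 0 + ∫ u in (0 : ℝ)..t, d u := fun t => by
    rw [← intervalIntegral.integral_Iic_sub_Iic h.integrable.integrableOn h.integrable.integrableOn,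
      h.setIntegral_Iic, h.setIntegral_Iic]
    ring
  rw [funext h1]
  exact continuous_const.add (intervalIntegral.continuous_primitive
    (fun a b => h.integrable.intervalIntegrable) 0)

/-- There is no mass on the negative half line and no atom at `0`; for negative `t` the oriented
integral gives `0` as well. -/
lemma cdfOf_eq [IsProbabilityMeasure μ] (h : IsDensity μ d) (h0 : μ (Set.Iio 0) = 0) :
    cdfOf d = cdf μ := by
  have hz : cdf μ 0 = 0 := by
    rw [cdf_eq_real, measureReal_def]
    have : μ (Set.Iic 0) = 0 := by
      rw [← Set.Iio_union_right]
      exact measure_union_null h0 (h.absolutelyContinuous (by simp))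
    simp [this]
  funext t
  rw [cdfOf, ← intervalIntegral.integral_Iic_sub_Iic h.integrable.integrableOn
    h.integrable.integrableOn, h.setIntegral_Iic, h.setIntegral_Iic, hz, sub_zero]

end IsDensity

lemma gaussDensity_eq : gaussDensity = gaussianPDFReal 0 1 := by
  funext x
  simp [gaussDensity, gaussianPDFReal]

lemma gaussDensity_pos (x : ℝ) : 0 < gaussDensity x := by
  rw [gaussDensity_eq]; exact gaussianPDFReal_pos _ _ _ one_ne_zero

lemma isDensity_gaussian : IsDensity (gaussianReal 0 1) gaussDensity where
  measurable := gaussDensity_eq ▸ measurable_gaussianPDFReal 0 1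
  nonneg x := (gaussDensity_pos x).le
  eq := by
    rw [gaussDensity_eq, gaussianReal_of_var_ne_zero _ one_ne_zero]
    rfl

lemma gaussCDF_eq : gaussCDF = cdf (gaussianReal 0 1) :=
  funext fun t => isDensity_gaussian.setIntegral_Iic t

lemma gaussCDF_strictMono : StrictMono gaussCDF := by
  have : (gaussianReal 0 1).IsOpenPosMeasure :=
    (gaussianReal_absolutelyContinuous' 0 one_ne_zero).isOpenPosMeasure
  intro x y hxy
  rw [gaussCDF_eq, cdf_eq_real, cdf_eq_real]
  have h1 : 0 < (gaussianReal 0 1).real (Set.Ioc x y) := by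
    rw [measureReal_def, ENNReal.toReal_pos_iff]
    refine ⟨?_, measure_lt_top _ _⟩
    exact (Measure.measure_Ioo_pos _ |>.2 hxy).trans_le (measure_mono Set.Ioo_subset_Ioc_self)
  have h2 : (gaussianReal 0 1).real (Set.Iic y) =
      (gaussianReal 0 1).real (Set.Iic x) + (gaussianReal 0 1).real (Set.Ioc x y) := by
    rw [← measureReal_union (Set.Iic_disjoint_Ioc le_rfl) measurableSet_Ioc,
      Set.Iic_union_Ioc_eq_Iic hxy.le]
  linarith

lemma gaussCDF_mem (z : ℝ) : gaussCDF z ∈ Set.Ioo (0 : ℝ) 1 := by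
  constructor
  · refine lt_of_le_of_lt ?_ (gaussCDF_strictMono (sub_one_lt z))
    rw [gaussCDF_eq]; exact cdf_nonneg _ _
  · refine lt_of_lt_of_le (gaussCDF_strictMono (lt_add_one z)) ?_
    rw [gaussCDF_eq]; exact cdf_le_one _ _

section genInv

variable {μ : Measure ℝ} {t : ℝ}

lemma le_cdf_genInv (hc : Continuous (cdf μ)) (ht : t ∈ Set.Ioo (0 : ℝ) 1) :
    t ≤ cdf μ (genInv (cdf μ) t) := by
  have hne : {x | t ≤ cdf μ x}.Nonempty :=
    (((tendsto_cdf_atTop μ).eventually (lt_mem_nhds ht.2)).exists).imp fun x hx => hx.le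
  obtain ⟨y, hy⟩ := ((tendsto_cdf_atBot μ).eventually (gt_mem_nhds ht.1)).exists
  have hbdd : BddBelow {x | t ≤ cdf μ x} := ⟨y, fun x hx => by
    by_contra hlt
    exact absurd (hy.trans_le hx) (not_lt.2 (monotone_cdf μ (not_le.1 hlt).le))⟩
  exact (isClosed_le continuous_const hc).csInf_mem hne hbdd

lemma genInv_cdf_le_iff (hc : Continuous (cdf μ)) (ht : t ∈ Set.Ioo (0 : ℝ) 1) {c : ℝ} :
    genInv (cdf μ) t ≤ c ↔ t ≤ cdf μ c := by
  obtain ⟨y, hy⟩ := ((tendsto_cdf_atBot μ).eventually (gt_mem_nhds ht.1)).exists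
  have hbdd : BddBelow {x | t ≤ cdf μ x} := ⟨y, fun x hx => by
    by_contra hlt
    exact absurd (hy.trans_le hx) (not_lt.2 (monotone_cdf μ (not_le.1 hlt).le))⟩
  exact ⟨fun h => (le_cdf_genInv hc ht).trans (monotone_cdf μ h), fun h => csInf_le hbdd h⟩

/-- Left of the infimum the distribution function is below `t`; continuity carries this to the
infimum, where it is at least `t`. Strict monotonicity plays no role, so `h` may vanish on
intervals. -/
lemma cdf_genInv (hc : Continuous (cdf μ)) (ht : t ∈ Set.Ioo (0 : ℝ) 1) :
    cdf μ (genInv (cdf μ) t) = t := by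
  refine le_antisymm ?_ (le_cdf_genInv hc ht)
  refine le_of_tendsto (hc.continuousWithinAt (s := Set.Iio (genInv (cdf μ) t))) ?_
  filter_upwards [self_mem_nhdsWithin] with x hx
  exact (not_le.1 fun h => not_lt.2 ((genInv_cdf_le_iff hc ht).2 h) hx).le

end genInv

/-- The inverse `G⁻¹ ∘ H` of the transport. -/
noncomputable def cotransport (h : ℝ → ℝ) (y : ℝ) : ℝ := genInv gaussCDF (cdfOf h y)

lemma gaussCDF_genInv {t : ℝ} (ht : t ∈ Set.Ioo (0 : ℝ) 1) : gaussCDF (genInv gaussCDF t) = t := by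
  rw [gaussCDF_eq]
  exact cdf_genInv isDensity_gaussian.continuous_cdf ht

lemma genInv_gaussCDF (z : ℝ) : genInv gaussCDF (gaussCDF z) = z :=
  gaussCDF_strictMono.injective (gaussCDF_genInv (gaussCDF_mem z))

/-- The open interval `{0 < H < 1}`. -/
def cdfSupport (h : ℝ → ℝ) : Set ℝ := {t | 0 < cdfOf h t ∧ cdfOf h t < 1}

namespace IsDensity

variable {ν : Measure ℝ} [IsProbabilityMeasure ν] {h : ℝ → ℝ}

lemma cdfOf_transport (hd : IsDensity ν h) (h0 : ν (Set.Iio 0) = 0) (z : ℝ) :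
    cdfOf h (transport h z) = gaussCDF z := by
  rw [transport, hd.cdfOf_eq h0]
  exact cdf_genInv hd.continuous_cdf (gaussCDF_mem z)

lemma transport_le_iff (hd : IsDensity ν h) (h0 : ν (Set.Iio 0) = 0) {z c : ℝ} :
    transport h z ≤ c ↔ gaussCDF z ≤ cdfOf h c := by
  rw [transport, hd.cdfOf_eq h0]
  exact genInv_cdf_le_iff hd.continuous_cdf (gaussCDF_mem z)

lemma cotransport_transport (hd : IsDensity ν h) (h0 : ν (Set.Iio 0) = 0) (z : ℝ) :
    cotransport h (transport h z) = z := by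
  rw [cotransport, hd.cdfOf_transport h0, genInv_gaussCDF]

lemma transport_mem (hd : IsDensity ν h) (h0 : ν (Set.Iio 0) = 0) (z : ℝ) :
    transport h z ∈ cdfSupport h := by
  rw [cdfSupport, Set.mem_ofPred_eq, hd.cdfOf_transport h0]
  exact gaussCDF_mem z

lemma measurable_transport (hd : IsDensity ν h) (h0 : ν (Set.Iio 0) = 0) :
    Measurable (transport h) := by
  refine measurable_of_Iic fun c => ?_
  have : transport h ⁻¹' Set.Iic c = {z | gaussCDF z ≤ cdfOf h c} :=
    Set.ext fun z => hd.transport_le_iff h0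
  rw [this]
  exact measurableSet_le gaussCDF_strictMono.monotone.measurable measurable_const

/-- A measurable injection of the line into itself, with left inverse `cotransport`. Being an
embedding, it transfers integrals and almost everywhere statements without any measurability of `f`.
-/
lemma measurableEmbedding_transport (hd : IsDensity ν h) (h0 : ν (Set.Iio 0) = 0) :
    MeasurableEmbedding (transport h) :=
  (hd.measurable_transport h0).measurableEmbedding
    (Function.LeftInverse.injective (hd.cotransport_transport h0))

lemma gaussCDF_cotransport {y : ℝ} (hy : y ∈ cdfSupport h) :
    gaussCDF (cotransport h y) = cdfOf h y := gaussCDF_genInv hy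

lemma transport_le_iff_le_cotransport (hd : IsDensity ν h) (h0 : ν (Set.Iio 0) = 0) {z y : ℝ}
    (hy : y ∈ cdfSupport h) : transport h z ≤ y ↔ z ≤ cotransport h y := by
  rw [hd.transport_le_iff h0, ← gaussCDF_cotransport hy, gaussCDF_strictMono.le_iff_le]

/-- Comparison of distribution functions. The levels `0` and `1` are treated apart, since the
Gaussian quantile is an inverse only strictly between them. -/
lemma map_transport (hd : IsDensity ν h) (h0 : ν (Set.Iio 0) = 0) :
    (gaussianReal 0 1).map (transport h) = ν := by
  have hm := hd.measurable_transport h0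
  have : IsProbabilityMeasure ((gaussianReal 0 1).map (transport h)) :=
    Measure.isProbabilityMeasure_map hm.aemeasurable
  refine Measure.eq_of_cdf _ _ (StieltjesFunction.ext fun c => ?_)
  rw [cdf_eq_real, map_measureReal_apply hm measurableSet_Iic]
  have hp : transport h ⁻¹' Set.Iic c = {z | gaussCDF z ≤ cdf ν c} :=
    Set.ext fun z => (hd.transport_le_iff h0).trans (by rw [hd.cdfOf_eq h0]; rfl)
  rw [hp]
  rcases (cdf_nonneg ν c).eq_or_lt with hc0 | hc0
  · have : {z | gaussCDF z ≤ cdf ν c} = ∅ := Set.eq_empty_of_forall_notMem fun z hz =>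
      absurd (gaussCDF_mem z).1 (not_lt.2 (hz.trans hc0.ge))
    rw [this, ← hc0]; simp
  rcases (cdf_le_one ν c).eq_or_lt with hc1 | hc1
  · have : {z | gaussCDF z ≤ cdf ν c} = Set.univ :=
      Set.eq_univ_of_forall fun z => (gaussCDF_mem z).2.le.trans hc1.ge
    rw [this, hc1]; simp
  · have : {z | gaussCDF z ≤ cdf ν c} = Set.Iic (genInv gaussCDF (cdf ν c)) := Set.ext fun z => by
      rw [Set.mem_Iic, ← gaussCDF_strictMono.le_iff_le, gaussCDF_genInv ⟨hc0, hc1⟩]; rfl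
    rw [this, ← cdf_eq_real, ← gaussCDF_eq, gaussCDF_genInv ⟨hc0, hc1⟩]

lemma ae_iff_transport (hd : IsDensity ν h) (h0 : ν (Set.Iio 0) = 0) {P : ℝ → Prop} :
    (∀ᵐ y ∂ν, P y) ↔ ∀ᵐ z ∂(gaussianReal 0 1), P (transport h z) := by
  conv_lhs => rw [← hd.map_transport h0]
  exact (hd.measurableEmbedding_transport h0).ae_map_iff

lemma isOpen_cdfSupport (hd : IsDensity ν h) (h0 : ν (Set.Iio 0) = 0) : IsOpen (cdfSupport h) := by
  rw [cdfSupport, hd.cdfOf_eq h0]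
  exact (isOpen_lt continuous_const hd.continuous_cdf).inter
    (isOpen_lt hd.continuous_cdf continuous_const)

lemma ordConnected_cdfSupport (hd : IsDensity ν h) (h0 : ν (Set.Iio 0) = 0) :
    (cdfSupport h).OrdConnected := by
  rw [cdfSupport, hd.cdfOf_eq h0]
  exact ⟨fun a ha b hb y hy => ⟨ha.1.trans_le (monotone_cdf ν hy.1),
    (monotone_cdf ν hy.2).trans_lt hb.2⟩⟩

lemma ae_mem_cdfSupport (hd : IsDensity ν h) (h0 : ν (Set.Iio 0) = 0) :
    ∀ᵐ y ∂ν, y ∈ cdfSupport h :=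
  (hd.ae_iff_transport h0).2 (.of_forall (hd.transport_mem h0))

/-- The derivative of `U ∘ G⁻¹ ∘ H`, if `w` is the derivative of `U`. -/
lemma setIntegral_cotransport (hd : IsDensity ν h) (h0 : ν (Set.Iio 0) = 0) {w : ℝ → ℝ}
    (hw : LocallyIntegrable w) {a b : ℝ} (ha : a ∈ cdfSupport h) (hb : b ∈ cdfSupport h) :
    IntegrableOn (fun y => w (cotransport h y) / gaussDensity (cotransport h y) * h y)
      (Set.Ioc a b) ∧
    ∫ y in Set.Ioc a b, w (cotransport h y) / gaussDensity (cotransport h y) * h y =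
      ∫ z in Set.Ioc (cotransport h a) (cotransport h b), w z := by
  have hemb := hd.measurableEmbedding_transport h0
  have hpre : transport h ⁻¹' Set.Ioc a b = Set.Ioc (cotransport h a) (cotransport h b) := by
    ext z
    simp only [Set.mem_preimage, Set.mem_Ioc, ← not_le,
      hd.transport_le_iff_le_cotransport h0 ha, hd.transport_le_iff_le_cotransport h0 hb]
  have hcancel : ∀ z, w z / gaussDensity z * gaussDensity z = w z := fun z =>
    div_mul_cancel₀ _ (gaussDensity_pos z).ne'
  constructor
  · rw [← hd.integrableOn_iff measurableSet_Ioc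
      (k := fun y => w (cotransport h y) / gaussDensity (cotransport h y)),
      ← hd.map_transport h0, hemb.integrableOn_map_iff, hpre]
    have : (fun y => w (cotransport h y) / gaussDensity (cotransport h y)) ∘ transport h =
        fun z => w z / gaussDensity z := funext fun z => by
      simp only [Function.comp, hd.cotransport_transport h0]
    rw [this, isDensity_gaussian.integrableOn_iff measurableSet_Ioc]
    simp only [hcancel]
    exact (hw.integrableOn_isCompact isCompact_Icc).mono_set Set.Ioc_subset_Icc_self
  · rw [← hd.setIntegral_eq measurableSet_Ioc
      (fun y => w (cotransport h y) / gaussDensity (cotransport h y)),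
      ← hd.map_transport h0, hemb.setIntegral_map, hpre]
    simp only [hd.cotransport_transport h0]
    rw [isDensity_gaussian.setIntegral_eq measurableSet_Ioc]
    simp only [hcancel]

/-- The chain rule comes from the change of variables in `setIntegral_cotransport`, without
differentiating `G⁻¹ ∘ H`. -/
lemma hasWeakDerivOn_cotransport (hd : IsDensity ν h) (h0 : ν (Set.Iio 0) = 0) {w : ℝ → ℝ}
    (hw : LocallyIntegrable w) (c : ℝ) :
    HasWeakDerivOn (cdfSupport h) (fun y => c + ∫ r in (0 : ℝ)..cotransport h y, w r)
      (fun y => w (cotransport h y) / gaussDensity (cotransport h y) * h y) := by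
  have hI := hd.isOpen_cdfSupport h0
  have hc := hd.ordConnected_cdfSupport h0
  refine hasWeakDerivOn_of_primitive hI hc ?_ ?_
  · intro x hx
    obtain ⟨a, ha, b, hb, -, hsub⟩ := exists_subset_Ioo hI ⟨x, hx⟩ isCompact_singleton
      (Set.singleton_subset_iff.2 hx)
    have hxab : x ∈ Set.Ioo a b := hsub rfl
    exact ⟨Set.Ioc a b, mem_nhdsWithin_of_mem_nhds (Ioc_mem_nhds hxab.1 hxab.2),
      (hd.setIntegral_cotransport h0 hw ha hb).1⟩
  · intro a ha b hb
    have hint : ∀ a b, IntervalIntegrable w volume a b := fun a b =>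
      (hw.integrableOn_isCompact isCompact_uIcc).intervalIntegrable
    rw [add_sub_add_left_eq_sub, intervalIntegral.integral_interval_sub_left (hint _ _) (hint _ _),
      intervalIntegral, intervalIntegral, (hd.setIntegral_cotransport h0 hw ha hb).2,
      (hd.setIntegral_cotransport h0 hw hb ha).2]

end IsDensity

end

/-! ### Transport on the mixed product -/

section

variable {S : Type*} {p : unitInterval} {ν : Measure ℝ} [IsProbabilityMeasure ν] {h : ℝ → ℝ}

/-- The transport of all the real coordinates. -/
noncomputable def transportMap (h : ℝ → ℝ) (ω : (S → Bool) × (ℕ → ℝ)) : (S → Bool) × (ℕ → ℝ) :=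
  (ω.1, fun i => transport h (ω.2 i))

lemma transportMap_update (ω : (S → Bool) × (ℕ → ℝ)) (i : ℕ) (z : ℝ) :
    transportMap h (ω.1, Function.update ω.2 i z) =
      ((transportMap h ω).1, Function.update (transportMap h ω).2 i (transport h z)) := by
  refine Prod.ext rfl (funext fun j => ?_)
  by_cases hj : j = i
  · subst hj; simp [transportMap]
  · simp [transportMap, hj]

lemma realSlice_transportMap (f : (S → Bool) × (ℕ → ℝ) → ℝ) (i : ℕ) (ω : (S → Bool) × (ℕ → ℝ))
    (z : ℝ) : realSlice f i (transportMap h ω) (transport h z) =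
      realSlice (fun ω => f (transportMap h ω)) i ω z := by
  simp only [realSlice, transportMap_update]

namespace IsDensity

lemma measurable_transportMap (hd : IsDensity ν h) (h0 : ν (Set.Iio 0) = 0) :
    Measurable (transportMap (S := S) h) := by
  have := hd.measurable_transport h0
  unfold transportMap
  fun_prop

/-- Countability of `S` makes the whole space standard Borel, so a measurable injection is an
embedding. -/
lemma measurableEmbedding_transportMap [Countable S] (hd : IsDensity ν h)
    (h0 : ν (Set.Iio 0) = 0) : MeasurableEmbedding (transportMap (S := S) h) := by
  refine (hd.measurable_transportMap h0).measurableEmbedding fun ω ω' hω => ?_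
  refine Prod.ext (congrArg Prod.fst hω :) (funext fun i => ?_)
  exact (hd.measurableEmbedding_transport h0).injective (congrFun (congrArg Prod.snd hω) i :)

lemma map_transportMap (hd : IsDensity ν h) (h0 : ν (Set.Iio 0) = 0) :
    (mixedProduct S p (gaussianReal 0 1)).map (transportMap h) = mixedProduct S p ν := by
  have hm := hd.measurable_transport h0
  have h1 : MeasurePreserving (fun (z : ℕ → ℝ) i => transport h (z i))
      (Measure.infinitePi fun _ => gaussianReal 0 1) (Measure.infinitePi fun _ => ν) := by
    refine ⟨by fun_prop, ?_⟩
    rw [Measure.infinitePi_map_pi (fun _ : ℕ => gaussianReal 0 1) (fun _ => hm)]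
    simp only [hd.map_transport h0]
  exact ((MeasurePreserving.id (bernoulliPi S p)).prod h1).map_eq

lemma ae_iff_transportMap [Countable S] (hd : IsDensity ν h) (h0 : ν (Set.Iio 0) = 0)
    {P : (S → Bool) × (ℕ → ℝ) → Prop} : (∀ᵐ ω ∂(mixedProduct S p ν), P ω) ↔
      ∀ᵐ ω ∂(mixedProduct S p (gaussianReal 0 1)), P (transportMap h ω) := by
  conv_lhs => rw [← hd.map_transportMap h0]
  exact (hd.measurableEmbedding_transportMap h0).ae_map_iff

lemma lintegral_transportMap [Countable S] (hd : IsDensity ν h) (h0 : ν (Set.Iio 0) = 0)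
    (f : (S → Bool) × (ℕ → ℝ) → ℝ≥0∞) : ∫⁻ ω, f ω ∂(mixedProduct S p ν) =
      ∫⁻ ω, f (transportMap h ω) ∂(mixedProduct S p (gaussianReal 0 1)) := by
  conv_lhs => rw [← hd.map_transportMap h0]
  exact (hd.measurableEmbedding_transportMap h0).lintegral_map f

lemma integral_transportMap [Countable S] (hd : IsDensity ν h) (h0 : ν (Set.Iio 0) = 0)
    (f : (S → Bool) × (ℕ → ℝ) → ℝ) : ∫ ω, f ω ∂(mixedProduct S p ν) =
      ∫ ω, f (transportMap h ω) ∂(mixedProduct S p (gaussianReal 0 1)) := by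
  conv_lhs => rw [← hd.map_transportMap h0]
  exact (hd.measurableEmbedding_transportMap h0).integral_map f

lemma memLp_transportMap_iff [Countable S] (hd : IsDensity ν h) (h0 : ν (Set.Iio 0) = 0)
    {f : (S → Bool) × (ℕ → ℝ) → ℝ} : MemLp f 2 (mixedProduct S p ν) ↔
      MemLp (fun ω => f (transportMap h ω)) 2 (mixedProduct S p (gaussianReal 0 1)) := by
  conv_lhs => rw [← hd.map_transportMap h0]
  exact (hd.measurableEmbedding_transportMap h0).memLp_map_measure_iff

lemma aestronglyMeasurable_transportMap_iff [Countable S] (hd : IsDensity ν h)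
    (h0 : ν (Set.Iio 0) = 0) {f : (S → Bool) × (ℕ → ℝ) → ℝ} :
    AEStronglyMeasurable f (mixedProduct S p ν) ↔
      AEStronglyMeasurable (fun ω => f (transportMap h ω))
        (mixedProduct S p (gaussianReal 0 1)) := by
  conv_lhs => rw [← hd.map_transportMap h0]
  exact (hd.measurableEmbedding_transportMap h0).aestronglyMeasurable_map_iff

lemma evariance_transportMap [Countable S] (hd : IsDensity ν h) (h0 : ν (Set.Iio 0) = 0)
    (f : (S → Bool) × (ℕ → ℝ) → ℝ) : evariance f (mixedProduct S p ν) =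
      evariance (fun ω => f (transportMap h ω)) (mixedProduct S p (gaussianReal 0 1)) := by
  rw [evariance, evariance, hd.lintegral_transportMap h0, hd.integral_transportMap h0]

lemma deltaReal_transportMap (hd : IsDensity ν h) (h0 : ν (Set.Iio 0) = 0)
    (f : (S → Bool) × (ℕ → ℝ) → ℝ) (i : ℕ) (ω : (S → Bool) × (ℕ → ℝ)) :
    deltaReal ν f i (transportMap h ω) =
      deltaReal (gaussianReal 0 1) (fun ω => f (transportMap h ω)) i ω := by
  simp only [deltaReal, ← realSlice_transportMap]
  conv_lhs => rw [← hd.map_transport h0, (hd.measurableEmbedding_transport h0).integral_map]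

lemma sumInfluences_transportMap [Countable S] [DecidableEq S] (hd : IsDensity ν h)
    (h0 : ν (Set.Iio 0) = 0) (f : (S → Bool) × (ℕ → ℝ) → ℝ) : sumInfluences p ν f =
      sumInfluences p (gaussianReal 0 1) (fun ω => f (transportMap h ω)) := by
  simp only [sumInfluences, hd.lintegral_transportMap h0, hd.deltaReal_transportMap h0]
  rfl

/-- In almost all directions of the coordinate `i`, `f` is a primitive composed with `G⁻¹ ∘ H`. -/
lemma realSlice_ae_eq_cotransport (hd : IsDensity ν h) (h0 : ν (Set.Iio 0) = 0)
    {f : (S → Bool) × (ℕ → ℝ) → ℝ} {i : ℕ} {ω : (S → Bool) × (ℕ → ℝ)} {U : ℝ → ℝ}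
    (hU : ∀ᵐ z ∂(gaussianReal 0 1), realSlice (fun ω => f (transportMap h ω)) i ω z = U z) :
    realSlice f i (transportMap h ω) =ᵐ[ν] fun y => U (cotransport h y) := by
  rw [EventuallyEq, hd.ae_iff_transport h0]
  filter_upwards [hU] with z hz
  rw [realSlice_transportMap, hz, hd.cotransport_transport h0]

/-- The witness is the chain rule formula for `D` composed with `G⁻¹ ∘ H`. Its measurability is
checked after transport, where `cotransport` cancels. -/
lemma exists_isPartialDeriv [Countable S] (hd : IsDensity ν h) (h0 : ν (Set.Iio 0) = 0)
    {f D : (S → Bool) × (ℕ → ℝ) → ℝ} {i : ℕ} (hD : Measurable D)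
    (hfD : HasPrimitiveSlices p i (fun ω => f (transportMap h ω)) D) :
    ∃ E : (S → Bool) × (ℕ → ℝ) → ℝ, IsPartialDeriv p ν h f i E := by
  refine ⟨fun ω => D (ω.1, fun j => cotransport h (ω.2 j)) /
    gaussDensity (cotransport h (ω.2 i)) * h (ω.2 i), ?_, ?_⟩
  · rw [hd.aestronglyMeasurable_transportMap_iff h0]
    simp only [transportMap, hd.cotransport_transport h0]
    have h1 := hd.measurable
    have h2 := hd.measurable_transport h0
    have h3 := isDensity_gaussian.measurable
    exact (by fun_prop : Measurable fun ω : (S → Bool) × (ℕ → ℝ) =>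
      D (ω.1, fun j => ω.2 j) / gaussDensity (ω.2 i) * h (transport h (ω.2 i))).aestronglyMeasurable
  · rw [hd.ae_iff_transportMap h0]
    filter_upwards [hfD] with ω ⟨hloc, c, hc⟩
    refine ⟨_, _, hd.hasWeakDerivOn_cotransport h0 hloc c,
      hd.realSlice_ae_eq_cotransport h0 hc, .of_forall fun y => ?_⟩
    have : (fun j => cotransport h (Function.update (transportMap h ω).2 i y j)) =
        Function.update ω.2 i (cotransport h y) := by
      funext j
      by_cases hj : j = i
      · subst hj; simp
      · simp [hj, transportMap, hd.cotransport_transport h0]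
    simp only [realSlice, this, Function.update_self]
    rfl

/-- Any partial derivative is compared with the one given by the chain rule. Their primitives agree
`ν`-almost everywhere, hence so do the derivatives by `HasWeakDerivOn.ae_eq_zero`, and `ψ` cancels
the factor `h / g` wherever `h > 0`, which is `ν`-almost everywhere. -/
lemma weightedGrad_ae_eq [Countable S] (hd : IsDensity ν h) (h0 : ν (Set.Iio 0) = 0)
    {f D : (S → Bool) × (ℕ → ℝ) → ℝ} {E : ℕ → (S → Bool) × (ℕ → ℝ) → ℝ} {i : ℕ}
    (hD : Measurable D) (hfD : HasPrimitiveSlices p i (fun ω => f (transportMap h ω)) D)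
    (hE : IsPartialDeriv p ν h f i (E i)) :
    (fun ω => weightedGrad h E i (transportMap h ω))
      =ᵐ[mixedProduct S p (gaussianReal 0 1)] D := by
  have hw : ∀ z, weight h (transport h z) = gaussDensity z / h (transport h z) := fun z => by
    rw [weight, ← cotransport, hd.cotransport_transport h0]
  refine ae_eq_of_realSlice_ae_eq i ?_ hD.aestronglyMeasurable ?_
  · have h1 := hd.measurable
    have h2 := hd.measurable_transport h0
    have h3 := isDensity_gaussian.measurable
    have e : (fun ω : (S → Bool) × (ℕ → ℝ) => weightedGrad h E i (transportMap h ω)) =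
        fun ω => gaussDensity (ω.2 i) / h (transport h (ω.2 i)) * E i (transportMap h ω) :=
      funext fun ω => by
        rw [← hw]
        rfl
    rw [e]
    exact (by fun_prop : Measurable fun ω : (S → Bool) × (ℕ → ℝ) =>
      gaussDensity (ω.2 i) / h (transport h (ω.2 i))).aestronglyMeasurable.mul
      ((hd.aestronglyMeasurable_transportMap_iff h0).1 hE.1)
  · filter_upwards [hfD, (hd.ae_iff_transportMap h0).1 hE.2] with ω ⟨hloc, c, hc⟩ ⟨u, v, huv, hu, hv⟩
    have h1 := huv.sub (hd.hasWeakDerivOn_cotransport h0 hloc c)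
    have h2 := hd.absolutelyContinuous.ae_le
      (h1.ae_eq_zero (hd.isOpen_cdfSupport h0) (hd.ordConnected_cdfSupport h0))
    have h3 : ∀ᵐ y ∂ν, weight h y * realSlice (E i) i (transportMap h ω) y =
        realSlice D i ω (cotransport h y) := by
      filter_upwards [h2, hd.ae_mem_cdfSupport h0, hd.ae_pos, hu, hv,
        hd.realSlice_ae_eq_cotransport h0 hc] with y h2 hy hpos hu hv hf
      -- Both primitives equal the slice of `f` at `y`, so their difference vanishes there, and with
      -- it the difference of the derivatives.
      have h4 := h2 hy (by rw [← hu, hf, sub_self])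
      rw [hv, sub_eq_zero.1 h4, weight, ← cotransport]
      have := gaussDensity_pos (cotransport h y)
      field_simp
    filter_upwards [(hd.ae_iff_transport h0).1 h3] with z hz
    rw [hd.cotransport_transport h0] at hz
    rw [← hz]
    simp only [realSlice, weightedGrad, transportMap_update, Function.update_self]

end IsDensity

end

end ModifiedPoincare

theorem mainTheorem10 {S : Type*} [Countable S] [DecidableEq S]
    (p : unitInterval) (hp0 : 0 < (p : ℝ)) (hp1 : (p : ℝ) < 1)
    (ν : Measure ℝ) [IsProbabilityMeasure ν] (hν : ν (Set.Iio 0) = 0)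
    (h : ℝ → ℝ) (h_meas : Measurable h) (h_nonneg : ∀ t, 0 ≤ h t)
    (hνh : ν = volume.withDensity (fun t => ENNReal.ofReal (h t)))
    (f : (S → Bool) × (ℕ → ℝ) → ℝ)
    (hf : MemGaussSobolev p
      (fun ω : (S → Bool) × (ℕ → ℝ) => f (ω.1, fun i => transport h (ω.2 i)))) :
    MemLp f 2 (mixedProduct S p ν) ∧
    (∀ i : ℕ, ∃ D : (S → Bool) × (ℕ → ℝ) → ℝ, IsPartialDeriv p ν h f i D) ∧
    ∀ D : ℕ → (S → Bool) × (ℕ → ℝ) → ℝ, (∀ i : ℕ, IsPartialDeriv p ν h f i (D i)) →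
      (∀ i : ℕ, MemLp (weightedGrad h D i) 2 (mixedProduct S p ν)) ∧
      (evariance f (mixedProduct S p ν) : EReal) *
          ENNReal.log (evariance f (mixedProduct S p ν) / sumInfluences p ν f) ≤
        (energy p ν h f D : EReal) := by
  have hd : IsDensity ν h := ⟨h_meas, h_nonneg, hνh⟩
  change MemGaussSobolev p fun ω => f (transportMap h ω) at hf
  choose E hEm hE hfE using hf.exists_hasPrimitiveSlices
  refine ⟨(hd.memLp_transportMap_iff hν).2 hf.1,
    fun i => hd.exists_isPartialDeriv hν (hEm i) (hfE i), fun D hD => ?_⟩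
  have hae := fun i => hd.weightedGrad_ae_eq hν (hEm i) (hfE i) (hD i)
  refine ⟨fun i => (hd.memLp_transportMap_iff hν).2 ((hE i).ae_eq (hae i).symm), ?_⟩
  have key := HasPrimitiveSlices.modified_poincare hp0 hp1 hf.1 hEm hE hfE
  have hgrad : ∀ i, ∫⁻ ω, ‖weightedGrad h D i (transportMap h ω)‖ₑ ^ 2
      ∂(mixedProduct S p (gaussianReal 0 1)) =
      ∫⁻ ω, ‖E i ω‖ₑ ^ 2 ∂(mixedProduct S p (gaussianReal 0 1)) := fun i =>
    lintegral_congr_ae (by filter_upwards [hae i] with ω hω; rw [hω])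
  rw [hd.evariance_transportMap hν, hd.sumInfluences_transportMap hν, energy]
  simp only [hd.lintegral_transportMap hν, hgrad]
  exact key
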